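/- Let $K$ be a field with $4^2=16$ elements, and let $\mathrm{H}(3,4^2)$ be the Hermitian space of all totally isotropic points and lines of $\mathrm{PG}(3,K)$ with respect to the Hermitian form $h(x,y)=x_1y_2^4+x_2y_1^4+x_3y_4^4+x_4y_3^4$. Let $\mathrm{W}(3,4)$ be the embedded symplectic quadrangle, whose points are the points of $\mathrm{PG}(3,K)$ spanned by a nonzero vector with all coordinates in $\mathrm{GF}(4)=\{a\in K: a^4=a\}$ (on such vectors $h$ is an alternating form). An external point is a point of $\mathrm{H}(3,4^2)$ not in $\mathrm{W}(3,4)$, and an external line is a line of $\mathrm{H}(3,4^2)$ containing no point of $\mathrm{W}(3,4)$. A relative hemisystem of $\mathrm{H}(3,4^2)$ (with respect to $\mathrm{W}(3,4)$) is a set $\mathcal R$ of external lines such that, for every external point $P$, exactly half of the external lines through $P$ belong to $\mathcal R$. Two sets of lines are equivalent if one is mapped to the other by a collineation of $\mathrm{H}(3,4^2)$ (induced by a bijective semilinear map of $K^4$ preserving $h$ up to a nonzero scalar and a field automorphism) that stabilises $\mathrm{W}(3,4)$. For $\upsilon\in K$ with $\upsilon^4+\upsilon=1$, let $\mathcal Q^+_\upsilon$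 be the hyperbolic quadric $x_1^2+\upsilon^{5}x_2^2+x_1x_2+x_3x_4=0$ of $\mathrm{PG}(3,K)$, whose two reguli are $$\mathscr R_1=\{\langle(\upsilon^4,1,0,\lambda),(\lambda\upsilon,\lambda,1,0)\rangle:\lambda\in K\}\cup\{\langle(0,0,0,1),(\upsilon,1,0,0)\rangle\},$$ $$\mathscr R_2=\{\langle(\upsilon^4,1,\lambda,0),(\lambda\upsilon,\lambda,0,1)\rangle:\lambda\in K\}\cup\{\langle(0,0,1,0),(\upsilon,1,0,0)\rangle\}.$$ The quadric $\mathcal Q^+_\upsilon$ meets $\mathrm{H}(3,4^2)$ in an elliptic quadric of $\mathrm{W}(3,4)$. Let $\mathrm{P}\Omega^-(4,4)$ be the group of projectivities (collineations of $\mathrm{PG}(3,K)$ induced by invertible linear maps) that are induced by linear maps preserving $h$ up to a nonzero scalar and that stabilise each of $\mathscr R_1$ and $\mathscr R_2$. A Penttila–Williford example is an orbit of this group, for some such $\upsilon$, on the set of external lines. Proposition. There are exactly $240$ relative hemisystems of $\mathrm{H}(3,4^2)$. Penttila–Williford examples exist, each of them is a relative hemisystem, and every relative hemisystem of $\mathrm{H}(3,4^2)$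 is equivalent to every Penttila–Williford example. -/

import Mathlib

namespace RelHemi

variable {K : Type*} [Field K]

/-- The Hermitian form `x₁y₂^q + x₂y₁^q + x₃y₄^q + x₄y₃^q` on `K⁴`, where `K = GF(q²)` and `q` is
a power of two. -/
def hermForm (q : ℕ) (x y : Fin 4 → K) : K :=
  x 0 * y 1 ^ q + x 1 * y 0 ^ q + x 2 * y 3 ^ q + x 3 * y 2 ^ q

/-- The points of `H(3,q²)`: the totally isotropic points of `PG(3,q²)`. -/
def hermPoints (q : ℕ) : Set (Submodule K (Fin 4 → K)) :=
  {P | Module.finrank K P = 1 ∧ ∀ x ∈ P, ∀ y ∈ P, hermForm q x y = 0}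

/-- The lines of `H(3,q²)`: the totally isotropic lines of `PG(3,q²)`. -/
def hermLines (q : ℕ) : Set (Submodule K (Fin 4 → K)) :=
  {l | Module.finrank K l = 2 ∧ ∀ x ∈ l, ∀ y ∈ l, hermForm q x y = 0}

/-- The points of the embedded `W(3,q)`: the points of `PG(3,q²)` that are spanned by a vector
with coordinates in `GF(q) = {a | a^q = a}`. On such vectors the Hermitian form restricts to the
alternating form `x₁y₂ + x₂y₁ + x₃y₄ + x₄y₃`, so all these points are totally isotropic. -/
def sympPoints (q : ℕ) : Set (Submodule K (Fin 4 → K)) :=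
  {P | ∃ v : Fin 4 → K, v ≠ 0 ∧ (∀ i, v i ^ q = v i) ∧ P = Submodule.span K {v}}

/-- The external points: points of `H(3,q²)` outside `W(3,q)`. -/
def externalPoints (q : ℕ) : Set (Submodule K (Fin 4 → K)) :=
  {P | P ∈ hermPoints q ∧ P ∉ sympPoints q}

/-- The external lines: lines of `H(3,q²)` that contain no point of `W(3,q)`. -/
def externalLines (q : ℕ) : Set (Submodule K (Fin 4 → K)) :=
  {l | l ∈ hermLines q ∧ ∀ P ∈ sympPoints q, ¬ P ≤ l}

/-- Relative hemisystems of `H(3,q²)` with respect to `W(3,q)`: sets of external lines that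
contain exactly half of the external lines through each external point. -/
def IsRelativeHemisystem (q : ℕ) (R : Set (Submodule K (Fin 4 → K))) : Prop :=
  R ⊆ externalLines q ∧
    ∀ P ∈ externalPoints q,
      2 * {l | l ∈ R ∧ P ≤ l}.ncard = {l | l ∈ externalLines q ∧ P ≤ l}.ncard

/-- Equivalence of sets of lines: some collineation of `H(3,q²)`, induced by a bijective semilinear
map `g` that preserves the Hermitian form up to a nonzero scalar and a field automorphism, fixes
`W(3,q)` setwise and maps `R` to `R'`. -/
def Equivalent (q : ℕ) (R R' : Set (Submodule K (Fin 4 → K))) : Prop :=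
  ∃ (σ : K ≃+* K) (g : (Fin 4 → K) →ₛₗ[(σ : K →+* K)] (Fin 4 → K)),
    Function.Bijective g ∧
    (∃ c : K, c ≠ 0 ∧ ∀ x y, hermForm q (g x) (g y) = c * σ (hermForm q x y)) ∧
    Submodule.map g '' sympPoints q = sympPoints q ∧
    Submodule.map g '' R = R'

/-- For `υ^q + υ = 1`: the first regulus of the hyperbolic quadric
`x₁² + υ^(q+1) x₂² + x₁x₂ + x₃x₄ = 0` of `PG(3,q²)`, which meets `H(3,q²)` in an elliptic quadric
of `W(3,q)`. -/
def regulusOne (q : ℕ) (υ : K) : Set (Submodule K (Fin 4 → K)) :=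
  {l | (∃ t : K, l = Submodule.span K {![υ ^ q, 1, 0, t], ![t * υ, t, 1, 0]}) ∨
    l = Submodule.span K {![0, 0, 0, 1], ![υ, 1, 0, 0]}}

/-- The opposite regulus of the same hyperbolic quadric. -/
def regulusTwo (q : ℕ) (υ : K) : Set (Submodule K (Fin 4 → K)) :=
  {l | (∃ t : K, l = Submodule.span K {![υ ^ q, 1, t, 0], ![t * υ, t, 0, 1]}) ∨
    l = Submodule.span K {![0, 0, 1, 0], ![υ, 1, 0, 0]}}

/-- The linear maps that induce the elements of `PΩ⁻(4,q)`: the projectivities that stabilise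
`H(3,q²)` and each of the two reguli of the hyperbolic quadric. -/
def omegaMinus (q : ℕ) (υ : K) : Set ((Fin 4 → K) ≃ₗ[K] (Fin 4 → K)) :=
  {g | (∃ c : K, c ≠ 0 ∧ ∀ x y, hermForm q (g x) (g y) = c * hermForm q x y) ∧
    Submodule.map (g : (Fin 4 → K) →ₗ[K] (Fin 4 → K)) '' regulusOne q υ = regulusOne q υ ∧
    Submodule.map (g : (Fin 4 → K) →ₗ[K] (Fin 4 → K)) '' regulusTwo q υ = regulusTwo q υ}

/-- The Penttila–Williford sets of lines: the orbits of `PΩ⁻(4,q)` on external lines. -/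
def IsPenttilaWilliford (q : ℕ) (R : Set (Submodule K (Fin 4 → K))) : Prop :=
  ∃ υ : K, υ ^ q + υ = 1 ∧ ∃ l ∈ externalLines q,
    R = {m | ∃ g ∈ omegaMinus q υ, m = Submodule.map (g : (Fin 4 → K) →ₗ[K] (Fin 4 → K)) l}

end RelHemi

namespace RelHemi

/-- Table-driven multiplication of `GF(16)`, an element being coded by the bits of a number:
bit `i` is the coefficient of `υ ^ i`, where `υ ^ 4 = υ + 1`. -/
def mulCode (a b : ℕ) : ℕ :=
  Nat.mod (Nat.shiftRight 116196760129267793630862849262464326346044543732748708940920453221664288556434379745879494961270582141731748813355742142288220638766218855867759359510984593843506004200114943278699875244065120512813025380665946106619127097398772031257643617143689515450995722003729973585221105779229319991106539050771048038400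
    (Nat.mul 4 (Nat.add (Nat.mul 16 (Nat.mod a 16)) (Nat.mod b 16)))) 16

/-- Multiplication of a code by `υ`. -/
def shiftCode (a : ℕ) : ℕ := bif a.testBit 3 then (2 * a) ^^^ 19 else 2 * a

/-- Multiplication of codes, computed digit by digit. -/
def slowMulCode (a b : ℕ) : ℕ :=
  (bif b.testBit 0 then a else 0) ^^^ (bif b.testBit 1 then shiftCode a else 0) ^^^
    (bif b.testBit 2 then shiftCode (shiftCode a) else 0) ^^^
    (bif b.testBit 3 then shiftCode (shiftCode (shiftCode a)) else 0)

theorem mulCode_eq_slowMulCode :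
    ∀ a < 16, ∀ b < 16, mulCode a b = slowMulCode a b % 16 := by
  decide +kernel

theorem exists_mulCode_eq_one : ∀ a < 16, a ≠ 0 → ∃ b < 16, mulCode a b = 1 := by
  decide +kernel

section Decode

variable {K : Type*} [Field K]

/-- The element of `K` with a given code. -/
def dec (υ : K) (n : ℕ) : K :=
  (bif n.testBit 0 then 1 else 0) + (bif n.testBit 1 then υ else 0) +
    (bif n.testBit 2 then υ ^ 2 else 0) + (bif n.testBit 3 then υ ^ 3 else 0)

variable {υ : K}

@[simp] theorem dec_zero : dec υ 0 = 0 := by simp [dec]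

@[simp] theorem dec_one : dec υ 1 = 1 := by
  simp [dec, show Nat.testBit 1 1 = false from rfl, show Nat.testBit 1 2 = false from rfl,
    show Nat.testBit 1 3 = false from rfl]

theorem dec_two : dec υ 2 = υ := by
  simp [dec, show Nat.testBit 2 1 = true from rfl, show Nat.testBit 2 2 = false from rfl,
    show Nat.testBit 2 3 = false from rfl]

theorem dec_mod (a : ℕ) : dec υ (a % 16) = dec υ a := by
  have h : ∀ i, (a % 16).testBit i = (decide (i < 4) && a.testBit i) :=
    fun i => Nat.testBit_mod_two_pow a 4 i
  simp only [dec, h]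
  simp

variable [CharP K 2]

theorem dec_xor (a b : ℕ) : dec υ (a ^^^ b) = dec υ a + dec υ b := by
  have h2 : (2 : K) = 0 := CharP.cast_eq_zero K 2
  have key : ∀ (s t : Bool) (z : K), (bif (s ^^ t) then z else 0) =
      (bif s then z else 0) + (bif t then z else 0) := by
    intro s t z
    cases s <;> cases t <;> simp
    linear_combination (-z) * h2
  simp only [dec, Nat.testBit_xor, key]
  ring

theorem dec_shiftCode (hυ : υ ^ 4 = υ + 1) (a : ℕ) : dec υ (shiftCode a) = υ * dec υ a := by
  have h2 : (2 : K) = 0 := CharP.cast_eq_zero K 2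
  have h : dec υ (2 * a) = υ * dec υ a - bif a.testBit 3 then υ ^ 4 else 0 := by
    have e : ∀ i, (2 * a).testBit (i + 1) = a.testBit i := by
      intro i; rw [mul_comm, show a * 2 = 2 * a by ring, Nat.testBit_succ]; simp
    have e0 : (2 * a).testBit 0 = false := by simp
    simp only [dec, e0, e 0, e 1, e 2]
    cases a.testBit 0 <;> cases a.testBit 1 <;> cases a.testBit 2 <;> cases a.testBit 3 <;>
      simp <;> ring
  unfold shiftCode
  cases h3 : a.testBit 3 with
  | false => simp [h, h3]
  | true =>
    have h19 : dec υ 19 = υ + 1 := by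
      simp [dec, show Nat.testBit 19 0 = true from rfl, show Nat.testBit 19 1 = true from rfl,
        show Nat.testBit 19 2 = false from rfl, show Nat.testBit 19 3 = false from rfl, add_comm]
    simp only [cond_true, dec_xor, h, h3, h19]
    rw [hυ]; ring

theorem dec_slowMulCode (hυ : υ ^ 4 = υ + 1) (a b : ℕ) :
    dec υ (slowMulCode a b) = dec υ a * dec υ b := by
  have key : ∀ (s : Bool) (n : ℕ), dec υ (bif s then n else 0) = bif s then dec υ n else 0 := by
    intro s n; cases s <;> simp
  simp only [slowMulCode, dec_xor, key, dec_shiftCode hυ]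
  conv_rhs => rw [show dec υ b = _ from rfl]
  unfold dec
  cases b.testBit 0 <;> cases b.testBit 1 <;> cases b.testBit 2 <;> cases b.testBit 3 <;>
    simp only [cond_true, cond_false] <;> ring

theorem dec_mulCode (hυ : υ ^ 4 = υ + 1) (a b : ℕ) :
    dec υ (mulCode a b) = dec υ a * dec υ b := by
  have h1 : mulCode a b = mulCode (a % 16) (b % 16) := by
    unfold mulCode
    congr 4
    · congr 1; exact (Nat.mod_mod a 16).symm
    · exact (Nat.mod_mod b 16).symm
  rw [h1, mulCode_eq_slowMulCode _ (Nat.mod_lt _ (by norm_num)) _ (Nat.mod_lt _ (by norm_num)),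
    dec_mod, dec_slowMulCode hυ, dec_mod, dec_mod]

theorem dec_injOn (hυ : υ ^ 4 = υ + 1) {a b : ℕ} (ha : a < 16) (hb : b < 16)
    (h : dec υ a = dec υ b) : a = b := by
  have h2 : (2 : K) = 0 := CharP.cast_eq_zero K 2
  by_contra hab
  have hx : a ^^^ b ≠ 0 := by simpa [Nat.xor_eq_zero_iff] using hab
  obtain ⟨c, -, hc⟩ := exists_mulCode_eq_one (a ^^^ b) (Nat.xor_lt_two_pow (n := 4) ha hb) hx
  have := dec_mulCode hυ (a ^^^ b) c
  rw [hc, dec_xor, h, dec_one] at this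
  have h0 : dec υ b + dec υ b = 0 := by linear_combination dec υ b * h2
  rw [h0, zero_mul] at this
  exact one_ne_zero this

theorem exists_dec_eq (hυ : υ ^ 4 = υ + 1) (hK : Nat.card K = 4 ^ 2) (z : K) :
    ∃ n < 16, dec υ n = z := by
  have : Finite K := Nat.finite_of_card_ne_zero (by rw [hK]; norm_num)
  have : Fintype K := Fintype.ofFinite K
  have hinj : Function.Injective fun i : Fin 16 => dec υ i := fun i j h =>
    Fin.ext (dec_injOn hυ i.2 j.2 h)
  have hsurj := ((Fintype.bijective_iff_injective_and_card fun i : Fin 16 => dec υ (i : ℕ)).2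
    ⟨hinj, by rw [Fintype.card_fin, ← Nat.card_eq_fintype_card, hK]; norm_num⟩).2
  obtain ⟨i, hi⟩ := hsurj z
  exact ⟨i, i.2, hi⟩

end Decode

section FieldOfOrderSixteen

variable {K : Type*} [Field K]

theorem charP_two_of_card (hK : Nat.card K = 4 ^ 2) : CharP K 2 := by
  have : Finite K := Nat.finite_of_card_ne_zero (by rw [hK]; norm_num)
  have : Fintype K := Fintype.ofFinite K
  obtain ⟨p, hp⟩ := CharP.exists K
  obtain ⟨n, hpp, hn⟩ := FiniteField.card K p
  rw [← Nat.card_eq_fintype_card, hK] at hn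
  have : p ∣ 2 ^ 4 := by
    have : p ∣ p ^ (n : ℕ) := dvd_pow_self p n.ne_zero
    rw [← hn] at this
    simpa using this
  have := (Nat.prime_dvd_prime_iff_eq hpp Nat.prime_two).1 (hpp.dvd_of_dvd_pow this)
  subst this
  exact hp

theorem pow_sixteen_of_card (hK : Nat.card K = 4 ^ 2) (x : K) : x ^ 16 = x := by
  have : Finite K := Nat.finite_of_card_ne_zero (by rw [hK]; norm_num)
  have : Fintype K := Fintype.ofFinite K
  have := FiniteField.pow_card x
  rwa [← Nat.card_eq_fintype_card, hK] at this

theorem exists_pow_four_add_eq_one (hK : Nat.card K = 4 ^ 2) : ∃ υ : K, υ ^ 4 + υ = 1 := by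
  classical
  have : Finite K := Nat.finite_of_card_ne_zero (by rw [hK]; norm_num)
  have : Fintype K := Fintype.ofFinite K
  have hc := charP_two_of_card hK
  have h2 : (2 : K) = 0 := CharP.cast_eq_zero K 2
  by_contra! hne
  open Polynomial in
  let p : K[X] := (X ^ 4 + X) * ((X ^ 4 + X) ^ 2 + (X ^ 4 + X) + 1)
  have hp : p.natDegree ≤ 12 := by
    simp only [p]; compute_degree
  have hp0 : p ≠ 0 := by
    have : p.Monic := by simp only [p]; monicity!
    exact this.ne_zero
  have hroot : ∀ x : K, p.IsRoot x := by
    intro x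
    have hx := pow_sixteen_of_card hK x
    have h1 : x ^ 4 + x + 1 ≠ 0 := fun h => hne x (by linear_combination h - h2)
    have : (x ^ 4 + x + 1) * p.eval x = 0 := by
      simp only [p, Polynomial.eval_mul, Polynomial.eval_add, Polynomial.eval_pow,
        Polynomial.eval_X, Polynomial.eval_one]
      linear_combination hx + (x + x ^ 2 + x ^ 3 + x ^ 4 + 2 * x ^ 5 + 3 * x ^ 6 + 2 * x ^ 7 + x ^ 8 +
        3 * x ^ 9 + 3 * x ^ 10 + x ^ 12 + 2 * x ^ 13) * h2
    exact (mul_eq_zero.1 this).resolve_left h1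
  have hle : Fintype.card K ≤ 12 := by
    have : (Finset.univ : Finset K) ⊆ p.roots.toFinset := by
      intro x _
      rw [Multiset.mem_toFinset, Polynomial.mem_roots hp0]
      exact hroot x
    calc Fintype.card K = (Finset.univ : Finset K).card := rfl
      _ ≤ p.roots.toFinset.card := Finset.card_le_card this
      _ ≤ p.roots.card := Multiset.toFinset_card_le _
      _ ≤ p.natDegree := p.card_roots'
      _ ≤ 12 := hp
  rw [← Nat.card_eq_fintype_card, hK] at hle
  norm_num at hle

end FieldOfOrderSixteen

/-- The matrices `(a, b; c, d)` of the 240 external lines `⟨(1, 0, a, b), (0, 1, c, d)⟩`, in a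
fixed order: line `n` takes 16 binary digits, four for each code. -/
def lineTable : ℕ :=
  3102253204626720621116125129116524789745370836270445306992850690987409748762043661128993333523823321899462117985608211258427762504844237977665028058760638336363565567911638577838896561959954895141191477130044535196976206272553332618637853613118474928102713838699037316057669206474420978348147323838624512599944824240216436558662725494869942732964111805540607559892735368617796905026092579911381983393795553499819533717915304555352786704722279633981786379018347009174551206804959266153333216452531602229617868083697276272646262029092837643136506356405583133153364933534710885315310288897901335272154231409654163344118972695139887216331089610332347689154243310992784512518053844767627498595499732950079455472347297217089002205423352961372846427338966972185063553094996549728889881221045161933491668760452985902794302776665014196936746719924201595091885227666589845243255374100774931795310748091001337160702242595464505320607497641056613063748266326821822004022606340739930234118603553623480462004392819708337846377192477658026469437653917973738432717354467200839961842460665424009304740854621018118922118315704756034119466374831565227119258342420804263007624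

/-- The external points sorted by levels `k = 1, …, 239`: an
entry `(x, a, b, c)` stands
for an external point on the lines `a < b < c < k`; `x` codes the first half of its coordinates. -/
def quadRows : List (List (ℕ × ℕ × ℕ × ℕ)) := [
  [], [], [], [], [], [(0, 3, 4, 5)], [], [(13, 1, 6, 7)], [], [(10, 0, 5, 9)], [], [(16, 2, 10,
  11)], [], [(11, 2, 8, 13)], [], [(9, 3, 11, 15)], [], [(8, 1, 15, 17)], [(9, 0, 13, 17)], [],
  [(2, 7, 11, 20)], [], [(12, 4, 13, 22)], [(13, 9, 20, 22)], [], [(15, 14, 18, 25)], [(6, 11, 23,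
  25)], [(5, 6, 24, 26)], [], [(7, 12, 24, 29)], [(1, 19, 27, 29)], [(2, 13, 16, 30), (13, 21, 26,
  31)], [(14, 5, 18, 29)], [], [(7, 1, 23, 34)], [(0, 2, 31, 34)], [(14, 9, 16, 34)], [], [(6, 17,
  37, 38)], [(15, 2, 33, 38)], [(7, 3, 14, 39)], [(8, 7, 36, 41)], [(1, 16, 28, 42), (7, 0, 21,
  40)], [(10, 22, 31, 39), (15, 5, 35, 42)], [(8, 6, 27, 40), (12, 12, 17, 42)], [(2, 26, 35, 38),
  (3, 9, 27, 41)], [(4, 7, 30, 38), (16, 18, 22, 43)], [], [(11, 4, 21, 48)], [(14, 14, 45, 48)],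
  [(9, 1, 32, 50)], [(3, 4, 12, 51)], [(12, 33, 41, 52)], [(3, 34, 47, 49)], [(15, 8, 29, 49)],
  [(16, 32, 41, 55)], [(5, 34, 45, 56), (6, 8, 43, 52)], [(10, 20, 35, 52), (11, 29, 37, 50), (14,
  0, 25, 56)], [(0, 43, 46, 50), (5, 10, 39, 49), (10, 15, 24, 56)], [(1, 1, 10, 53), (2, 3, 47,
  58), (4, 40, 44, 55), (6, 24, 36, 48)], [(3, 21, 37, 53), (4, 3, 19, 57), (8, 12, 46, 54), (11,
  23, 28, 55)], [(1, 14, 20, 54), (4, 23, 33, 59), (9, 30, 44, 57), (12, 0, 36, 51)], [(0, 25, 30,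
  53), (5, 15, 40, 54), (13, 28, 39, 51), (16, 19, 35, 48)], [(1, 4, 38, 56), (8, 8, 9, 63), (9,
  18, 36, 61), (13, 11, 44, 50)], [(0, 17, 20, 55), (3, 16, 33, 48), (5, 27, 47, 51), (14, 10, 26,
  57)], [(2, 15, 31, 52), (10, 25, 42, 49), (15, 13, 46, 60), (16, 6, 37, 62)], [(4, 2, 28, 58),
  (6, 5, 32, 54), (7, 64, 65, 66), (11, 22, 45, 53), (12, 7, 19, 59)], [], [], [(15, 1, 68, 69)],
  [], [(9, 29, 69, 71)], [], [(7, 56, 68, 73)], [(0, 62, 71, 73)], [], [(11, 15, 72, 76)], [(3,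
  44, 74, 76)], [(13, 33, 70, 76)], [(4, 34, 71, 78)], [(1, 5, 68, 77), (7, 17, 71, 79)], [(2, 45,
  75, 76), (14, 30, 68, 80)], [], [(10, 4, 82, 83)], [(11, 7, 73, 84)], [(3, 64, 80, 85), (15, 47,
  74, 83)], [(3, 32, 72, 84), (12, 28, 79, 86)], [(1, 9, 69, 83), (12, 60, 77, 85)], [(1, 0, 70,
  85), (8, 53, 81, 83)], [], [(5, 43, 84, 90)], [(4, 13, 86, 90)], [(14, 11, 70, 90)], [(0, 26,
  83, 93)], [(2, 48, 72, 93)], [(6, 65, 77, 90), (16, 3, 79, 95)], [(14, 2, 83, 96)], [(4, 35, 73,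
  97), (7, 45, 69, 91), (14, 24, 81, 92), (16, 33, 80, 94)], [(6, 18, 82, 92), (7, 57, 70, 97),
  (8, 23, 74, 91), (14, 12, 77, 94)], [(1, 59, 78, 97), (4, 1, 75, 94), (7, 42, 72, 92), (10, 30,
  79, 91)], [(9, 67, 88, 92), (11, 46, 80, 96), (12, 40, 73, 93), (15, 20, 89, 91)], [(0, 67, 74,
  95), (1, 39, 75, 90), (11, 60, 87, 97)], [(1, 49, 87, 94), (12, 31, 82, 95), (13, 53, 78, 90)],
  [], [(6, 10, 84, 104)], [(9, 8, 77, 105)], [(8, 51, 97, 105)], [(5, 46, 75, 105)], [(13, 85, 95,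
  108)], [(10, 3, 69, 105)], [(4, 87, 101, 110)], [(4, 52, 96, 104), (6, 26, 91, 106), (9, 48, 78,
  111), (10, 40, 81, 109), (11, 11, 82, 107)], [(2, 28, 69, 109), (6, 14, 74, 107), (13, 27, 92,
  106), (15, 22, 93, 104), (16, 64, 75, 111)], [(1, 25, 86, 104), (2, 4, 70, 106), (5, 7, 81,
  110), (14, 32, 78, 108), (15, 43, 94, 107)], [(3, 31, 70, 111), (5, 50, 102, 104), (10, 53, 72,
  107), (16, 49, 91, 108)], [(9, 20, 94, 109), (10, 6, 88, 104), (14, 53, 73, 106), (16, 0, 82,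
  110)], [(1, 58, 80, 106), (5, 41, 97, 109), (9, 38, 89, 104), (14, 63, 74, 110)], [(0, 41, 77,
  111), (1, 66, 79, 107), (8, 16, 103, 104), (10, 63, 92, 108)], [(2, 71, 99, 104)], [], [(1, 45,
  119, 120)], [(16, 61, 93, 120)], [(3, 63, 96, 122)], [(5, 1, 119, 123)], [(6, 7, 103, 120), (12,
  27, 102, 123)], [(16, 13, 117, 125)], [(7, 33, 119, 126)], [(15, 48, 116, 125)], [(12, 30, 119,
  128)], [(2, 67, 105, 126), (13, 61, 114, 128)], [(1, 61, 112, 127), (7, 83, 108, 125), (9, 60,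
  113, 129)], [(3, 101, 107, 125), (14, 41, 86, 121), (15, 61, 84, 124)], [(2, 90, 110, 131), (4,
  14, 88, 123), (8, 95, 106, 132), (9, 40, 115, 128), (10, 32, 89, 120), (13, 47, 118, 126)], [(3,
  8, 102, 121), (5, 85, 107, 122), (8, 32, 116, 127), (10, 65, 117, 129), (11, 83, 111, 130), (14,
  40, 103, 124)], [(0, 7, 115, 127), (2, 2, 118, 129), (7, 87, 106, 122), (12, 48, 89, 124), (15,
  90, 109, 130), (16, 51, 88, 121)], [(5, 9, 95, 129), (8, 28, 77, 125), (11, 66, 110, 121), (12,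
  14, 80, 130), (14, 47, 75, 122)], [(3, 26, 110, 124), (4, 43, 95, 127), (8, 49, 73, 130), (9,
  37, 70, 125), (11, 20, 78, 122)], [(4, 11, 108, 124), (5, 37, 94, 133), (6, 0, 72, 130), (9, 31,
  81, 122), (14, 4, 101, 127)], [(0, 13, 69, 122), (6, 58, 108, 121), (8, 39, 101, 129), (9, 27,
  79, 130), (12, 64, 97, 133)], [(2, 49, 81, 132), (4, 26, 85, 128), (8, 43, 111, 120), (12, 20,
  72, 131), (13, 37, 82, 135), (16, 36, 104, 136)], [(0, 51, 80, 131), (6, 9, 87, 126), (10, 2,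
  75, 132), (12, 54, 104, 138), (14, 66, 109, 123), (15, 3, 92, 134)], [(0, 0, 78, 132), (4, 4,
  109, 120), (5, 31, 73, 131), (10, 11, 87, 128), (12, 37, 91, 134), (14, 55, 104, 139)], [(0, 19,
  104, 137), (4, 8, 79, 131), (9, 39, 85, 126), (10, 46, 74, 135), (13, 65, 69, 132), (15, 58,
  111, 123)], [(5, 35, 79, 120), (7, 18, 78, 129), (9, 24, 75, 127), (16, 57, 72, 123)], [(2, 18,
  73, 121), (3, 59, 69, 128), (11, 57, 81, 126), (13, 42, 80, 124)], [(0, 42, 70, 129), (7, 59,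
  82, 123), (12, 29, 74, 120), (15, 34, 77, 127)], [(6, 44, 69, 127), (7, 15, 80, 120), (9, 12,
  73, 123), (15, 23, 81, 129)], [(0, 15, 91, 126), (7, 44, 94, 121), (8, 34, 92, 128), (10, 29,
  97, 124), (11, 68, 104, 144)], [(2, 62, 92, 120), (3, 17, 97, 127), (7, 76, 104, 145), (11, 5,
  91, 123), (13, 56, 94, 129)], [(5, 23, 72, 121), (6, 56, 79, 124), (7, 5, 75, 128), (10, 12, 78,
  126), (13, 98, 104, 146)], [(3, 100, 104, 147), (7, 62, 77, 124), (8, 35, 82, 126), (12, 24, 70,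
  121), (16, 17, 74, 128)], [], [(6, 63, 145, 152)], [(2, 65, 148, 153)], [(9, 47, 98, 152)], [(1,
  41, 71, 155)], [(5, 13, 76, 155)], [(4, 46, 119, 152)], [(0, 21, 97, 157)], [(10, 41, 147,
  153)], [(5, 2, 68, 160)], [(12, 65, 100, 161)], [(9, 52, 124, 161)], [(9, 21, 74, 162)], [(8,
  38, 78, 153)], [(10, 21, 77, 152)], [(5, 21, 126, 156)], [(1, 65, 150, 158)], [(15, 21, 80,
  168)], [(13, 19, 91, 158), (16, 21, 92, 160)], [(4, 54, 82, 164), (14, 3, 119, 157)], [(1, 2,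
  145, 171)], [(14, 21, 79, 172)], [(3, 25, 120, 155), (6, 21, 123, 154)], [(4, 41, 144, 162),
  (13, 2, 151, 154), (15, 63, 150, 157)], [(12, 16, 81, 175)], [(3, 66, 98, 171), (8, 58, 76,
  158), (11, 63, 71, 161)], [(1, 21, 129, 177)], [(0, 64, 151, 155), (2, 51, 144, 171), (4, 21,
  69, 176), (12, 58, 99, 153), (14, 46, 149, 161)], [(8, 3, 146, 161), (9, 66, 99, 175), (12, 21,
  75, 165), (14, 8, 147, 158), (15, 28, 148, 155)], [(2, 10, 127, 178), (5, 8, 98, 162), (6, 3,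
  151, 168), (12, 46, 148, 172), (15, 51, 76, 160)], [(4, 9, 76, 154), (6, 66, 68, 156), (8, 47,
  147, 172), (10, 28, 119, 162), (11, 36, 94, 159), (16, 14, 150, 179)], [(5, 55, 70, 166), (10,
  13, 144, 168), (11, 64, 119, 160), (12, 39, 98, 154), (13, 58, 100, 156), (16, 27, 145, 180)],
  [(0, 60, 145, 162), (9, 14, 148, 177), (11, 9, 99, 168), (13, 67, 147, 157), (14, 51, 146, 156),
  (15, 6, 72, 173)], [(3, 60, 150, 160), (4, 27, 151, 177), (10, 50, 73, 169), (12, 8, 149, 156),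
  (14, 67, 144, 152), (15, 39, 99, 172)], [(2, 27, 68, 157), (5, 14, 100, 152), (8, 60, 71, 154),
  (9, 28, 149, 168), (10, 64, 146, 172), (14, 22, 128, 167)], [(0, 39, 68, 158), (3, 13, 146,
  153), (8, 21, 121, 163), (9, 9, 100, 171), (10, 47, 149, 175), (16, 67, 71, 181)], [(0, 12, 134,
  183), (1, 63, 84, 167), (3, 57, 135, 182), (7, 60, 114, 163), (8, 67, 112, 174), (10, 18, 125,
  158), (13, 41, 93, 178), (16, 23, 133, 171)], [(2, 34, 107, 185), (3, 3, 140, 166), (5, 62, 83,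
  153), (6, 46, 142, 159), (7, 28, 138, 170), (8, 29, 90, 175), (10, 17, 106, 184), (15, 64, 137,
  164)], [(0, 58, 103, 173), (1, 33, 122, 186), (2, 39, 116, 176), (4, 66, 89, 169), (6, 45, 131,
  161), (7, 9, 115, 165), (10, 1, 130, 155), (11, 30, 132, 181)], [(1, 44, 125, 175), (3, 14, 142,
  163), (6, 15, 135, 185), (7, 58, 93, 164), (8, 65, 138, 167), (13, 12, 110, 155), (14, 23, 85,
  181), (16, 9, 112, 166)], [(4, 65, 114, 173), (5, 30, 111, 185), (7, 46, 116, 174), (8, 5, 131,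
  183), (11, 1, 95, 175), (12, 56, 122, 171), (13, 14, 84, 165), (16, 28, 89, 178)], [(1, 47, 116,
  170), (2, 41, 137, 173), (3, 35, 90, 186), (4, 24, 107, 161), (5, 67, 140, 165), (7, 8, 89,
  159), (14, 62, 87, 183), (15, 17, 108, 171)], [(0, 1, 101, 153), (2, 42, 122, 158), (4, 64, 103,
  178), (6, 2, 114, 169), (7, 27, 84, 176), (11, 3, 115, 174), (14, 59, 131, 182), (16, 30, 109,
  184)], [(4, 15, 132, 183), (5, 44, 130, 171), (8, 33, 110, 184), (9, 46, 103, 167), (10, 8, 93,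
  176), (12, 47, 112, 169), (14, 28, 115, 163), (15, 45, 85, 153)], [(0, 56, 90, 181), (1, 17,
  111, 182), (6, 62, 95, 158), (9, 63, 142, 173), (10, 60, 138, 165), (12, 2, 116, 166), (14, 27,
  89, 164), (16, 5, 107, 155)], [(2, 59, 134, 175), (3, 18, 109, 161), (9, 58, 84, 159), (10, 51,
  137, 174), (11, 42, 133, 185), (12, 9, 114, 170), (13, 57, 101, 186), (14, 13, 140, 178)], [(0,
  44, 106, 161), (1, 13, 115, 164), (2, 29, 85, 182), (7, 51, 103, 166), (11, 41, 138, 169), (12,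
  34, 110, 158), (15, 67, 142, 176), (16, 15, 83, 186)], [(0, 27, 140, 163), (1, 24, 133, 153),
  (3, 39, 112, 159), (5, 66, 93, 170), (6, 35, 134, 184), (7, 2, 137, 167), (12, 57, 108, 155),
  (13, 18, 87, 181)], [(0, 8, 138, 174), (4, 56, 125, 184), (7, 47, 142, 178), (8, 66, 84, 166),
  (9, 5, 135, 153), (11, 39, 114, 164), (13, 23, 111, 161), (15, 12, 95, 186)], [(1, 34, 109,
  183), (2, 14, 103, 170), (6, 29, 101, 171), (7, 63, 140, 169), (9, 42, 83, 181), (11, 59, 106,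
  155), (15, 65, 115, 159), (16, 60, 137, 176)], [(0, 33, 108, 185), (3, 24, 130, 158), (5, 64,
  116, 163), (6, 51, 93, 165), (7, 13, 112, 173), (9, 35, 132, 182), (13, 3, 89, 167), (16, 45,
  87, 175)], [(0, 22, 110, 160), (2, 19, 83, 156), (3, 56, 141, 176), (4, 36, 106, 187), (5, 5,
  139, 169), (7, 52, 85, 157), (8, 11, 98, 197), (12, 1, 118, 164), (13, 30, 102, 166), (14, 49,
  151, 188), (15, 37, 145, 202), (16, 40, 99, 193)], [(2, 53, 151, 200), (3, 11, 71, 192), (4, 42,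
  102, 167), (5, 18, 96, 176), (8, 57, 113, 169), (9, 55, 110, 172), (10, 54, 85, 180), (11, 31,
  150, 193), (12, 6, 132, 152), (13, 48, 68, 189), (14, 38, 130, 162), (15, 59, 118, 163)], [(1,
  52, 130, 154), (3, 29, 118, 165), (4, 32, 145, 191), (5, 48, 147, 197), (6, 40, 144, 200), (7,
  22, 132, 177), (8, 62, 117, 176), (9, 7, 150, 199), (10, 34, 102, 173), (11, 25, 131, 187), (13,
  17, 88, 169), (15, 10, 122, 156)], [(0, 23, 105, 169), (1, 36, 101, 180), (3, 38, 131, 157), (4,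
  6, 122, 160), (6, 12, 86, 176), (7, 19, 109, 172), (11, 32, 98, 189), (12, 43, 71, 202), (13,
  49, 144, 196), (14, 44, 118, 174), (15, 15, 102, 178), (16, 53, 149, 199)], [(1, 32, 151, 195),
  (3, 42, 105, 164), (4, 22, 135, 180), (5, 29, 141, 178), (6, 6, 111, 187), (7, 38, 95, 156), (8,
  0, 119, 199), (9, 59, 86, 166), (10, 61, 76, 193), (11, 52, 125, 172), (13, 34, 139, 174), (15,
  11, 144, 190)], [(0, 10, 109, 152), (1, 35, 136, 176), (2, 37, 147, 192), (3, 7, 99, 196), (4,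
  45, 118, 159), (6, 31, 149, 188), (7, 25, 101, 162), (9, 33, 102, 170), (10, 43, 68, 191), (13,
  55, 83, 177), (15, 54, 106, 154), (16, 24, 143, 169)], [(0, 40, 100, 189), (2, 5, 117, 163), (3,
  36, 108, 168), (4, 53, 148, 197), (5, 20, 145, 198), (7, 16, 130, 160), (8, 19, 87, 179), (9,
  23, 96, 165), (10, 26, 71, 194), (11, 12, 113, 173), (15, 56, 88, 167), (16, 50, 132, 157)],
  [(0, 11, 149, 201), (1, 30, 105, 163), (2, 54, 125, 160), (5, 33, 113, 174), (6, 19, 133, 162),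
  (7, 36, 134, 152), (8, 55, 135, 157), (9, 43, 151, 198), (10, 45, 96, 178), (11, 26, 146, 196),
  (13, 4, 148, 193), (16, 1, 86, 167)], [(0, 38, 107, 168), (2, 23, 141, 159), (3, 50, 83, 180),
  (4, 12, 139, 170), (5, 16, 106, 172), (7, 6, 90, 179), (8, 31, 100, 202), (9, 49, 76, 192), (10,
  57, 136, 164), (11, 18, 143, 166), (15, 0, 98, 194), (16, 20, 68, 195)], [(1, 40, 146, 192), (2,
  24, 96, 164), (4, 17, 141, 163), (5, 25, 135, 168), (6, 16, 85, 177), (7, 50, 110, 154), (8, 4,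
  145, 190), (11, 62, 139, 167), (12, 61, 68, 201), (13, 10, 125, 179), (14, 35, 113, 166), (15,
  31, 119, 197)], [(0, 37, 150, 195), (2, 22, 108, 162), (3, 1, 117, 170), (4, 48, 99, 198), (5,
  0, 148, 188), (7, 55, 107, 187), (8, 30, 88, 159), (12, 26, 76, 200), (13, 59, 136, 173), (14,
  42, 143, 165), (15, 52, 87, 152), (16, 54, 90, 156)], [(0, 49, 119, 191), (1, 7, 148, 202), (2,
  17, 136, 174), (3, 62, 143, 178), (6, 61, 98, 198), (9, 22, 134, 179), (10, 16, 101, 156), (11,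
  56, 105, 170), (12, 50, 109, 187), (13, 5, 86, 159), (14, 52, 133, 168), (16, 26, 147, 190)],
  [(0, 45, 117, 166), (1, 15, 139, 165), (4, 20, 146, 188), (5, 32, 99, 201), (6, 33, 88, 164),
  (8, 37, 144, 194), (9, 25, 95, 160), (10, 36, 90, 177), (12, 10, 111, 157), (14, 19, 107, 154),
  (15, 4, 100, 199), (16, 44, 141, 173)], [(0, 29, 136, 167), (1, 48, 149, 194), (2, 61, 100,
  196), (3, 20, 119, 200), (5, 38, 87, 177), (6, 34, 143, 163), (7, 10, 133, 180), (8, 44, 96,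
  170), (11, 6, 108, 154), (12, 15, 113, 159), (14, 43, 150, 190), (16, 25, 134, 172)], [(1, 55,
  95, 179), (2, 57, 86, 165), (4, 0, 147, 201), (5, 53, 146, 191), (6, 4, 71, 195), (7, 54, 111,
  168), (8, 50, 122, 162), (11, 35, 88, 178), (12, 18, 105, 173), (13, 16, 131, 152), (14, 7, 76,
  189), (15, 24, 117, 174)], [(0, 112, 121, 186), (1, 93, 126, 161), (2, 74, 138, 183), (3, 75,
  89, 184), (4, 84, 129, 155), (5, 92, 137, 182), (6, 80, 115, 175), (7, 204, 214, 215), (8, 114,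
  123, 181), (9, 203, 216, 217), (10, 206, 212, 213), (11, 79, 116, 153), (12, 207, 208, 209),
  (13, 77, 142, 171), (14, 205, 210, 211), (15, 97, 140, 158), (16, 69, 103, 185)], [(0, 113, 124,
  156), (1, 96, 128, 187), (2, 78, 88, 172), (3, 82, 139, 152), (4, 91, 136, 157), (5, 86, 127,
  154), (6, 73, 118, 179), (7, 195, 196, 197), (8, 94, 143, 160), (9, 188, 189, 190), (10, 200,
  201, 202), (11, 70, 141, 162), (12, 191, 193, 194), (13, 72, 117, 180), (14, 192, 198, 199),
  (15, 105, 120, 177), (16, 81, 102, 168)], [(0, 98, 125, 165), (1, 26, 141, 185), (2, 1, 142,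
  168), (3, 22, 79, 201), (4, 16, 74, 199), (5, 12, 89, 187), (6, 122, 148, 166), (7, 49, 88,
  161), (10, 62, 114, 157), (11, 19, 129, 195), (12, 90, 145, 174), (13, 40, 105, 182), (14, 64,
  72, 208), (15, 41, 82, 216), (16, 58, 127, 204)], [(0, 85, 144, 170), (1, 8, 82, 209), (2, 101,
  150, 166), (3, 58, 81, 210), (5, 61, 118, 184), (6, 22, 97, 192), (8, 48, 141, 155), (9, 90,
  119, 169), (10, 27, 94, 217), (11, 10, 74, 202), (12, 38, 69, 188), (13, 62, 115, 172), (14, 15,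
  137, 187), (15, 32, 136, 161), (16, 42, 142, 154)], [(0, 66, 128, 217), (1, 3, 73, 213), (2, 43,
  139, 184), (3, 45, 138, 172), (4, 63, 70, 214), (5, 132, 149, 164), (6, 20, 102, 155), (7, 32,
  113, 158), (9, 10, 80, 193), (10, 23, 103, 154), (11, 100, 135, 176), (12, 83, 144, 163), (13,
  29, 112, 160), (15, 36, 126, 192), (16, 38, 77, 197)], [(0, 57, 116, 177), (1, 50, 92, 200), (2,
  9, 124, 206), (3, 68, 133, 173), (4, 31, 117, 181), (5, 4, 143, 175), (6, 28, 78, 203), (9, 54,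
  121, 194), (10, 33, 140, 179), (11, 17, 93, 152), (12, 107, 147, 167), (13, 25, 75, 198), (14,
  60, 91, 207), (15, 7, 96, 183), (16, 130, 146, 159)], [(0, 16, 123, 193), (1, 18, 138, 157), (2,
  56, 112, 180), (3, 19, 77, 190), (4, 49, 113, 153), (6, 100, 110, 178), (8, 20, 86, 185), (9, 2,
  120, 213), (10, 95, 98, 163), (11, 51, 128, 208), (12, 44, 84, 168), (13, 71, 134, 164), (14, 6,
  126, 201), (15, 53, 139, 182), (16, 46, 70, 205)], [(0, 48, 86, 171), (1, 76, 134, 169), (2, 55,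
  123, 202), (3, 67, 94, 212), (4, 18, 115, 156), (5, 52, 69, 196), (6, 30, 137, 180), (7, 11,
  136, 153), (8, 220, 222, 223), (9, 6, 97, 191), (11, 0, 118, 186), (12, 106, 150, 178), (13, 46,
  81, 215), (14, 39, 120, 209), (15, 131, 151, 170), (16, 34, 84, 162)], [(0, 47, 72, 212), (1,
  99, 132, 174), (2, 36, 79, 191), (3, 5, 103, 162), (4, 37, 105, 186), (5, 11, 88, 158), (6, 59,
  89, 160), (7, 221, 223, 224), (8, 26, 102, 171), (9, 45, 114, 156), (10, 55, 80, 199), (11, 109,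
  151, 165), (12, 63, 127, 211), (13, 13, 73, 216), (14, 111, 148, 176), (16, 52, 129, 189)], [(0,
  28, 82, 205), (1, 57, 142, 160), (2, 98, 111, 167), (3, 15, 114, 179), (4, 5, 93, 172), (5, 36,
  74, 190), (6, 50, 129, 193), (8, 13, 124, 208), (9, 53, 141, 158), (11, 27, 127, 213), (12, 49,
  96, 184), (13, 38, 121, 201), (14, 20, 105, 175), (15, 71, 133, 166), (16, 85, 100, 174)], [(0,
  54, 79, 197), (1, 37, 113, 181), (2, 44, 89, 152), (3, 43, 88, 183), (5, 19, 80, 200), (6, 41,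
  128, 211), (7, 4, 102, 182), (8, 2, 72, 214), (9, 108, 146, 176), (11, 24, 103, 157), (12, 25,
  126, 189), (13, 99, 122, 163), (14, 1, 112, 177), (15, 110, 149, 165), (16, 65, 73, 207)], [(0,
  35, 114, 180), (1, 12, 140, 162), (2, 64, 91, 205), (3, 6, 129, 198), (5, 71, 125, 159), (6, 76,
  109, 167), (7, 53, 143, 171), (8, 59, 93, 168), (9, 68, 87, 174), (10, 14, 127, 203), (11, 47,
  124, 215), (12, 55, 92, 190), (13, 0, 96, 185), (15, 16, 121, 196), (16, 31, 105, 153)], [(0,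
  61, 88, 175), (1, 108, 147, 166), (2, 25, 97, 195), (3, 40, 136, 181), (4, 39, 72, 210), (6, 13,
  94, 204), (7, 7, 141, 186), (8, 24, 142, 156), (9, 65, 82, 206), (10, 111, 145, 170), (11, 34,
  89, 179), (12, 5, 137, 177), (13, 52, 74, 194), (15, 50, 79, 188), (16, 106, 119, 165)], [(0,
  76, 133, 176), (1, 11, 143, 184), (2, 0, 102, 161), (3, 28, 73, 215), (4, 83, 150, 174), (6, 1,
  140, 172), (7, 48, 105, 183), (8, 22, 80, 196), (9, 41, 91, 212), (10, 122, 151, 159), (11, 38,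
  92, 191), (13, 66, 127, 209), (14, 54, 129, 202), (15, 57, 103, 187), (16, 29, 114, 152)], [(0,
  87, 147, 164), (1, 51, 91, 204), (2, 40, 143, 155), (3, 10, 92, 195), (4, 29, 116, 168), (5, 22,
  77, 194), (6, 83, 119, 173), (7, 61, 117, 185), (8, 14, 70, 206), (9, 56, 140, 154), (10, 225,
  227, 228), (11, 16, 75, 188), (12, 66, 78, 210), (13, 35, 138, 187), (14, 95, 145, 159), (16, 7,
  139, 161)], [(0, 32, 96, 182), (1, 6, 74, 197), (2, 12, 115, 177), (3, 106, 144, 167), (4, 130,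
  149, 166), (5, 60, 82, 214), (6, 64, 81, 213), (7, 20, 118, 181), (8, 25, 69, 193), (9, 34, 93,
  157), (10, 19, 121, 192), (11, 33, 142, 180), (13, 43, 141, 153), (14, 100, 125, 169), (16, 39,
  124, 217)], [(0, 9, 120, 204), (1, 98, 135, 173), (2, 50, 77, 199), (3, 23, 116, 156), (4, 221,
  228, 229), (5, 3, 78, 208), (6, 49, 117, 186), (7, 26, 139, 175), (8, 52, 75, 201), (9, 107,
  145, 178), (10, 67, 70, 216), (11, 40, 86, 158), (13, 36, 123, 195), (14, 17, 84, 160), (15, 30,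
  138, 179), (16, 131, 148, 164)], [(0, 14, 81, 207), (1, 67, 124, 211), (2, 87, 146, 169), (3,
  30, 93, 154), (4, 10, 121, 189), (5, 224, 230, 231), (6, 55, 75, 197), (7, 37, 96, 155), (8, 85,
  149, 173), (10, 99, 131, 167), (11, 43, 117, 171), (12, 35, 115, 160), (13, 15, 116, 162), (14,
  36, 69, 200), (15, 27, 78, 214), (16, 4, 118, 158)], [(0, 24, 84, 172), (1, 23, 137, 152), (2,
  8, 128, 215), (3, 0, 113, 175), (4, 50, 126, 196), (5, 42, 112, 179), (6, 53, 136, 183), (7, 31,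
  86, 184), (8, 68, 108, 178), (10, 38, 123, 198), (11, 65, 120, 203), (12, 3, 94, 205), (13, 54,
  97, 190), (14, 71, 135, 170), (15, 226, 232, 233), (16, 76, 101, 163)], [(0, 52, 92, 192), (1,
  110, 144, 159), (2, 6, 80, 188), (3, 2, 91, 217), (4, 25, 77, 202), (5, 17, 103, 180), (6, 47,
  70, 209), (8, 109, 150, 164), (9, 220, 235, 236), (10, 48, 139, 181), (11, 44, 140, 156), (12,
  32, 143, 186), (13, 107, 119, 176), (14, 61, 102, 153), (15, 9, 73, 210), (16, 59, 138, 177)],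
  [(0, 99, 130, 178), (1, 22, 123, 189), (2, 33, 84, 187), (3, 95, 148, 169), (4, 51, 81, 216),
  (5, 101, 151, 173), (6, 42, 116, 157), (8, 56, 115, 152), (9, 26, 118, 183), (10, 37, 86, 161),
  (11, 54, 69, 199), (12, 11, 117, 182), (13, 60, 120, 211), (14, 222, 229, 230), (15, 19, 75,
  191), (16, 8, 78, 212)], [(0, 18, 89, 154), (1, 46, 72, 203), (2, 63, 94, 207), (3, 55, 126,
  194), (4, 68, 134, 165), (5, 58, 128, 206), (6, 132, 146, 170), (7, 227, 237, 238), (8, 10, 79,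
  198), (9, 4, 136, 185), (10, 7, 113, 171), (11, 90, 147, 163), (12, 231, 233, 234), (13, 45,
  137, 168), (14, 31, 88, 155), (15, 62, 112, 162), (16, 16, 97, 200)]]

/-- The 120 solutions of the balance conditions that contain line `0`, as binary numbers. -/
def halfSolutions : List ℕ := [
  1196288233578691406588764929519725374483224205951944547345367208055069025,
  702807515916603845171034284393703793791866123444629148797788066684982609,
  1465518521570461541488143577597994541126982930316401545434829443034240337,
  264782536105230423729507397967379286020623610914140857938415488875318609,
  540832843437530056660738641803176372213652074657113026101469586382081361,
  261742999463918337006749066386213001343434762207929178709739060300926289,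
  1023974820130481889956661899930678823680644813438622675265436896378146129,
  1141089218807741124041752371181225339390328078563642140215131758234753873,
  1116909032030937623493079804862673030418691694976612014608922522924407633,
  1415433733279896932996396066640511431416964748266772749826347659441781585,
  701102326027598014764665058264592788498741037233659005054980103405370065,
  759819933617152786940102384738809562316304282869030668169528705601198513,
  1117775761263614013965482437993346194525789478150613961684246646501463369,
  1141089309202422841977936405567345912032568422601419344237287146874254665,
  702808209282423556677436641027224355307373175311277767628973688344605897,
  682146615324224545757188842844388785060403909971316898007077605409772953,
  701102287612277992239319069545438890190552895171214885751428675573953945,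
  701581472599572135606515529205263815188459650812293785832772215845991833,
  239763759862095742785338215545114664912531438189921212339015597391498649,
  264783100661048394774379731495625376585702176680568153443894294064024985,
  1196287454448011516586080767747672066281146197130417238553944069523738981,
  756301667056251067166265527889818722278095037590315101741754779433816293,
  1520717360181869927602690296411841256891067756712048058582671987343347941,
  260876686883626434325118378928386308565035196040058125213109551571502421,
  536087840193776915815980673132224992056529304879413477877494187716085077,
  1416750713576086922643625017654235737457002587125491962606561318087267157,
  954933580421183944980100000500092300638399637367568583121180904090176341,
  976074230556675358806014235237478324932847172248387029498713710826130261,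
  583988253608041550534162498300772171475515645076993229661824467756893397,
  585306592617484845341727907592555499174956755621688945241837469391111381,
  1441338158634116144507005171754788912826535245736715525846227302212686549,
  514947793029423495560284760642238956635348477827466446308991614000253653,
  540444633844714215901598366687789672960564827304862095138875281747954389,
  260877289854764427895336701175786297438301903868929540022139784591624917,
  1023974643970939993524196060406025504351833512445966781283043990866938581,
  756779617845160810214659891385589969437037425341291680149429138495476149,
  755914084395548797535713365699816584860715867994947935444222768297382325,
  1519011438511724363164572724930055791774247476571985176705126974572695989,
  955800309653860335452502633630765464745497420541570530196505027667232077,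
  976073741368783661584545973117593184117762253421715039512492895008228685,
  240603368951949404541825099569073437250952152162113040719931101432726733,
  540832178090096463006804540158637912069755854837785142132855865052972237,
  1000661186426812883447926127218146359487294912032938602752158879133648077,
  1396477395644409892860331738294922866142919543247546878113382867948491469,
  1415433067932463339342461964995972971273068528447444865857733938112672461,
  1116908946266077444996797999724140283732120738021733324648685006052700877,
  1392120099576227926487660293927978967223614846861088677313069642197283533,
  1416751406941906634150027374287756298972509638992140581437746939746890445,
  954933694204430241328850060627607148696581426369768007943990321292397261,
  1175626553855632217172235326198357057549683983657104987763233608248529325,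
  1171268678204876835641911585325407445173054024406197592954544178039919021,
  539605441407245041935883428336677371950842330338801160336654392554358173,
  241081319740859147590219463064844684409894539913089619127605460494386589,
  515813288063715485713885297608858442903481893111366071710646556366931357,
  540444595429394193376252377968635774652376685242417975835323853916538269,
  260038097417295253929621762824673996428579406902868605219918895398028701,
  261742784889056418048937238142405783706435319152829165423794726958302621,
  1024453790542914114366046531346696531041552126024601562060836103307560349,
  1117388002443369847902464436278690737779599007562590901404321729853821853,
  954094990954852764584603384396379988501943848230379063127990247916702621,
  1251420756404233319103279357750415737524912771594486680583210874252097635,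
  1472272048965582669487498043247712788625045107949156441616029521938545235,
  1471884015532308725160823607656979408700769161589561404635828122815625811,
  767890617468005801019151640926905435183215600353160671113335348662196531,
  1230759162446034308183031559567580167277943506254525810961314791317264691,
  1251420627594231578641749334645141266574484285494265357257504057781180723,
  1251899812581525722008945794304966191572391041135344257338847598053218611,
  766572858041135921369238528141127820941099752672914149541698551485380915,
  1472271559777690972266029781127827647809960189122484451629808706120643659,
  1127180791866773284360920799633497346776764558129985500113921754857241163,
  1403231099199072917292152043469294432969793021872957668276975852364003915,
  1181541103388146090163686681740770221675023107378898962428157131301861675,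
  766572971824382217717988588268642668999281541675113574364507968687601835,
  712691693091737236408323116974525972732559817002635468005255287481382171,
  272014630489752257413060038051762846751079139261081340889031475762842907,
  1010933482800080397508171200528234665038835508905418648900065015924673819,
  272015210072325672570712334557768560208404402125530534897407680220245275,
  546359144961908066367703733511048938777715808964211950500247376969870619,
  1127181242639344959057043073034228589283661334894213370796591142843726619,
  712692296062875229978541439221925961605826524831506882814285520501504667,
  1227240895885132588409194702718589327239734260975810244533540865149882471,
  1527083356560961777562424077282205342480123161946217501322602798844072039,
  1525765597134091897912510964496427728238007314265970979750966001667256423,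
  326347371095730659803787897651590087373763842543956813826188844685150311,
  1065266223406058799898899060128061905661520212188294121837222384846981223,
  547198663657080010188006583148887138473896178898626574859007492371597911,
  1010067208635108517351886501789561870568624084799991714706986935026666071,
  1030340640350031843483929841276389589940888917680136224022974802367662679,
  1007027671993796430629128170208395585891435236093780035478310506452273751,
  545492870796936186211419034772376144307504384858785016307169296071862871,
  1030341219932605258641582137782395303398214180544585418031351006825065047,
  1251033500001233819327315106847139498793991474967473203842218089323794743,
  325508667846153183059541221420362927179126264404567869010188771309455671,
  301328481069349682510868655101810618207489880817537743403979535999109431,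
  326347821868302334499910171052321329880660619308184684508858232671635767,
  1084700951871404649286695723383662464839147466929049686337210178812283191,
  812752400081234534026815342307017942068796227677331627233904630794145975,
  811046607221090710050227793930506947902404433637490068682066434494410935,
  374727420269861112585288455880693434297553715146843336374532052984481975,
  649459388592717450708954290424707192791141068345119788957573148857026743,
  649071355159443506382279854833973812866865121985524751977371749734107319,
  370369544619105731054964715007743821920923755895935941565842622775871671,
  547198754051761728124190617535007711116136522936403778881162881011098703,
  1403230320068393027289467881697241124767715013051430359485552713832673871,
  962165803615707519125182663689750332319283651814730389397503707448617551,
  1182858083684336079810915632754494527715060946237618175208370789947347247,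
  1506808804430900347460328701758838793327075750178170095155755167494918319,
  766185844231384458403554360470640901218788731148321420949222000230215855,
  742393690887854902181556229742821972171428293920886332323214164042789039,
  767890531703145622522869835788372688496644643398281981153097831790489775,
  1526243661706247937309655388119713823455131491019146982981449777931137199,
  247835349553224941876627679525942149923225891506854098847737671118030111,
  962165674805705778663652640584475861368855165714509066071796890977700639,
  595578223643318765748038879258105344582601132674841107421129884853027999,
  591220927575136799375367434891161445663296436288382906620816659101820063,
  1471883800957446806203011779413172191063769718534461391349883789473002143,
  1010545273207264556749030925412847965785748261553167717937470711290546847,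
  246130159664219111470258453396831144630100805295883955104929707838417567,
  546358968802366169935237893986395619448904507971556056517854471458663071,
  545493435352754157256291368300622234872582950625212311812648101260569247]

/-- Digit `n` of the binary number `m`. -/
def digit (m n : ℕ) : ℕ := Nat.mod (Nat.shiftRight m n) 2

/-- The code of entry `i` of the matrix of line `n`. -/
def entry (n i : ℕ) : ℕ :=
  Nat.mod (Nat.shiftRight lineTable (Nat.add (Nat.mul 16 n) (Nat.mul 4 i))) 16

/-- The second half of the coordinates of the point of line `n` whose first half is
`(1, x)` for `x < 16`, and `(0, 1)` for `x = 16`. -/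
def pointCode (x n : ℕ) : ℕ :=
  bif Nat.beq x 16 then Nat.add (entry n 2) (Nat.mul 16 (entry n 3))
  else Nat.add (Nat.xor (entry n 0) (mulCode x (entry n 2)))
    (Nat.mul 16 (Nat.xor (entry n 1) (mulCode x (entry n 3))))

/-- The quadruples of concurrent external lines in the given levels, the first being level `k`. -/
def quadsFrom : ℕ → List (List (ℕ × ℕ × ℕ × ℕ)) → List (ℕ × ℕ × ℕ × ℕ × ℕ)
  | _, [] => []
  | k, r :: rs => r.map (fun q => (q.1, q.2.1, q.2.2.1, q.2.2.2, k)) ++ quadsFrom (k + 1) rs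

/-- All 1020 quadruples `(x, a, b, c, d)` of concurrent external lines. -/
def quads : List (ℕ × ℕ × ℕ × ℕ × ℕ) := quadsFrom 1 quadRows

/-- Whether each quadruple of a level, with digit `b` for its last line, has sum two. -/
noncomputable def levelOk (m b : ℕ) (r : List (ℕ × ℕ × ℕ × ℕ)) : Bool :=
  List.rec (motive := fun _ => Bool) true (fun q _ ih => match q with
    | (_, x, y, z) =>
      bif Nat.beq (Nat.add (Nat.add (digit m x) (digit m y)) (Nat.add (digit m z) b)) 2
        then ih else false) r

/-- Depth-first search for the binary numbers for which all quadruples have sum two. Here `m` is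
the part found so far and `p` the weight of the next digit. -/
noncomputable def search (rs : List (List (ℕ × ℕ × ℕ × ℕ))) : ℕ → ℕ → List ℕ → List ℕ :=
  List.rec (motive := fun _ => ℕ → ℕ → List ℕ → List ℕ) (fun _ m acc => m :: acc)
    (fun r _ ih p m acc =>
      bif levelOk m 1 r then
        bif levelOk m 0 r then ih (Nat.add p p) m (ih (Nat.add p p) (Nat.add m p) acc)
        else ih (Nat.add p p) (Nat.add m p) acc
      else bif levelOk m 0 r then ih (Nat.add p p) m acc else acc) rs

/-- Equality test for lists of numbers. -/
def listBeq : List ℕ → List ℕ → Bool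
  | [], [] => true
  | a :: l, b :: l' => bif Nat.beq a b then listBeq l l' else false
  | _, _ => false

theorem eq_of_listBeq : ∀ l l' : List ℕ, listBeq l l' = true → l = l'
  | [], [], _ => rfl
  | a :: l, b :: l', h => by
    rw [listBeq] at h
    cases hab : Nat.beq a b with
    | false => simp [hab] at h
    | true =>
      rw [hab, cond_true] at h
      rw [Nat.eq_of_beq_eq_true hab, eq_of_listBeq l l' h]
  | [], _ :: _, h => by simp [listBeq] at h
  | _ :: _, [], h => by simp [listBeq] at h

set_option maxRecDepth 100000 in
theorem search_quadRows : search quadRows 2 1 [] = halfSolutions :=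
  eq_of_listBeq _ _ (by decide +kernel)

theorem digit_eq (m n : ℕ) : digit m n = (m.testBit n).toNat := by
  rw [Nat.testBit_eq_decide_div_mod_eq]
  change m >>> n % 2 = _
  rw [Nat.shiftRight_eq_div_pow]
  rcases Nat.mod_two_eq_zero_or_one (m / 2 ^ n) with h | h <;> simp [h]

/-- The sum of the digits of `m` in the places of a quadruple. -/
def quadSum (m : ℕ) (q : ℕ × ℕ × ℕ × ℕ × ℕ) : ℕ :=
  digit m q.2.1 + digit m q.2.2.1 + digit m q.2.2.2.1 + digit m q.2.2.2.2

theorem levelOk_iff (m b : ℕ) (r : List (ℕ × ℕ × ℕ × ℕ)) : levelOk m b r = true ↔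
    ∀ q ∈ r, digit m q.2.1 + digit m q.2.2.1 + digit m q.2.2.2 + b = 2 := by
  induction r with
  | nil => simp [levelOk]
  | cons q r ih =>
    have : levelOk m b (q :: r) = bif Nat.beq (Nat.add (Nat.add (digit m q.2.1) (digit m q.2.2.1))
        (Nat.add (digit m q.2.2.2) b)) 2 then levelOk m b r else false := rfl
    rw [this]
    simp only [List.forall_mem_cons, ← ih, Nat.add_eq, ← add_assoc]
    cases h : Nat.beq (digit m q.2.1 + digit m q.2.2.1 + digit m q.2.2.2 + b) 2 with
    | false => simp [Nat.ne_of_beq_eq_false h]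
    | true => simp [Nat.eq_of_beq_eq_true h]

theorem digit_mod {m k n : ℕ} (h : n < k) : digit (m % 2 ^ k) n = digit m n := by
  rw [digit_eq, digit_eq, Nat.testBit_mod_two_pow]; simp [h]

/-- The conditions on a quadruple `(x, a, b, c, d)` that make it the set of external lines on an
external point. -/
def quadValid (q : ℕ × ℕ × ℕ × ℕ × ℕ) : Bool := match q with
  | (x, a, b, c, d) => Nat.ble x 16 && Nat.blt a b && Nat.blt b c && Nat.blt c d &&
    Nat.blt d 240 && Nat.beq (pointCode x a) (pointCode x d) &&
    Nat.beq (pointCode x b) (pointCode x d) && Nat.beq (pointCode x c) (pointCode x d)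

set_option maxRecDepth 100000 in
theorem quads_valid : quads.all quadValid = true := by decide +kernel

/-- A code for the external point of a quadruple. -/
def quadKey (q : ℕ × ℕ × ℕ × ℕ × ℕ) : ℕ := Nat.add (Nat.mul 256 q.1) (pointCode q.1 q.2.2.2.2)

/-- Whether a list of numbers has no repetitions and no element among the digits of `s`. -/
def distinctFrom : ℕ → List ℕ → Bool
  | _, [] => true
  | s, a :: l => Nat.beq (digit s a) 0 && distinctFrom (Nat.lor s (Nat.shiftLeft 1 a)) l

theorem digit_lor_shiftLeft (s a i : ℕ) :
    digit (Nat.lor s (Nat.shiftLeft 1 a)) i = 1 ↔ digit s i = 1 ∨ i = a := by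
  change digit (s ||| 1 <<< a) i = 1 ↔ _
  rw [digit_eq, digit_eq, Nat.testBit_or, Nat.shiftLeft_eq, one_mul, Nat.testBit_two_pow]
  cases s.testBit i <;> simp [eq_comm]

theorem nodup_of_distinctFrom : ∀ (l : List ℕ) (s : ℕ), distinctFrom s l = true →
    l.Nodup ∧ ∀ a ∈ l, digit s a ≠ 1
  | [], _, _ => by simp
  | a :: l, s, h => by
    simp only [distinctFrom, Bool.and_eq_true] at h
    obtain ⟨h1, h2⟩ := nodup_of_distinctFrom l _ h.2
    have h0 := Nat.eq_of_beq_eq_true h.1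
    refine ⟨List.nodup_cons.2 ⟨fun ha => h2 a ha ((digit_lor_shiftLeft s a a).2 (Or.inr rfl)), h1⟩,
      ?_⟩
    rintro b hb hsb
    rcases List.mem_cons.1 hb with rfl | hb
    · omega
    · exact h2 b hb ((digit_lor_shiftLeft s a b).2 (Or.inl hsb))

set_option maxRecDepth 100000 in
theorem quadKey_nodup : (quads.map quadKey).Nodup :=
  (nodup_of_distinctFrom _ 0 (by decide +kernel)).1

/-- The binary number whose digits are set in the places of a list. -/
def digitSet : List ℕ → ℕ
  | [] => 0
  | a :: l => Nat.lor (digitSet l) (Nat.shiftLeft 1 a)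

theorem mem_of_digit_digitSet : ∀ (l : List ℕ) (i : ℕ), digit (digitSet l) i = 1 → i ∈ l
  | [], i, h => by simp [digitSet, digit_eq] at h
  | a :: l, i, h => by
    rcases (digit_lor_shiftLeft _ _ _).1 h with h | h
    · exact List.mem_cons_of_mem _ (mem_of_digit_digitSet l i h)
    · exact h ▸ List.mem_cons_self

/-- The incident pairs of a quadruple: its first entry with each of its lines. -/
def quadFlags (q : ℕ × ℕ × ℕ × ℕ × ℕ) : List ℕ := match q with
  | (x, a, b, c, d) => [240 * x + a, 240 * x + b, 240 * x + c, 240 * x + d]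

set_option maxRecDepth 100000 in
theorem digitSet_quadFlags : digitSet (quads.flatMap quadFlags) = 2 ^ 4080 - 1 :=
  Nat.eq_of_beq_eq_true (by decide +kernel)

theorem digit_le_one (m n : ℕ) : digit m n = 0 ∨ digit m n = 1 := Nat.mod_two_eq_zero_or_one _

theorem mod_two_pow_succ_eq (M k : ℕ) :
    M % 2 ^ (k + 1) = M % 2 ^ k + 2 ^ k * digit M k := by
  rw [Nat.mod_pow_succ, ← Nat.shiftRight_eq_div_pow]; rfl

theorem mod_two_pow_succ_eq_self_iff {M k m : ℕ} (hm : m < 2 ^ k) :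
    M % 2 ^ (k + 1) = m ↔ M % 2 ^ k = m ∧ digit M k = 0 := by
  have h1 := mod_two_pow_succ_eq M k
  rcases digit_le_one M k with h3 | h3 <;> rw [h3] at h1 ⊢ <;> omega

theorem mod_two_pow_succ_eq_add_iff {M k m : ℕ} (hm : m < 2 ^ k) :
    M % 2 ^ (k + 1) = m + 2 ^ k ↔ M % 2 ^ k = m ∧ digit M k = 1 := by
  have h1 := mod_two_pow_succ_eq M k
  have h2 := Nat.mod_lt M (show 0 < 2 ^ k by positivity)
  rcases digit_le_one M k with h3 | h3 <;> rw [h3] at h1 ⊢ <;> omega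

theorem search_cons (r : List (ℕ × ℕ × ℕ × ℕ)) (rs : List (List (ℕ × ℕ × ℕ × ℕ))) (k m : ℕ)
    (acc : List ℕ) : search (r :: rs) (2 ^ k) m acc =
      bif levelOk m 1 r then
        bif levelOk m 0 r then
          search rs (2 ^ (k + 1)) m (search rs (2 ^ (k + 1)) (m + 2 ^ k) acc)
        else search rs (2 ^ (k + 1)) (m + 2 ^ k) acc
      else bif levelOk m 0 r then search rs (2 ^ (k + 1)) m acc else acc := by
  rw [pow_succ, mul_two]; rfl

theorem mem_search (M : ℕ) (rs : List (List (ℕ × ℕ × ℕ × ℕ))) : ∀ (k m : ℕ) (acc : List ℕ),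
    m < 2 ^ k →
    (∀ q ∈ quadsFrom k rs, q.2.1 < q.2.2.2.2 ∧ q.2.2.1 < q.2.2.2.2 ∧ q.2.2.2.1 < q.2.2.2.2) →
    (M ∈ search rs (2 ^ k) m acc ↔
      M ∈ acc ∨
        (M < 2 ^ (k + rs.length) ∧ M % 2 ^ k = m ∧ ∀ q ∈ quadsFrom k rs, quadSum M q = 2)) := by
  induction rs with
  | nil =>
    intro k m acc hm _
    have : search [] (2 ^ k) m acc = m :: acc := rfl
    rw [this]
    simp only [List.mem_cons, List.length_nil, add_zero, quadsFrom, List.not_mem_nil,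
      false_imp_iff, implies_true, and_true]
    constructor
    · rintro (rfl | h)
      · exact Or.inr ⟨hm, Nat.mod_eq_of_lt hm⟩
      · exact Or.inl h
    · rintro (h | ⟨h1, h2⟩)
      · exact Or.inr h
      · rw [Nat.mod_eq_of_lt h1] at h2; exact Or.inl h2
  | cons r rs ih =>
    intro k m acc hm hq
    have hm1 : m < 2 ^ (k + 1) := hm.trans (Nat.pow_lt_pow_right (by norm_num) (by omega))
    have hm2 : m + 2 ^ k < 2 ^ (k + 1) := by rw [pow_succ]; omega
    have hq' : ∀ q ∈ quadsFrom (k + 1) rs,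
        q.2.1 < q.2.2.2.2 ∧ q.2.2.1 < q.2.2.2.2 ∧ q.2.2.2.1 < q.2.2.2.2 := fun q h =>
      hq q (List.mem_append_right _ h)
    have ih0 := fun acc => ih (k + 1) m acc hm1 hq'
    have ih1 := fun acc => ih (k + 1) (m + 2 ^ k) acc hm2 hq'
    have hlen : k + (r :: rs).length = k + 1 + rs.length := by simp; omega
    have hall : (∀ q ∈ quadsFrom k (r :: rs), quadSum M q = 2) ↔
        (∀ q ∈ r, digit M q.2.1 + digit M q.2.2.1 + digit M q.2.2.2 + digit M k = 2) ∧
          ∀ q ∈ quadsFrom (k + 1) rs, quadSum M q = 2 := by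
      rw [quadsFrom, List.forall_mem_append, List.forall_mem_map]; rfl
    have hr : ∀ b, M % 2 ^ k = m → (levelOk m b r = true ↔
        ∀ q ∈ r, digit M q.2.1 + digit M q.2.2.1 + digit M q.2.2.2 + b = 2) := by
      rintro b rfl
      rw [levelOk_iff]
      refine forall₂_congr fun q h => ?_
      have := hq _ (List.mem_append_left _ (List.mem_map_of_mem h))
      simp only at this
      rw [digit_mod this.1, digit_mod this.2.1, digit_mod this.2.2]
    rw [mod_two_pow_succ_eq_self_iff hm] at ih0
    rw [mod_two_pow_succ_eq_add_iff hm] at ih1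
    rw [search_cons, hlen, hall]
    by_cases hmod : M % 2 ^ k = m
    · have h0 := hr 0 hmod
      have h1 := hr 1 hmod
      simp only [hmod, true_and] at ih0 ih1 ⊢
      rcases digit_le_one M k with h3 | h3 <;> rw [h3] at ih0 ih1 ⊢
      · rw [← h0]
        cases levelOk m 1 r <;> cases levelOk m 0 r <;> simp [ih0, ih1]
      · rw [← h1]
        cases levelOk m 1 r <;> cases levelOk m 0 r <;> simp [ih0, ih1]
    · simp only [hmod, false_and, and_false, or_false] at ih0 ih1 ⊢
      cases levelOk m 1 r <;> cases levelOk m 0 r <;> simp [ih0, ih1]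

theorem valid_of_mem_quads {x a b c d : ℕ} (h : (x, a, b, c, d) ∈ quads) :
    x ≤ 16 ∧ a < b ∧ b < c ∧ c < d ∧ d < 240 ∧ pointCode x a = pointCode x d ∧
      pointCode x b = pointCode x d ∧ pointCode x c = pointCode x d := by
  have := List.all_eq_true.1 quads_valid _ h
  simp only [quadValid, Bool.and_eq_true, Nat.ble_eq, Nat.blt_eq, Nat.beq_eq] at this
  tauto

theorem mem_halfSolutions (M : ℕ) : M ∈ halfSolutions ↔
    M < 2 ^ 240 ∧ digit M 0 = 1 ∧ ∀ q ∈ quads, quadSum M q = 2 := by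
  have h := mem_search M quadRows 1 1 [] (by norm_num) (by
    rintro ⟨x, a, b, c, d⟩ hq
    have := valid_of_mem_quads hq
    simp only
    omega)
  rw [pow_one, search_quadRows] at h
  have hlen : 1 + quadRows.length = 240 := by decide +kernel
  rw [h, hlen]
  simp only [List.not_mem_nil, false_or]
  rfl

/-- The lines of a quadruple are all the lines with the same point code. -/
theorem exists_quad {x n : ℕ} (hx : x ≤ 16) (hn : n < 240) : ∃ a b c d, (x, a, b, c, d) ∈ quads ∧
    ∀ m < 240, pointCode x m = pointCode x n ↔ m = a ∨ m = b ∨ m = c ∨ m = d := by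
  have hflag : ∀ m < 240, ∃ a b c d, (x, a, b, c, d) ∈ quads ∧
      (m = a ∨ m = b ∨ m = c ∨ m = d) := by
    intro m hm
    have h1 : digit (digitSet (quads.flatMap quadFlags)) (240 * x + m) = 1 := by
      rw [digitSet_quadFlags, digit_eq, Nat.testBit_two_pow_sub_one]
      simp; omega
    obtain ⟨⟨y, a, b, c, d⟩, hq, h2⟩ := List.mem_flatMap.1 (mem_of_digit_digitSet _ _ h1)
    have := valid_of_mem_quads hq
    simp only [quadFlags, List.mem_cons, List.not_mem_nil, or_false] at h2
    obtain rfl : x = y := by omega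
    exact ⟨a, b, c, d, hq, by omega⟩
  obtain ⟨a, b, c, d, hq, hnq⟩ := hflag n hn
  have hv := valid_of_mem_quads hq
  have hnd : pointCode x n = pointCode x d := by
    rcases hnq with rfl | rfl | rfl | rfl <;> tauto
  refine ⟨a, b, c, d, hq, fun m hm => ⟨fun h => ?_, ?_⟩⟩
  · obtain ⟨a', b', c', d', hq', hmq⟩ := hflag m hm
    have hv' := valid_of_mem_quads hq'
    have hmd : pointCode x m = pointCode x d' := by
      rcases hmq with rfl | rfl | rfl | rfl <;> tauto
    have := List.inj_on_of_nodup_map quadKey_nodup hq hq' (by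
      simp only [quadKey]; rw [← hnd, ← hmd, h])
    simp only [Prod.mk.injEq] at this
    omega
  · rw [hnd]; rintro (rfl | rfl | rfl | rfl) <;> tauto

theorem pointCode_eq_iff {x a b c d m : ℕ} (h : (x, a, b, c, d) ∈ quads) (hm : m < 240) :
    pointCode x m = pointCode x d ↔ m = a ∨ m = b ∨ m = c ∨ m = d := by
  have hv := valid_of_mem_quads h
  obtain ⟨a', b', c', d', hq, hc⟩ := exists_quad hv.1 hv.2.2.2.2.1
  have hv' := valid_of_mem_quads hq
  have hd : pointCode x d' = pointCode x d :=
    (hc d' hv'.2.2.2.2.1).2 (Or.inr (Or.inr (Or.inr rfl)))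
  have := List.inj_on_of_nodup_map quadKey_nodup h hq (by simp only [quadKey, hd])
  simp only [Prod.mk.injEq, true_and] at this
  obtain ⟨rfl, rfl, rfl, rfl⟩ := this
  exact hc m hm

/-- All solutions of the balance conditions. -/
def solutions : List ℕ := halfSolutions ++ halfSolutions.map fun M => 2 ^ 240 - (M + 1)

theorem digit_compl {M n : ℕ} (hM : M < 2 ^ 240) (hn : n < 240) :
    digit (2 ^ 240 - (M + 1)) n + digit M n = 1 := by
  rw [digit_eq, digit_eq, Nat.testBit_two_pow_sub_succ hM]
  cases M.testBit n <;> simp [hn]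

theorem quadSum_compl {M : ℕ} {q : ℕ × ℕ × ℕ × ℕ × ℕ} (hM : M < 2 ^ 240) (hq : q ∈ quads) :
    quadSum (2 ^ 240 - (M + 1)) q + quadSum M q = 4 := by
  obtain ⟨x, a, b, c, d⟩ := q
  have hv := valid_of_mem_quads hq
  have h1 := digit_compl hM (n := a) (by omega)
  have h2 := digit_compl hM (n := b) (by omega)
  have h3 := digit_compl hM (n := c) (by omega)
  have h4 := digit_compl hM (n := d) (by omega)
  simp only [quadSum]
  omega

theorem mem_solutions (M : ℕ) :
    M ∈ solutions ↔ M < 2 ^ 240 ∧ ∀ q ∈ quads, quadSum M q = 2 := by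
  simp only [solutions, List.mem_append, List.mem_map, mem_halfSolutions]
  constructor
  · rintro (⟨h1, -, h2⟩ | ⟨N, ⟨h1, -, h2⟩, rfl⟩)
    · exact ⟨h1, h2⟩
    · refine ⟨by omega, fun q hq => ?_⟩
      have := quadSum_compl h1 hq
      have := h2 q hq
      omega
  · rintro ⟨h1, h2⟩
    have h3 := digit_compl h1 (n := 0) (by norm_num)
    rcases digit_le_one M 0 with h0 | h0
    · refine Or.inr ⟨2 ^ 240 - (M + 1), ⟨by omega, by omega, fun q hq => ?_⟩, by omega⟩
      have := quadSum_compl h1 hq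
      have := h2 q hq
      omega
    · exact Or.inl ⟨h1, h0, h2⟩

set_option maxRecDepth 100000 in
theorem solutions_nodup : solutions.Nodup := by
  decide +kernel

theorem length_solutions : solutions.length = 240 := by
  simp only [solutions, List.length_append, List.length_map]; rfl

section Geometry

variable {K : Type*} [Field K]

/-- The line of `PG(3, K)` spanned by `(1, 0, a, b)` and `(0, 1, c, d)`. -/
def graphLine (a b c d : K) : Submodule K (Fin 4 → K) :=
  Submodule.span K {![1, 0, a, b], ![0, 1, c, d]}

theorem mem_graphLine {a b c d : K} {v : Fin 4 → K} :
    v ∈ graphLine a b c d ↔ v 2 = v 0 * a + v 1 * c ∧ v 3 = v 0 * b + v 1 * d := by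
  rw [graphLine, Submodule.mem_span_pair]
  constructor
  · rintro ⟨s, t, rfl⟩
    simp
  · rintro ⟨h2, h3⟩
    refine ⟨v 0, v 1, ?_⟩
    ext i
    fin_cases i <;> simp [h2, h3]

theorem finrank_span_pair {r s : Fin 4 → K} (h : LinearIndependent K ![r, s]) :
    Module.finrank K (Submodule.span K {r, s}) = 2 := by
  have := finrank_span_eq_card h
  rwa [Matrix.range_cons, Matrix.range_cons, Matrix.range_empty, Set.union_empty,
    Set.singleton_union, Fintype.card_fin] at this

theorem finrank_graphLine (a b c d : K) : Module.finrank K (graphLine a b c d) = 2 := by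
  refine finrank_span_pair (LinearIndependent.pair_iff.2 fun s t h => ?_)
  have h0 := congrFun h 0
  have h1 := congrFun h 1
  simpa using And.intro h0 h1

theorem graphLine_injective {a b c d a' b' c' d' : K}
    (h : graphLine a b c d = graphLine a' b' c' d') : a = a' ∧ b = b' ∧ c = c' ∧ d = d' := by
  have h1 : ![1, 0, a, b] ∈ graphLine a b c d := mem_graphLine.2 (by simp)
  have h2 : ![0, 1, c, d] ∈ graphLine a b c d := mem_graphLine.2 (by simp)
  rw [h, mem_graphLine] at h1 h2
  simp at h1 h2
  tauto

theorem add_pow_four [CharP K 2] (x y : K) : (x + y) ^ 4 = x ^ 4 + y ^ 4 := by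
  have h2 : (2 : K) = 0 := CharP.cast_eq_zero K 2
  linear_combination (2 * x ^ 3 * y + 3 * x ^ 2 * y ^ 2 + 2 * x * y ^ 3) * h2

theorem hermForm_add_left (x y z : Fin 4 → K) :
    hermForm 4 (x + y) z = hermForm 4 x z + hermForm 4 y z := by
  simp only [hermForm, Pi.add_apply]; ring

theorem hermForm_smul_left (t : K) (x z : Fin 4 → K) :
    hermForm 4 (t • x) z = t * hermForm 4 x z := by
  simp only [hermForm, Pi.smul_apply, smul_eq_mul]; ring

theorem hermForm_add_right [CharP K 2] (x y z : Fin 4 → K) :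
    hermForm 4 z (x + y) = hermForm 4 z x + hermForm 4 z y := by
  simp only [hermForm, Pi.add_apply, add_pow_four]; ring

theorem hermForm_smul_right (t : K) (x z : Fin 4 → K) :
    hermForm 4 z (t • x) = t ^ 4 * hermForm 4 z x := by
  simp only [hermForm, Pi.smul_apply, smul_eq_mul, mul_pow]; ring

theorem hermForm_pow_four [CharP K 2] (h16 : ∀ x : K, x ^ 16 = x) (x y : Fin 4 → K) :
    hermForm 4 x y ^ 4 = hermForm 4 y x := by
  simp only [hermForm, add_pow_four, mul_pow, ← pow_mul]
  norm_num [h16]; ring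

theorem hermForm_eq_zero_comm [CharP K 2] (h16 : ∀ x : K, x ^ 16 = x) {x y : Fin 4 → K}
    (h : hermForm 4 x y = 0) : hermForm 4 y x = 0 := by
  rw [← hermForm_pow_four h16, h]; norm_num

theorem isotropic_span_pair [CharP K 2] (h16 : ∀ x : K, x ^ 16 = x) {r s : Fin 4 → K}
    (hrr : hermForm 4 r r = 0) (hrs : hermForm 4 r s = 0) (hss : hermForm 4 s s = 0) :
    ∀ x ∈ Submodule.span K {r, s}, ∀ y ∈ Submodule.span K {r, s}, hermForm 4 x y = 0 := by
  have hsr := hermForm_eq_zero_comm h16 hrs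
  intro x hx y hy
  obtain ⟨a, b, rfl⟩ := Submodule.mem_span_pair.1 hx
  obtain ⟨c, d, rfl⟩ := Submodule.mem_span_pair.1 hy
  simp [hermForm_add_left, hermForm_add_right, hermForm_smul_left, hermForm_smul_right, *]

/-- The conditions that make `graphLine a b c d` an external line. -/
def IsExternalMatrix (a b c d : K) : Prop :=
  a * b ^ 4 + b * a ^ 4 = 0 ∧ c * d ^ 4 + d * c ^ 4 = 0 ∧ 1 + a * d ^ 4 + b * c ^ 4 = 0 ∧
    a * d + b * c ≠ 1

theorem eq_det_mul_pow_four [CharP K 2] (h16 : ∀ x : K, x ^ 16 = x) {a b c d : K}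
    (h1 : a * b ^ 4 + b * a ^ 4 = 0) (h3 : c * d ^ 4 + d * c ^ 4 = 0)
    (h4 : 1 + a * d ^ 4 + b * c ^ 4 = 0) :
    a = (a * d + b * c) * a ^ 4 ∧ b = (a * d + b * c) * b ^ 4 ∧
      c = (a * d + b * c) * c ^ 4 ∧ d = (a * d + b * c) * d ^ 4 := by
  have h2 : (2 : K) = 0 := CharP.cast_eq_zero K 2
  have h5 : 1 + d * a ^ 4 + c * b ^ 4 = 0 := by
    have : (1 + a * d ^ 4 + b * c ^ 4) ^ 4 = 0 := by rw [h4]; norm_num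
    rw [add_pow_four, add_pow_four, mul_pow, mul_pow, ← pow_mul, ← pow_mul] at this
    norm_num [h16] at this
    linear_combination this
  refine ⟨?_, ?_, ?_, ?_⟩
  · linear_combination (-a) * h5 + c * h1 + (a + a * d * a ^ 4 * 0) * h2 - b * c * a ^ 4 * h2
  · linear_combination (-b) * h5 + d * h1 + b * h2 - a * d * b ^ 4 * h2
  · linear_combination (-c) * h4 + a * h3 + c * h2 - a * d * c ^ 4 * h2
  · linear_combination (-d) * h4 + b * h3 + d * h2 - b * c * d ^ 4 * h2

theorem IsExternalMatrix.conj [CharP K 2] (h16 : ∀ x : K, x ^ 16 = x) {a b c d : K}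
    (h : IsExternalMatrix a b c d) :
    a = (a * d + b * c) * a ^ 4 ∧ b = (a * d + b * c) * b ^ 4 ∧
      c = (a * d + b * c) * c ^ 4 ∧ d = (a * d + b * c) * d ^ 4 :=
  eq_det_mul_pow_four h16 h.1 h.2.1 h.2.2.1

theorem IsExternalMatrix.det_ne_zero [CharP K 2] (h16 : ∀ x : K, x ^ 16 = x) {a b c d : K}
    (h : IsExternalMatrix a b c d) : a * d + b * c ≠ 0 := by
  intro h0
  obtain ⟨ha, hb, -, -⟩ := h.conj h16
  rw [h0, zero_mul] at ha hb
  have := h.2.2.1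
  rw [ha, hb] at this
  simp at this

theorem graphLine_mem_externalLines [CharP K 2] (h16 : ∀ x : K, x ^ 16 = x) {a b c d : K}
    (h : IsExternalMatrix a b c d) : graphLine a b c d ∈ externalLines 4 := by
  have h2 : (2 : K) = 0 := CharP.cast_eq_zero K 2
  refine ⟨⟨finrank_graphLine a b c d, isotropic_span_pair h16 ?_ ?_ ?_⟩, ?_⟩
  · simpa [hermForm] using h.1
  · simpa [hermForm] using h.2.2.1
  · simpa [hermForm] using h.2.1
  rintro P ⟨v, hv0, hv, rfl⟩ hle
  obtain ⟨e2, e3⟩ := mem_graphLine.1 (hle (Submodule.mem_span_singleton_self v))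
  obtain ⟨ha, hb, hc, hd⟩ := h.conj h16
  have hdet := h.det_ne_zero h16
  have hdet1 := h.2.2.2
  set δ := a * d + b * c with hδ
  have e2' : v 2 = δ * v 2 := by
    conv_rhs => rw [← hv 2, e2, add_pow_four, mul_pow, mul_pow, hv, hv]
    rw [e2]; linear_combination v 0 * ha + v 1 * hc
  have e3' : v 3 = δ * v 3 := by
    conv_rhs => rw [← hv 3, e3, add_pow_four, mul_pow, mul_pow, hv, hv]
    rw [e3]; linear_combination v 0 * hb + v 1 * hd
  have z : ∀ t : K, t = δ * t → t = 0 := fun t ht => by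
    have : (δ - 1) * t = 0 := by linear_combination -ht
    exact (mul_eq_zero.1 this).resolve_left (sub_ne_zero.2 hdet1)
  have z2 := z _ e2'
  have z3 := z _ e3'
  have z0 : v 0 = 0 := by
    have : δ * v 0 = 0 := by
      rw [hδ]; linear_combination d * (z2 - e2) - c * (z3 - e3) + (v 0 * b * c) * h2
    exact (mul_eq_zero.1 this).resolve_left hdet
  have z1 : v 1 = 0 := by
    have : δ * v 1 = 0 := by
      rw [hδ]; linear_combination a * (z3 - e3) - b * (z2 - e2) + (v 1 * b * c) * h2
    exact (mul_eq_zero.1 this).resolve_left hdet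
  apply hv0
  ext i
  fin_cases i <;> assumption

theorem eq_zero_of_mem_externalLine [CharP K 2] {l : Submodule K (Fin 4 → K)} (hl : l ∈ externalLines 4)
    {v : Fin 4 → K} (hv : v ∈ l) (h0 : v 0 = 0) (h1 : v 1 = 0) : v = 0 := by
  by_contra hne
  have hh := hl.1.2 v hv v hv
  simp only [hermForm, h0, h1, zero_mul, zero_add] at hh
  suffices h : ∃ w : Fin 4 → K, w ≠ 0 ∧ (∀ i, w i ^ 4 = w i) ∧ w ∈ l by
    obtain ⟨w, hw0, hw, hwl⟩ := h
    exact hl.2 _ ⟨w, hw0, hw, rfl⟩ ((Submodule.span_singleton_le_iff_mem w l).2 hwl)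
  by_cases h3 : v 3 = 0
  · have h2 : v 2 ≠ 0 := fun h2 => hne (by ext i; fin_cases i <;> assumption)
    refine ⟨(v 2)⁻¹ • v, smul_ne_zero (inv_ne_zero h2) hne, fun i => ?_, l.smul_mem _ hv⟩
    fin_cases i <;> simp [h0, h1, h2, h3]
  · refine ⟨(v 3)⁻¹ • v, smul_ne_zero (inv_ne_zero h3) hne, fun i => ?_, l.smul_mem _ hv⟩
    have h2 : (2 : K) = 0 := CharP.cast_eq_zero K 2
    have : ((v 3)⁻¹ * v 2) ^ 4 = (v 3)⁻¹ * v 2 := by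
      have hh' : v 2 * v 3 ^ 3 + v 2 ^ 4 = 0 :=
        (mul_eq_zero.1 (show v 3 * (v 2 * v 3 ^ 3 + v 2 ^ 4) = 0 by linear_combination hh)).resolve_left
          h3
      field_simp
      linear_combination hh' - v 2 * v 3 ^ 3 * h2
    fin_cases i <;> simp [h0, h1, h3]
    simpa using this

theorem exists_graphLine_eq [CharP K 2] (h16 : ∀ x : K, x ^ 16 = x)
    {l : Submodule K (Fin 4 → K)} (hl : l ∈ externalLines 4) :
    ∃ a b c d : K, IsExternalMatrix a b c d ∧ l = graphLine a b c d := by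
  have h2 : (2 : K) = 0 := CharP.cast_eq_zero K 2
  let f : l →ₗ[K] (Fin 2 → K) :=
    (LinearMap.pi ![LinearMap.proj 0, LinearMap.proj 1]).comp l.subtype
  have hf : Function.Injective f := by
    rw [← LinearMap.ker_eq_bot, LinearMap.ker_eq_bot']
    intro v hv
    exact Subtype.ext (eq_zero_of_mem_externalLine hl v.2 (congrFun hv 0) (congrFun hv 1))
  have hsurj : Function.Surjective f :=
    (LinearMap.injective_iff_surjective_of_finrank_eq_finrank
      (by rw [hl.1.1, Module.finrank_fin_fun])).1 hf
  obtain ⟨r, hr⟩ := hsurj ![1, 0]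
  obtain ⟨s, hs⟩ := hsurj ![0, 1]
  have hr0 : r.1 0 = 1 := congrFun hr 0
  have hr1 : r.1 1 = 0 := congrFun hr 1
  have hs0 : s.1 0 = 0 := congrFun hs 0
  have hs1 : s.1 1 = 1 := congrFun hs 1
  have er : r.1 = ![1, 0, r.1 2, r.1 3] := by ext i; fin_cases i <;> simp [hr0, hr1]
  have es : s.1 = ![0, 1, s.1 2, s.1 3] := by ext i; fin_cases i <;> simp [hs0, hs1]
  have hle : graphLine (r.1 2) (r.1 3) (s.1 2) (s.1 3) ≤ l := by
    rw [graphLine, ← er, ← es, Submodule.span_le]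
    rintro x (rfl | rfl)
    exacts [r.2, s.2]
  have heq := Submodule.eq_of_le_of_finrank_eq hle (by rw [finrank_graphLine, hl.1.1])
  have h1 : r.1 2 * r.1 3 ^ 4 + r.1 3 * r.1 2 ^ 4 = 0 := by
    have := hl.1.2 _ r.2 _ r.2
    rw [er] at this
    simpa [hermForm] using this
  have h3 : s.1 2 * s.1 3 ^ 4 + s.1 3 * s.1 2 ^ 4 = 0 := by
    have := hl.1.2 _ s.2 _ s.2
    rw [es] at this
    simpa [hermForm] using this
  have h4 : 1 + r.1 2 * s.1 3 ^ 4 + r.1 3 * s.1 2 ^ 4 = 0 := by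
    have := hl.1.2 _ r.2 _ s.2
    rw [er, es] at this
    simpa [hermForm] using this
  refine ⟨_, _, _, _, ⟨h1, h3, h4, fun hdet => ?_⟩, heq.symm⟩
  obtain ⟨ha, hb, -, -⟩ := eq_det_mul_pow_four h16 h1 h3 h4
  rw [hdet, one_mul] at ha hb
  refine hl.2 _ ⟨r.1, fun h => ?_, fun i => ?_, rfl⟩
    ((Submodule.span_singleton_le_iff_mem _ l).2 r.2)
  · rw [h] at hr0; simp at hr0
  · fin_cases i
    · simp [hr0]
    · simp [hr1]
    · exact ha.symm
    · exact hb.symm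

end Geometry

/-- The code of the fourth power. -/
def frobCode (a : ℕ) : ℕ := mulCode (mulCode a a) (mulCode a a)

/-- The conditions for an external line, in terms of codes. -/
def externalCode (a b c d : ℕ) : Bool :=
  Nat.beq (Nat.xor (mulCode a (frobCode b)) (mulCode b (frobCode a))) 0 &&
    Nat.beq (Nat.xor (mulCode c (frobCode d)) (mulCode d (frobCode c))) 0 &&
    Nat.beq (Nat.xor (Nat.xor 1 (mulCode a (frobCode d))) (mulCode b (frobCode c))) 0 &&
    !Nat.beq (Nat.xor (mulCode a d) (mulCode b c)) 1

theorem externalCode_entry :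
    ∀ n < 240, externalCode (entry n 0) (entry n 1) (entry n 2) (entry n 3) = true := by
  decide +kernel

theorem exists_entry_eq : ∀ e ∈ [8, 10, 12, 15], ∀ a ∈ [0, 1, 6, 7], ∀ b ∈ [0, 1, 6, 7],
    ∀ c ∈ [0, 1, 6, 7], ∀ d ∈ [0, 1, 6, 7], Nat.xor (mulCode a d) (mulCode b c) = 1 →
    ∃ n < 240, entry n 0 = mulCode e a ∧ entry n 1 = mulCode e b ∧
      entry n 2 = mulCode e c ∧ entry n 3 = mulCode e d := by
  decide +kernel

set_option maxRecDepth 100000 in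
theorem entry_nodup : ((List.range 240).map fun n =>
    entry n 0 + 16 * entry n 1 + 256 * entry n 2 + 4096 * entry n 3).Nodup := by
  decide +kernel

theorem mem_of_frobCode_eq : ∀ a < 16, frobCode a = a → a ∈ [0, 1, 6, 7] := by decide +kernel

theorem mem_of_pow_five_code : ∀ a < 16, mulCode a (frobCode a) = 1 → a ≠ 1 →
    a ∈ [8, 10, 12, 15] := by decide +kernel

theorem mulCode_lt (a b : ℕ) : mulCode a b < 16 := Nat.mod_lt _ (by norm_num)

theorem entry_lt (n i : ℕ) : entry n i < 16 := Nat.mod_lt _ (by norm_num)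

section Lines

variable {K : Type*} [Field K] [CharP K 2] {υ : K}

theorem dec_frobCode (hυ : υ ^ 4 = υ + 1) (a : ℕ) : dec υ (frobCode a) = dec υ a ^ 4 := by
  rw [frobCode, dec_mulCode hυ, dec_mulCode hυ]; ring

/-- External line number `n`. -/
def line (υ : K) (n : ℕ) : Submodule K (Fin 4 → K) :=
  graphLine (dec υ (entry n 0)) (dec υ (entry n 1)) (dec υ (entry n 2)) (dec υ (entry n 3))

theorem line_mem_externalLines (h16 : ∀ x : K, x ^ 16 = x) (hυ : υ ^ 4 = υ + 1) {n : ℕ}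
    (hn : n < 240) : line υ n ∈ externalLines 4 := by
  have h := externalCode_entry n hn
  simp only [externalCode, Bool.and_eq_true, Nat.beq_eq, Bool.not_eq_true'] at h
  obtain ⟨⟨⟨h1, h2⟩, h3⟩, h4⟩ := h
  have h4 := Nat.ne_of_beq_eq_false h4
  refine graphLine_mem_externalLines h16 ⟨?_, ?_, ?_, ?_⟩
  · simpa [dec_xor, dec_mulCode hυ, dec_frobCode hυ] using congrArg (dec υ) h1
  · simpa [dec_xor, dec_mulCode hυ, dec_frobCode hυ] using congrArg (dec υ) h2
  · simpa [dec_xor, dec_mulCode hυ, dec_frobCode hυ] using congrArg (dec υ) h3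
  · rw [← dec_mulCode hυ, ← dec_mulCode hυ, ← dec_xor, ← dec_one (υ := υ)]
    exact fun h => h4 (dec_injOn hυ
      (Nat.xor_lt_two_pow (n := 4) (mulCode_lt _ _) (mulCode_lt _ _)) (by norm_num) h)

theorem line_injOn (hυ : υ ^ 4 = υ + 1) {m n : ℕ} (hm : m < 240) (hn : n < 240)
    (h : line υ m = line υ n) : m = n := by
  obtain ⟨h0, h1, h2, h3⟩ := graphLine_injective h
  have e := fun i => dec_injOn hυ (entry_lt m i) (entry_lt n i)
  refine List.inj_on_of_nodup_map entry_nodup (List.mem_range.2 hm) (List.mem_range.2 hn) ?_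
  simp only [e 0 h0, e 1 h1, e 2 h2, e 3 h3]

theorem exists_line_eq (hK : Nat.card K = 4 ^ 2) (hυ : υ ^ 4 = υ + 1)
    {l : Submodule K (Fin 4 → K)} (hl : l ∈ externalLines 4) : ∃ n < 240, line υ n = l := by
  have h2 : (2 : K) = 0 := CharP.cast_eq_zero K 2
  have h16 := pow_sixteen_of_card hK
  obtain ⟨a, b, c, d, h, rfl⟩ := exists_graphLine_eq h16 hl
  obtain ⟨ha, hb, hc, hd⟩ := h.conj h16
  have hdet := h.det_ne_zero h16
  have hdet1 := h.2.2.2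
  set δ := a * d + b * c with hδ
  have key : ∀ z : K, z = δ * z ^ 4 → z = δ ^ 5 * z := by
    intro z hz
    have h1 : z ^ 4 = δ ^ 4 * z := by
      conv_lhs => rw [hz]
      rw [mul_pow, ← pow_mul, h16]
    calc z = δ * z ^ 4 := hz
      _ = δ ^ 5 * z := by rw [h1]; ring
  have hδ5 : δ ^ 5 = 1 := by
    have h1 : (δ ^ 5 - 1) * a = 0 := by linear_combination -key a ha
    have h3 : (δ ^ 5 - 1) * b = 0 := by linear_combination -key b hb
    have h4 : (δ ^ 5 - 1) * δ = 0 := by rw [hδ]; linear_combination d * h1 + c * h3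
    exact sub_eq_zero.1 ((mul_eq_zero.1 h4).resolve_right hdet)
  have hr : ∀ z : K, z = δ * z ^ 4 → ∃ n ∈ [0, 1, 6, 7], dec υ n = δ ^ 2 * z := by
    intro z hz
    obtain ⟨n, hn, hnz⟩ := exists_dec_eq hυ hK (δ ^ 2 * z)
    refine ⟨n, mem_of_frobCode_eq n hn (dec_injOn hυ (mulCode_lt _ _) hn ?_), hnz⟩
    rw [dec_frobCode hυ, hnz]
    calc (δ ^ 2 * z) ^ 4 = δ ^ 5 * δ ^ 2 * (δ * z ^ 4) := by ring
      _ = δ ^ 2 * z := by rw [← hz, hδ5, one_mul]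
  obtain ⟨a', ha', ea⟩ := hr a ha
  obtain ⟨b', hb', eb⟩ := hr b hb
  obtain ⟨c', hc', ec⟩ := hr c hc
  obtain ⟨d', hd', ed⟩ := hr d hd
  obtain ⟨e, he, ee⟩ := exists_dec_eq hυ hK (δ ^ 3)
  have he' : e ∈ [8, 10, 12, 15] := by
    refine mem_of_pow_five_code e he (dec_injOn hυ (mulCode_lt _ _) (by norm_num) ?_) ?_
    · rw [dec_mulCode hυ, dec_frobCode hυ, ee, dec_one]
      linear_combination (δ ^ 10 + δ ^ 5 + 1) * hδ5
    · rintro rfl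
      rw [dec_one] at ee
      apply hdet1
      linear_combination (-δ) * hδ5 - (δ ^ 3 + 1) * ee
  have hdet' : Nat.xor (mulCode a' d') (mulCode b' c') = 1 := by
    refine dec_injOn hυ (Nat.xor_lt_two_pow (n := 4) (mulCode_lt _ _) (mulCode_lt _ _))
      (by norm_num) ((dec_xor _ _).trans ?_)
    rw [dec_mulCode hυ, dec_mulCode hυ, ea, eb, ec, ed, dec_one]
    linear_combination hδ5 - δ ^ 4 * hδ
  obtain ⟨n, hn, e0, e1, e2, e3⟩ :=
    exists_entry_eq e he' a' ha' b' hb' c' hc' d' hd' hdet'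
  refine ⟨n, hn, ?_⟩
  have hm : ∀ z : K, δ ^ 3 * (δ ^ 2 * z) = z := fun z => by linear_combination z * hδ5
  rw [line, e0, e1, e2, e3]
  simp only [dec_mulCode hυ, ea, eb, ec, ed, ee, hm]

end Lines

open scoped Classical in
theorem ncard_image_quad {α : Type*} {f : ℕ → α} {a b c d : ℕ} (hab : a < b) (hbc : b < c)
    (hcd : c < d) (hd : d < 240) (hf : Set.InjOn f (Set.Iio 240)) (R : Set α) :
    {l | l ∈ R ∧ ∃ n, (n = a ∨ n = b ∨ n = c ∨ n = d) ∧ l = f n}.ncard =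
      (if f a ∈ R then 1 else 0) + (if f b ∈ R then 1 else 0) + (if f c ∈ R then 1 else 0) +
        (if f d ∈ R then 1 else 0) := by
  have h : {l | l ∈ R ∧ ∃ n, (n = a ∨ n = b ∨ n = c ∨ n = d) ∧ l = f n} =
      f '' (({a, b, c, d} : Finset ℕ).filter fun n => f n ∈ R) := by
    ext l
    simp only [Set.mem_ofPred_eq, Set.mem_image, Finset.coe_filter, Finset.mem_insert,
      Finset.mem_singleton]
    constructor
    · rintro ⟨hl, n, hn, rfl⟩; exact ⟨n, ⟨hn, hl⟩, rfl⟩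
    · rintro ⟨n, ⟨hn, hl⟩, rfl⟩; exact ⟨hl, n, hn, rfl⟩
  rw [h, Set.InjOn.ncard_image, Set.ncard_coe_finset, Finset.card_filter,
    Finset.sum_insert, Finset.sum_insert, Finset.sum_insert, Finset.sum_singleton]
  · ring
  · simp; omega
  · simp; omega
  · simp; omega
  · refine hf.mono fun n hn => ?_
    simp only [Finset.coe_filter, Finset.mem_insert, Finset.mem_singleton, Set.mem_ofPred_eq] at hn
    simp only [Set.mem_Iio]
    omega

section Hemisystems

variable {K : Type*} [Field K] {υ : K}

/-- The point of line `n` whose first two coordinates are `(1, x)` for `x < 16`, and `(0, 1)` for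
`x = 16`. -/
def pointVec (υ : K) (x n : ℕ) : Fin 4 → K :=
  bif Nat.beq x 16 then ![0, 1, dec υ (entry n 2), dec υ (entry n 3)]
  else ![1, dec υ x, dec υ (entry n 0) + dec υ x * dec υ (entry n 2),
    dec υ (entry n 1) + dec υ x * dec υ (entry n 3)]

theorem pointVec_ne_zero (x n : ℕ) : pointVec υ x n ≠ 0 := by
  intro h
  unfold pointVec at h
  cases hx : Nat.beq x 16 <;> rw [hx] at h
  · simpa using congrFun h 0
  · simpa using congrFun h 1

theorem pointVec_mem_line (x n : ℕ) : pointVec υ x n ∈ line υ n := by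
  unfold pointVec line
  cases Nat.beq x 16 <;> rw [mem_graphLine] <;> simp

theorem pointVec_mem_line_iff [CharP K 2] (hυ : υ ^ 4 = υ + 1) (x n m : ℕ) :
    pointVec υ x n ∈ line υ m ↔ pointCode x m = pointCode x n := by
  have hlt : ∀ i j : ℕ, Nat.xor (entry i j) (mulCode x (entry i (j + 2))) < 16 := fun i j =>
    Nat.xor_lt_two_pow (n := 4) (entry_lt _ _) (mulCode_lt _ _)
  have split : ∀ {s t s' t' : ℕ}, s < 16 → s' < 16 →
      (Nat.add s (Nat.mul 16 t) = Nat.add s' (Nat.mul 16 t') ↔ s = s' ∧ t = t') := by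
    intro s t s' t' hs hs'
    change s + 16 * t = s' + 16 * t' ↔ _
    omega
  unfold pointVec line pointCode
  rw [mem_graphLine]
  cases Nat.beq x 16
  · rw [cond_false, cond_false, cond_false, split (hlt m 0) (hlt n 0)]
    have e : ∀ j, Nat.xor (entry m j) (mulCode x (entry m (j + 2))) =
        Nat.xor (entry n j) (mulCode x (entry n (j + 2))) ↔
        dec υ (entry n j) + dec υ x * dec υ (entry n (j + 2)) =
          dec υ (entry m j) + dec υ x * dec υ (entry m (j + 2)) := by
      intro j
      rw [← dec_mulCode hυ, ← dec_mulCode hυ, ← dec_xor, ← dec_xor]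
      exact ⟨fun h => congrArg (dec υ) h.symm, fun h => dec_injOn hυ (hlt m j) (hlt n j) h.symm⟩
    rw [e 0, e 1]
    simp
  · rw [cond_true, cond_true, cond_true, split (entry_lt m 2) (entry_lt n 2)]
    have e : ∀ j, entry m j = entry n j ↔ dec υ (entry n j) = dec υ (entry m j) := fun j =>
      ⟨fun h => congrArg (dec υ) h.symm, fun h => dec_injOn hυ (entry_lt m j) (entry_lt n j) h.symm⟩
    rw [e 2, e 3]
    simp

theorem exists_smul_pointVec [CharP K 2] (hK : Nat.card K = 4 ^ 2) (hυ : υ ^ 4 = υ + 1) {n : ℕ}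
    {v : Fin 4 → K} (hv : v ∈ line υ n) (hv0 : v ≠ 0) :
    ∃ x ≤ 16, ∃ t : K, t ≠ 0 ∧ v = t • pointVec υ x n := by
  obtain ⟨h2, h3⟩ := mem_graphLine.1 hv
  by_cases h0 : v 0 = 0
  · have h1 : v 1 ≠ 0 := fun h1 => hv0 (by
      ext i; fin_cases i <;> simp [h0, h1, h2, h3])
    refine ⟨16, le_rfl, v 1, h1, ?_⟩
    ext i; fin_cases i <;> simp [pointVec, h0, h2, h3]
  · obtain ⟨x, hx, hxv⟩ := exists_dec_eq hυ hK (v 1 / v 0)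
    refine ⟨x, hx.le, v 0, h0, ?_⟩
    have hb : Nat.beq x 16 = false := by
      cases h : Nat.beq x 16
      · rfl
      · exact absurd (Nat.eq_of_beq_eq_true h) hx.ne
    ext i
    fin_cases i <;> simp only [pointVec, hb, cond_false, hxv] <;> simp [h2, h3] <;> field_simp

theorem span_pointVec_mem_externalPoints [CharP K 2] (h16 : ∀ x : K, x ^ 16 = x)
    (hυ : υ ^ 4 = υ + 1) (x : ℕ) {n : ℕ} (hn : n < 240) :
    Submodule.span K {pointVec υ x n} ∈ externalPoints 4 := by
  have hl := line_mem_externalLines h16 hυ hn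
  have hle := (Submodule.span_singleton_le_iff_mem _ _).2 (pointVec_mem_line (υ := υ) x n)
  exact ⟨⟨finrank_span_singleton (pointVec_ne_zero x n),
    fun y hy z hz => hl.1.2 y (hle hy) z (hle hz)⟩, fun h => hl.2 _ h hle⟩

open scoped Classical in
theorem ncard_lines_through [CharP K 2] (hK : Nat.card K = 4 ^ 2) (hυ : υ ^ 4 = υ + 1)
    {R : Set (Submodule K (Fin 4 → K))} (hR : R ⊆ externalLines 4) {x n a b c d : ℕ}
    (hq : (x, a, b, c, d) ∈ quads)
    (h : ∀ m < 240, pointCode x m = pointCode x n ↔ m = a ∨ m = b ∨ m = c ∨ m = d) :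
    {l | l ∈ R ∧ Submodule.span K {pointVec υ x n} ≤ l}.ncard =
      (if line υ a ∈ R then 1 else 0) + (if line υ b ∈ R then 1 else 0) +
        (if line υ c ∈ R then 1 else 0) + (if line υ d ∈ R then 1 else 0) := by
  have hv := valid_of_mem_quads hq
  rw [← ncard_image_quad hv.2.1 hv.2.2.1 hv.2.2.2.1 hv.2.2.2.2.1
    (fun i hi j hj hij => line_injOn hυ hi hj hij)]
  congr 1
  ext l
  simp only [Set.mem_ofPred_eq, Submodule.span_singleton_le_iff_mem]
  refine and_congr_right fun hl => ?_
  obtain ⟨m, hm, rfl⟩ := exists_line_eq hK hυ (hR hl)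
  rw [pointVec_mem_line_iff hυ, h m hm]
  constructor
  · exact fun h => ⟨m, h, rfl⟩
  · rintro ⟨i, hi, him⟩
    rwa [line_injOn hυ hm (by omega) him]

open scoped Classical in
theorem isRelativeHemisystem_iff [CharP K 2] (hK : Nat.card K = 4 ^ 2) (hυ : υ ^ 4 = υ + 1)
    {R : Set (Submodule K (Fin 4 → K))} (hR : R ⊆ externalLines 4) :
    IsRelativeHemisystem 4 R ↔ ∀ x a b c d, (x, a, b, c, d) ∈ quads →
      (if line υ a ∈ R then 1 else 0) + (if line υ b ∈ R then 1 else 0) +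
        (if line υ c ∈ R then 1 else 0) + (if line υ d ∈ R then 1 else 0) = 2 := by
  have h16 := pow_sixteen_of_card hK
  have four : ∀ {x n a b c d : ℕ}, (x, a, b, c, d) ∈ quads →
      (∀ m < 240, pointCode x m = pointCode x n ↔ m = a ∨ m = b ∨ m = c ∨ m = d) →
      {l | l ∈ externalLines 4 ∧ Submodule.span K {pointVec υ x n} ≤ l}.ncard = 4 := by
    intro x n a b c d hq h
    have hv := valid_of_mem_quads hq
    rw [ncard_lines_through hK hυ subset_rfl hq h,
      if_pos (line_mem_externalLines h16 hυ (by omega)),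
      if_pos (line_mem_externalLines h16 hυ (by omega)),
      if_pos (line_mem_externalLines h16 hυ (by omega)),
      if_pos (line_mem_externalLines h16 hυ (by omega))]
  constructor
  · rintro ⟨-, h⟩ x a b c d hq
    have hv := valid_of_mem_quads hq
    have hc : ∀ m < 240, _ := fun m hm => pointCode_eq_iff hq hm
    have := h _ (span_pointVec_mem_externalPoints h16 hυ x hv.2.2.2.2.1)
    rw [four hq hc, ncard_lines_through hK hυ hR hq hc] at this
    omega
  · refine fun h => ⟨hR, fun P hP => ?_⟩
    by_cases hE : ∃ l ∈ externalLines 4, P ≤ l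
    · obtain ⟨l, hl, hPl⟩ := hE
      obtain ⟨n, hn, rfl⟩ := exists_line_eq hK hυ hl
      obtain ⟨⟨v, hvP⟩, hv0, hspan⟩ := finrank_eq_one_iff'.1 hP.1.1
      have hPv : P = Submodule.span K {v} := by
        refine le_antisymm (fun w hw => ?_) ((Submodule.span_singleton_le_iff_mem _ _).2 hvP)
        obtain ⟨t, ht⟩ := hspan ⟨w, hw⟩
        exact Submodule.mem_span_singleton.2 ⟨t, congrArg Subtype.val ht⟩
      obtain ⟨x, hx, t, ht, rfl⟩ := exists_smul_pointVec hK hυ (hPl hvP) fun h0 => hv0 (by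
        simpa using h0)
      rw [Submodule.span_singleton_smul_eq (IsUnit.mk0 t ht)] at hPv
      obtain ⟨a, b, c, d, hq, hc⟩ := exists_quad hx hn
      rw [hPv, four hq hc, ncard_lines_through hK hυ hR hq hc, h x a b c d hq]
    · have h1 : {l | l ∈ externalLines 4 ∧ P ≤ l} = ∅ := by
        ext l; simpa using fun hl hP => hE ⟨l, hl, hP⟩
      have h2 : {l | l ∈ R ∧ P ≤ l} = ∅ := by
        ext l; simpa using fun hl hP => hE ⟨l, hR hl, hP⟩
      rw [h1, h2, Set.ncard_empty]

/-- The set of the lines whose digit in a binary number is one. -/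
def lineSet (υ : K) (M : ℕ) : Set (Submodule K (Fin 4 → K)) :=
  {l | ∃ n < 240, digit M n = 1 ∧ l = line υ n}

theorem line_mem_lineSet [CharP K 2] (hυ : υ ^ 4 = υ + 1) {M n : ℕ} (hn : n < 240) :
    line υ n ∈ lineSet υ M ↔ digit M n = 1 := by
  constructor
  · rintro ⟨m, hm, hM, h⟩
    rwa [line_injOn hυ hn hm h]
  · exact fun h => ⟨n, hn, h, rfl⟩

theorem lineSet_subset [CharP K 2] (h16 : ∀ x : K, x ^ 16 = x) (hυ : υ ^ 4 = υ + 1) (M : ℕ) :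
    lineSet υ M ⊆ externalLines 4 := by
  rintro l ⟨n, hn, -, rfl⟩
  exact line_mem_externalLines h16 hυ hn

open scoped Classical in
theorem isRelativeHemisystem_lineSet_iff [CharP K 2] (hK : Nat.card K = 4 ^ 2)
    (hυ : υ ^ 4 = υ + 1) {M : ℕ} (hM : M < 2 ^ 240) :
    IsRelativeHemisystem 4 (lineSet υ M) ↔ M ∈ solutions := by
  rw [isRelativeHemisystem_iff hK hυ (lineSet_subset (pow_sixteen_of_card hK) hυ M), mem_solutions]
  simp only [hM, true_and, Prod.forall]
  refine forall₅_congr fun x a b c d => forall_congr' fun hq => ?_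
  have hv := valid_of_mem_quads hq
  have e : ∀ n < 240, (if line υ n ∈ lineSet υ M then 1 else 0) = digit M n := by
    intro n hn
    rw [line_mem_lineSet hυ hn]
    rcases digit_le_one M n with h | h <;> simp [h]
  rw [e a (by omega), e b (by omega), e c (by omega), e d (by omega)]
  rfl

theorem exists_lineSet_eq [CharP K 2] (hK : Nat.card K = 4 ^ 2) (hυ : υ ^ 4 = υ + 1)
    {R : Set (Submodule K (Fin 4 → K))} (hR : R ⊆ externalLines 4) :
    ∃ M < 2 ^ 240, R = lineSet υ M := by
  classical
  refine ⟨Nat.ofBits fun i : Fin 240 => decide (line υ i ∈ R), Nat.ofBits_lt_two_pow _, ?_⟩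
  have h : ∀ n < 240, (digit (Nat.ofBits fun i : Fin 240 => decide (line υ i ∈ R)) n = 1 ↔
      line υ n ∈ R) := by
    intro n hn
    rw [digit_eq, Nat.testBit_ofBits_lt _ _ hn]
    simp
  ext l
  constructor
  · intro hl
    obtain ⟨n, hn, rfl⟩ := exists_line_eq hK hυ (hR hl)
    exact ⟨n, hn, (h n hn).2 hl, rfl⟩
  · rintro ⟨n, hn, h1, rfl⟩
    exact (h n hn).1 h1

theorem lineSet_injOn [CharP K 2] (hυ : υ ^ 4 = υ + 1) {M N : ℕ} (hM : M < 2 ^ 240)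
    (hN : N < 2 ^ 240) (h : lineSet υ M = lineSet υ N) : M = N := by
  refine Nat.eq_of_testBit_eq fun n => ?_
  by_cases hn : n < 240
  · have := line_mem_lineSet (M := M) hυ hn
    rw [h, line_mem_lineSet hυ hn, digit_eq, digit_eq] at this
    cases h1 : M.testBit n <;> cases h2 : N.testBit n <;> simp [h1, h2] at this ⊢
  · have hp : 2 ^ 240 ≤ 2 ^ n := Nat.pow_le_pow_right (by norm_num) (by omega)
    rw [Nat.testBit_eq_false_of_lt (hM.trans_le hp), Nat.testBit_eq_false_of_lt (hN.trans_le hp)]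

theorem isRelativeHemisystem_iff_exists [CharP K 2] (hK : Nat.card K = 4 ^ 2)
    (hυ : υ ^ 4 = υ + 1) (R : Set (Submodule K (Fin 4 → K))) :
    IsRelativeHemisystem 4 R ↔ ∃ M ∈ solutions, R = lineSet υ M := by
  constructor
  · intro h
    obtain ⟨M, hM, rfl⟩ := exists_lineSet_eq hK hυ h.1
    exact ⟨M, (isRelativeHemisystem_lineSet_iff hK hυ hM).1 h, rfl⟩
  · rintro ⟨M, hM, rfl⟩
    exact (isRelativeHemisystem_lineSet_iff hK hυ ((mem_solutions M).1 hM).1).2 hM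

theorem ncard_isRelativeHemisystem [CharP K 2] (hK : Nat.card K = 4 ^ 2) (hυ : υ ^ 4 = υ + 1) :
    {R : Set (Submodule K (Fin 4 → K)) | IsRelativeHemisystem 4 R}.ncard = 240 := by
  have h : {R : Set (Submodule K (Fin 4 → K)) | IsRelativeHemisystem 4 R} =
      lineSet υ '' (solutions.toFinset : Set ℕ) := by
    ext R
    simp only [Set.mem_ofPred_eq, isRelativeHemisystem_iff_exists hK hυ, Set.mem_image,
      List.coe_toFinset, eq_comm]
  rw [h, Set.InjOn.ncard_image, Set.ncard_coe_finset,
    List.toFinset_card_of_nodup solutions_nodup, length_solutions]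
  intro M hM N hN
  simp only [List.coe_toFinset, Set.mem_ofPred_eq, mem_solutions] at hM hN
  exact lineSet_injOn hυ hM.1 hN.1

end Hemisystems

/-- The permutation of the 240 lines by each of the four generators of `gen`, eight binary digits
for each line. -/
def permTable : ℕ → ℕ
  | 0 => 10775977676195747609044571398502299775460563548916042277462730641525648937113673906285307160948759993805894990151956353004158338954449409332044818438913694649193308093058415650732199725461806626905955325299784810176761789222865968579226633920245702869375827784267020553141385395230928360593014852479811915568755149522025529151327612443436711918797369619622580038039090246040587807694077701863139537905420291706581669221255159937655016718392080107069977408748655971518140262143031346394787730229853931604854032762363075450177312419964858880072120906608538306142804462856245402435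
  | 1 => 8303241099918379495543986848334044949868571133934714899476089576381879809854909123484728272875534875029042018882344889925301946310046390755460321270074527901918314139853064336201467884331122024677580066340218229120703097929732491012531419484847240341848424547910778117430628611218633420239637869550577561830038699765511466847367331957501042815938350482733366208113552252511047625689500341688644248781405802202296079731666581362269309000900828087410757902200437309237807137735480735191235192486197332614311358594752115744352391223369028537621018504652079461344891407198875791360
  | 2 => 10517531437195591774957088579398893855122091889355224113132495824332467209138901050500207968501882277121246656981117502292638812822304482069853372413430108891435214522037377957574364268658733116916145848099006230019153749106126522143666552754601007250190638419657444413217865263834572088333005453740738756395920558570391520128102253410361896138683997018960003315789063756680545287894845598495063019883420879764954449894699356798508112075475346917383595970272117829274848391532544125970362307340509661528772143241444099379181501902609244825525433543710239452973985403880836340125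
  | _ => 42512274824397261884547630043802857151822079097024753531896229716169338558414824697935244001974652215399888556046851083054316336110143841368412581313100340848026004821957451021447309679828630060708601639423643911625220203490234492982271436286215158674675544072248697066262586041940572917106313254372417876646556493232404660889203385034792077161408788371333207952961860817969550565180973086121443697813407870042226913849419654683733906645285868660666232994564176505053222581395247809580529382639950980393743664724672414340899776422657189903536346723074429783214988713553406561845

/-- Steps `(p, g, k)` from line `p` to line `k` by generator `g`, for the orbit of line `0`. -/
def orbitStepsZero : List (ℕ × ℕ × ℕ) := [
  (0, 0, 67), (0, 2, 157), (67, 1, 168), (67, 2, 128), (157, 0, 17), (157, 1, 99), (157, 2, 8),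
  (168, 2, 113), (128, 0, 50), (128, 1, 4), (128, 2, 182), (17, 1, 56), (17, 2, 233), (99, 0,
  183), (8, 0, 200), (8, 1, 100), (8, 2, 154), (113, 0, 101), (113, 1, 207), (113, 2, 155), (50,
  1, 226), (4, 0, 33), (182, 1, 41), (182, 2, 81), (56, 0, 2), (56, 2, 3), (233, 1, 77), (183, 2,
  104), (200, 1, 189), (200, 2, 205), (100, 0, 179), (154, 0, 167), (154, 1, 160), (154, 2, 16),
  (101, 1, 133), (207, 0, 165), (155, 2, 195), (226, 0, 218), (226, 2, 72), (33, 2, 190), (41, 0,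
  83), (81, 0, 220), (81, 1, 124), (2, 2, 30), (3, 0, 108), (3, 1, 66), (3, 2, 158), (77, 0, 26),
  (104, 0, 87), (104, 1, 63), (104, 2, 201), (205, 1, 170), (205, 2, 177), (167, 1, 136), (167, 2,
  194), (160, 0, 203), (16, 0, 49), (16, 1, 123), (16, 2, 227), (133, 0, 44), (133, 2, 35), (195,
  0, 23), (195, 1, 75), (195, 2, 54), (218, 2, 112), (72, 1, 43), (190, 1, 69), (190, 2, 45), (83,
  2, 80), (220, 1, 198), (30, 1, 143), (30, 2, 172), (158, 1, 187), (158, 2, 107), (26, 2, 117),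
  (87, 1, 120), (87, 2, 139), (201, 0, 7), (201, 1, 10), (177, 1, 146), (177, 2, 237), (136, 0,
  18), (136, 2, 149), (194, 1, 231), (194, 2, 24), (203, 2, 78), (49, 1, 61), (123, 0, 191), (227,
  1, 221), (227, 2, 178), (44, 2, 204), (35, 0, 197), (35, 1, 86), (35, 2, 31), (23, 1, 206), (23,
  2, 229), (75, 0, 73), (69, 0, 162), (45, 0, 116), (80, 1, 126), (80, 2, 173), (198, 2, 51),
  (143, 0, 164), (172, 0, 192), (172, 1, 27), (172, 2, 225), (107, 1, 95), (107, 2, 37), (139, 0,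
  60), (7, 1, 135), (7, 2, 148), (10, 0, 152), (24, 1, 163), (24, 2, 134), (61, 0, 230), (178, 1,
  159), (178, 2, 70), (197, 2, 90), (37, 2, 20)]

/-- Steps `(p, g, k)` from line `p` to line `k` by generator `g`, for the orbit of line `1`. -/
def orbitStepsOne : List (ℕ × ℕ × ℕ) := [
  (1, 0, 219), (1, 1, 176), (1, 2, 153), (219, 1, 235), (219, 2, 156), (176, 0, 161), (176, 2,
  208), (153, 1, 76), (153, 2, 199), (235, 0, 98), (235, 2, 211), (156, 1, 14), (156, 2, 71),
  (161, 2, 91), (208, 0, 109), (208, 1, 210), (208, 2, 188), (76, 0, 106), (199, 0, 140), (199, 1,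
  236), (199, 2, 184), (98, 2, 103), (211, 1, 102), (211, 2, 228), (14, 0, 125), (71, 0, 62), (71,
  1, 150), (71, 2, 217), (91, 0, 15), (91, 1, 131), (91, 2, 185), (109, 1, 11), (109, 2, 84),
  (210, 0, 127), (188, 0, 130), (188, 1, 36), (188, 2, 114), (106, 2, 232), (236, 0, 92), (184, 0,
  13), (103, 1, 122), (103, 2, 121), (102, 0, 142), (228, 0, 180), (125, 2, 94), (62, 1, 213),
  (62, 2, 55), (150, 0, 169), (217, 0, 59), (217, 1, 5), (217, 2, 111), (15, 1, 141), (131, 0,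
  39), (185, 1, 186), (11, 0, 115), (11, 2, 53), (84, 0, 52), (127, 2, 214), (130, 1, 21), (130,
  2, 85), (36, 0, 181), (114, 0, 79), (114, 1, 48), (114, 2, 29), (232, 0, 137), (232, 1, 234),
  (92, 2, 40), (13, 1, 58), (13, 2, 93), (122, 0, 145), (121, 0, 47), (121, 1, 202), (142, 2,
  224), (180, 1, 171), (180, 2, 19), (94, 0, 118), (213, 0, 105), (55, 0, 97), (55, 1, 196), (55,
  2, 6), (169, 2, 12), (59, 1, 212), (111, 1, 32), (111, 2, 64), (141, 0, 68), (53, 0, 82), (214,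
  1, 88), (214, 2, 166), (21, 0, 65), (21, 2, 209), (85, 2, 238), (181, 2, 222), (29, 0, 239),
  (29, 1, 216), (40, 1, 138), (40, 2, 132), (58, 2, 119), (47, 1, 46), (224, 1, 193), (224, 2,
  57), (19, 0, 147), (19, 1, 25), (19, 2, 34), (118, 1, 96), (118, 2, 38), (64, 1, 151), (88, 0,
  175), (65, 2, 74), (209, 1, 174), (238, 2, 89), (239, 1, 22), (239, 2, 28), (46, 2, 223), (57,
  1, 42), (57, 2, 110), (147, 1, 9), (147, 2, 215), (28, 1, 144), (28, 2, 129)]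

/-- Steps `(p, g, k)` from solution `p` to solution `k` by generator `g`. -/
def solutionSteps : List (ℕ × ℕ × ℕ) := [
  (52, 3, 225), (225, 0, 65), (225, 1, 177), (65, 1, 68), (65, 2, 237), (65, 3, 43), (177, 0, 21),
  (177, 2, 184), (177, 3, 39), (68, 0, 9), (68, 2, 81), (68, 3, 234), (237, 0, 231), (237, 1,
  152), (237, 2, 165), (237, 3, 69), (43, 0, 139), (43, 1, 59), (43, 2, 121), (21, 2, 135), (21,
  3, 112), (184, 0, 149), (184, 1, 162), (184, 2, 174), (184, 3, 93), (39, 0, 216), (39, 1, 91),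
  (39, 2, 66), (9, 2, 158), (9, 3, 109), (81, 0, 176), (81, 1, 95), (234, 0, 198), (234, 1, 183),
  (234, 2, 200), (231, 3, 73), (152, 0, 119), (152, 3, 136), (165, 0, 173), (165, 1, 123), (165,
  2, 99), (165, 3, 124), (69, 0, 24), (69, 1, 34), (69, 2, 47), (139, 1, 223), (139, 2, 55), (139,
  3, 150), (59, 0, 131), (59, 2, 144), (59, 3, 96), (121, 0, 130), (121, 2, 78), (121, 3, 168),
  (135, 0, 217), (135, 2, 7), (135, 3, 154), (112, 1, 113), (112, 2, 209), (149, 1, 213), (162, 0,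
  146), (162, 3, 110), (174, 0, 85), (174, 2, 44), (93, 0, 40), (93, 1, 29), (93, 2, 56), (216, 1,
  197), (216, 2, 79), (216, 3, 179), (91, 0, 140), (91, 2, 6), (91, 3, 143), (66, 0, 170), (66, 2,
  37), (66, 3, 125), (158, 0, 224), (158, 1, 169), (158, 2, 236), (158, 3, 51), (109, 0, 207),
  (109, 1, 76), (109, 2, 192), (176, 1, 193), (176, 3, 151), (95, 0, 155), (95, 3, 126), (198, 1,
  161), (198, 2, 92), (198, 3, 142), (183, 3, 164), (200, 2, 159), (200, 3, 97), (73, 0, 17),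
  (119, 2, 171), (119, 3, 35), (173, 3, 153), (99, 1, 70), (99, 2, 137), (99, 3, 58), (124, 0,
  180), (124, 1, 228), (124, 2, 13), (24, 1, 36), (24, 2, 101), (24, 3, 122), (34, 0, 227), (34,
  3, 15), (47, 3, 67), (223, 0, 166), (223, 3, 120), (55, 1, 25), (55, 2, 60), (55, 3, 133), (150,
  1, 138), (150, 2, 61), (131, 2, 12), (131, 3, 235), (144, 0, 189), (144, 1, 156), (144, 2, 221),
  (144, 3, 2), (96, 1, 77), (96, 2, 199), (130, 2, 75), (78, 0, 114), (78, 1, 41), (78, 2, 212),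
  (78, 3, 22), (168, 1, 206), (168, 2, 28), (217, 3, 80), (7, 3, 106), (154, 0, 107), (113, 2,
  84), (113, 3, 222), (209, 0, 132), (209, 3, 86), (213, 0, 160), (213, 3, 64), (146, 2, 82),
  (146, 3, 134), (85, 3, 50), (44, 0, 218), (44, 3, 63), (40, 1, 26), (40, 2, 104), (29, 3, 201),
  (56, 2, 239), (56, 3, 31), (79, 1, 118), (79, 2, 194), (179, 0, 11), (179, 1, 163), (140, 2,
  108), (140, 3, 190), (6, 3, 215), (170, 3, 205), (224, 2, 178), (224, 3, 116), (169, 3, 181),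
  (236, 0, 72), (51, 0, 219), (51, 2, 98), (207, 3, 90), (76, 2, 30), (192, 2, 18), (192, 3, 145),
  (193, 3, 111), (161, 2, 16), (161, 3, 128), (92, 0, 157), (142, 1, 191), (142, 2, 14), (164, 1,
  127), (164, 2, 53), (159, 1, 211), (159, 2, 186), (159, 3, 57), (97, 1, 5), (97, 2, 23), (171,
  3, 38), (70, 3, 20), (228, 3, 147), (13, 2, 62), (13, 3, 175), (101, 0, 230), (122, 0, 182),
  (122, 2, 220), (227, 2, 210), (166, 2, 4), (166, 3, 214), (120, 1, 202), (138, 2, 229), (138, 3,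
  71), (61, 2, 196), (61, 3, 49), (12, 0, 89), (235, 0, 83), (189, 2, 167), (189, 3, 117), (156,
  0, 27), (156, 3, 238), (2, 2, 100), (77, 3, 195), (199, 0, 48), (199, 2, 74), (114, 3, 188),
  (41, 0, 233), (41, 3, 8), (212, 3, 3), (206, 0, 208), (86, 0, 88), (64, 1, 42), (64, 2, 54),
  (82, 1, 0), (82, 2, 87), (82, 3, 148), (134, 0, 187), (134, 2, 19), (63, 0, 232), (239, 0, 32),
  (11, 1, 46), (11, 3, 115), (163, 2, 1), (163, 3, 185), (98, 3, 203), (145, 0, 94), (145, 2,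
  103), (127, 3, 226), (53, 0, 45), (53, 2, 129), (53, 3, 33), (57, 0, 141), (57, 1, 105), (147,
  2, 102), (100, 3, 204), (54, 3, 10), (105, 3, 172)]

/-- The image of line `n` under generator `g`. -/
def perm (g n : ℕ) : ℕ := Nat.mod (Nat.shiftRight (permTable g) (Nat.mul 8 n)) 256

/-- The generators, acting on vectors of codes. -/
def genCode (g a b c d : ℕ) : ℕ × ℕ × ℕ × ℕ := match g with
  | 0 => (Nat.xor a c, b, c, Nat.xor (Nat.xor b c) d)
  | 1 => (Nat.xor a b, b, d, c)
  | 2 => (Nat.xor (mulCode 6 a) (mulCode 7 b), mulCode 6 a, mulCode 6 c, mulCode 7 d)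
  | _ => (c, d, a, b)

/-- Whether a vector of codes lies on line `n`. -/
def onLine (n : ℕ) (v : ℕ × ℕ × ℕ × ℕ) : Bool := match v with
  | (a, b, c, d) =>
    Nat.beq c (Nat.xor (mulCode a (entry n 0)) (mulCode b (entry n 2))) &&
      Nat.beq d (Nat.xor (mulCode a (entry n 1)) (mulCode b (entry n 3)))

theorem perm_valid : ∀ g < 4, ∀ n < 240, perm g n < 240 ∧
    onLine (perm g n) (genCode g 1 0 (entry n 0) (entry n 1)) = true ∧
    onLine (perm g n) (genCode g 0 1 (entry n 2) (entry n 3)) = true := by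
  decide +kernel

/-- The places reached from the digits of `s` by the valid steps of a list. -/
def reach (ok : ℕ → ℕ → ℕ → Bool) : List (ℕ × ℕ × ℕ) → ℕ → ℕ
  | [], s => s
  | (p, g, k) :: l, s => bif Nat.beq (digit s p) 1 && ok p g k
      then reach ok l (Nat.lor s (Nat.shiftLeft 1 k)) else s

theorem reach_induction {ok : ℕ → ℕ → ℕ → Bool} {r : ℕ → Prop}
    (h : ∀ p g k, ok p g k = true → r p → r k) : ∀ (l : List (ℕ × ℕ × ℕ)) (s : ℕ),
    (∀ i, digit s i = 1 → r i) → ∀ i, digit (reach ok l s) i = 1 → r i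
  | [], _, hs => hs
  | (p, g, k) :: l, s, hs => by
    rw [reach]
    cases hc : Nat.beq (digit s p) 1 && ok p g k with
    | false => exact hs
    | true =>
      rw [Bool.and_eq_true] at hc
      refine reach_induction h l _ fun i hi => ?_
      rcases (digit_lor_shiftLeft _ _ _).1 hi with hi | rfl
      · exact hs i hi
      · exact h p g _ hc.2 (hs p (Nat.eq_of_beq_eq_true hc.1))

/-- Solution number `k`. -/
def solution (k : ℕ) : ℕ := solutions.getD k 0

/-- The solution that consists of the orbit of line `0` under the first three generators. -/
def baseSolution : ℕ := solution 52

/-- Whether generator `g` takes line `p` to line `k`. -/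
def lineStepOk (p g k : ℕ) : Bool := Nat.beq (perm g p) k && Nat.blt g 3

/-- Whether a binary number `M` is taken to `N` by generator `g`, up to line `n`. -/
def digitsOk (M g N : ℕ) : ℕ → Bool
  | 0 => true
  | n + 1 => bif Nat.beq (digit N (perm g n)) (digit M n) then digitsOk M g N n else false

/-- Whether generator `g` takes solution `p` to solution `k`. -/
def solutionStepOk (p g k : ℕ) : Bool :=
  Nat.blt g 4 && digitsOk (solution p) g (solution k) 240

theorem digitsOk_iff (M g N n : ℕ) : digitsOk M g N n = true ↔
    ∀ i < n, digit N (perm g i) = digit M i := by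
  induction n with
  | zero => simp [digitsOk]
  | succ n ih =>
    rw [digitsOk, Nat.forall_lt_succ_right, ← ih]
    cases h : Nat.beq (digit N (perm g n)) (digit M n) with
    | false => simp [Nat.ne_of_beq_eq_false h]
    | true => simp [Nat.eq_of_beq_eq_true h]

set_option maxRecDepth 100000 in
theorem reach_orbitStepsZero : reach lineStepOk orbitStepsZero 1 = baseSolution :=
  Nat.eq_of_beq_eq_true (by decide +kernel)

set_option maxRecDepth 100000 in
theorem reach_orbitStepsOne :
    reach lineStepOk orbitStepsOne 2 = 2 ^ 240 - (baseSolution + 1) :=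
  Nat.eq_of_beq_eq_true (by decide +kernel)

set_option maxRecDepth 100000 in
theorem baseSolution_stable : ∀ g < 3, digitsOk baseSolution g baseSolution 240 = true := by
  decide +kernel

set_option maxRecDepth 100000 in
theorem baseSolution_compl_stable : ∀ g < 3,
    digitsOk (2 ^ 240 - (baseSolution + 1)) g (2 ^ 240 - (baseSolution + 1)) 240 = true := by
  decide +kernel

set_option maxRecDepth 100000 in
theorem reach_solutionSteps : reach solutionStepOk solutionSteps (2 ^ 52) = 2 ^ 240 - 1 :=
  Nat.eq_of_beq_eq_true (by decide +kernel)

section Generators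

variable {K : Type*} [Field K]

/-- The image of a subspace under an invertible linear map. -/
abbrev act (g : (Fin 4 → K) ≃ₗ[K] (Fin 4 → K)) (l : Submodule K (Fin 4 → K)) :
    Submodule K (Fin 4 → K) :=
  Submodule.map (g : (Fin 4 → K) →ₗ[K] (Fin 4 → K)) l

theorem act_mul (g h : (Fin 4 → K) ≃ₗ[K] (Fin 4 → K)) (l : Submodule K (Fin 4 → K)) :
    act (g * h) l = act g (act h l) :=
  Submodule.map_comp _ _ _

theorem act_one (l : Submodule K (Fin 4 → K)) :
    act (1 : (Fin 4 → K) ≃ₗ[K] (Fin 4 → K)) l = l :=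
  Submodule.map_id l

theorem act_inv_act (g : (Fin 4 → K) ≃ₗ[K] (Fin 4 → K)) (l : Submodule K (Fin 4 → K)) :
    act g⁻¹ (act g l) = l := by
  rw [← act_mul, inv_mul_cancel, act_one]

theorem act_injective (g : (Fin 4 → K) ≃ₗ[K] (Fin 4 → K)) : Function.Injective (act g) :=
  Function.LeftInverse.injective (act_inv_act g)

theorem act_image_mul (g h : (Fin 4 → K) ≃ₗ[K] (Fin 4 → K))
    (S : Set (Submodule K (Fin 4 → K))) : act (g * h) '' S = act g '' (act h '' S) := by
  rw [Set.image_image]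
  exact Set.image_congr fun l _ => act_mul g h l

theorem act_image_one (S : Set (Submodule K (Fin 4 → K))) :
    act (1 : (Fin 4 → K) ≃ₗ[K] (Fin 4 → K)) '' S = S := by
  rw [Set.image_congr fun l _ => act_one l, Set.image_id']

theorem act_image_inv {g : (Fin 4 → K) ≃ₗ[K] (Fin 4 → K)}
    {S S' : Set (Submodule K (Fin 4 → K))} (h : act g '' S = S') : act g⁻¹ '' S' = S := by
  rw [← h, ← act_image_mul, inv_mul_cancel, act_image_one]

/-- Similarities of the Hermitian form. -/
def IsSimilarity (g : (Fin 4 → K) ≃ₗ[K] (Fin 4 → K)) : Prop :=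
  ∃ c : K, c ≠ 0 ∧ ∀ x y, hermForm 4 (g x) (g y) = c * hermForm 4 x y

theorem IsSimilarity.one : IsSimilarity (1 : (Fin 4 → K) ≃ₗ[K] (Fin 4 → K)) :=
  ⟨1, one_ne_zero, fun x y => by simp⟩

theorem IsSimilarity.mul {g h : (Fin 4 → K) ≃ₗ[K] (Fin 4 → K)} (hg : IsSimilarity g)
    (hh : IsSimilarity h) : IsSimilarity (g * h) := by
  obtain ⟨c, hc, hg⟩ := hg
  obtain ⟨d, hd, hh⟩ := hh
  exact ⟨c * d, mul_ne_zero hc hd, fun x y => by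
    rw [LinearEquiv.mul_apply, LinearEquiv.mul_apply, hg, hh, mul_assoc]⟩

theorem IsSimilarity.inv {g : (Fin 4 → K) ≃ₗ[K] (Fin 4 → K)} (hg : IsSimilarity g) :
    IsSimilarity g⁻¹ := by
  obtain ⟨c, hc, hg⟩ := hg
  refine ⟨c⁻¹, inv_ne_zero hc, fun x y => ?_⟩
  have h := hg (g⁻¹ x) (g⁻¹ y)
  rw [← LinearEquiv.mul_apply, ← LinearEquiv.mul_apply, mul_inv_cancel] at h
  rw [eq_inv_mul_iff_mul_eq₀ hc, ← h]
  rfl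

variable (K) in
/-- The linear similarities of the Hermitian form that stabilise `W(3,4)`. -/
def sympSimilarities : Subgroup ((Fin 4 → K) ≃ₗ[K] (Fin 4 → K)) where
  carrier := {g | IsSimilarity g ∧ act g '' sympPoints 4 = sympPoints 4}
  one_mem' := ⟨IsSimilarity.one, act_image_one _⟩
  mul_mem' := fun {g h} hg hh => ⟨hg.1.mul hh.1, by rw [act_image_mul, hh.2, hg.2]⟩
  inv_mem' := fun {g} hg => ⟨hg.1.inv, act_image_inv hg.2⟩

theorem equivalent_of_act {g : (Fin 4 → K) ≃ₗ[K] (Fin 4 → K)} (hg : g ∈ sympSimilarities K)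
    {R R' : Set (Submodule K (Fin 4 → K))} (h : act g '' R = R') : Equivalent 4 R R' := by
  obtain ⟨⟨c, hc, hh⟩, hs⟩ := hg
  exact ⟨RingEquiv.refl K, (g : (Fin 4 → K) →ₗ[K] (Fin 4 → K)), g.bijective,
    ⟨c, hc, fun x y => hh x y⟩, hs, h⟩

theorem mem_sympSimilarities {g : (Fin 4 → K) ≃ₗ[K] (Fin 4 → K)} (hg : IsSimilarity g)
    (h1 : ∀ v : Fin 4 → K, (∀ i, v i ^ 4 = v i) → ∀ i, g v i ^ 4 = g v i)
    (h2 : ∀ v : Fin 4 → K, (∀ i, v i ^ 4 = v i) → ∀ i, g.symm v i ^ 4 = g.symm v i) :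
    g ∈ sympSimilarities K := by
  refine ⟨hg, Set.Subset.antisymm ?_ ?_⟩
  · rintro _ ⟨_, ⟨v, hv0, hv, rfl⟩, rfl⟩
    refine ⟨g v, by simpa using hv0, h1 v hv, ?_⟩
    rw [act, Submodule.map_span, Set.image_singleton]; rfl
  · rintro _ ⟨v, hv0, hv, rfl⟩
    refine ⟨_, ⟨g.symm v, by simpa using hv0, h2 v hv, rfl⟩, ?_⟩
    rw [act, Submodule.map_span, Set.image_singleton]
    simp

/-- The map that interchanges the two halves of the coordinates. -/
def halfSwap (K : Type*) [Field K] : (Fin 4 → K) ≃ₗ[K] (Fin 4 → K) :=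
  LinearEquiv.ofInvolutive
    { toFun := fun v => ![v 2, v 3, v 0, v 1]
      map_add' := fun u v => by ext i; fin_cases i <;> simp
      map_smul' := fun t v => by ext i; fin_cases i <;> simp }
    (fun v => by ext i; fin_cases i <;> simp)

theorem halfSwap_apply (v : Fin 4 → K) : halfSwap K v = ![v 2, v 3, v 0, v 1] := rfl

theorem isSimilarity_halfSwap : IsSimilarity (halfSwap K) :=
  ⟨1, one_ne_zero, fun x y => by simp [halfSwap_apply, hermForm]; ring⟩

theorem halfSwap_mem : halfSwap K ∈ sympSimilarities K := by
  have h : ∀ v : Fin 4 → K, (∀ i, v i ^ 4 = v i) → ∀ i, halfSwap K v i ^ 4 = halfSwap K v i := by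
    intro v hv i
    fin_cases i <;> simp [halfSwap_apply, hv]
  exact mem_sympSimilarities isSimilarity_halfSwap h h

theorem dec_six (υ : K) : dec υ 6 = υ ^ 2 + υ := by
  simp [dec, show Nat.testBit 6 1 = true from rfl, show Nat.testBit 6 2 = true from rfl,
    show Nat.testBit 6 3 = false from rfl, add_comm]

variable [CharP K 2]

/-- The map that adds `x₃` to `x₁` and `x₂ + x₃` to `x₄`. -/
def shear (K : Type*) [Field K] [CharP K 2] : (Fin 4 → K) ≃ₗ[K] (Fin 4 → K) :=
  LinearEquiv.ofInvolutive
    { toFun := fun v => ![v 0 + v 2, v 1, v 2, v 1 + v 2 + v 3]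
      map_add' := fun u v => by ext i; fin_cases i <;> simp <;> ring
      map_smul' := fun t v => by ext i; fin_cases i <;> simp <;> ring }
    (fun v => by
      have h2 : (2 : K) = 0 := CharP.cast_eq_zero K 2
      ext i; fin_cases i <;> simp
      · linear_combination v 2 * h2
      · linear_combination (v 1 + v 2) * h2)

/-- The map that adds `x₂` to `x₁` and interchanges `x₃` and `x₄`. -/
def flip (K : Type*) [Field K] [CharP K 2] : (Fin 4 → K) ≃ₗ[K] (Fin 4 → K) :=
  LinearEquiv.ofInvolutive
    { toFun := fun v => ![v 0 + v 1, v 1, v 3, v 2]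
      map_add' := fun u v => by ext i; fin_cases i <;> simp <;> ring
      map_smul' := fun t v => by ext i; fin_cases i <;> simp <;> ring }
    (fun v => by
      have h2 : (2 : K) = 0 := CharP.cast_eq_zero K 2
      ext i; fin_cases i <;> simp
      linear_combination v 1 * h2)

variable {υ : K}

theorem cubeRoot_mul (hυ : υ ^ 4 = υ + 1) : (υ ^ 2 + υ) * (υ ^ 2 + υ + 1) = 1 := by
  have h2 : (2 : K) = 0 := CharP.cast_eq_zero K 2
  linear_combination hυ + (υ ^ 3 + υ ^ 2 + υ) * h2

theorem cubeRoot_pow_four (hυ : υ ^ 4 = υ + 1) : (υ ^ 2 + υ) ^ 4 = υ ^ 2 + υ := by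
  have h2 : (2 : K) = 0 := CharP.cast_eq_zero K 2
  have h := cubeRoot_mul hυ
  rw [show (υ ^ 2 + υ) * (υ ^ 2 + υ + 1) = (υ ^ 2 + υ) ^ 2 + (υ ^ 2 + υ) by ring] at h
  generalize υ ^ 2 + υ = w at h ⊢
  linear_combination (w ^ 2 - w + 2) * h + (1 - 2 * w) * h2

/-- A map that is diagonal in the coordinates `x₁ + υ x₂`, `x₁ + υ⁴ x₂`, `x₃`, `x₄`. -/
def diag (hυ : υ ^ 4 = υ + 1) : (Fin 4 → K) ≃ₗ[K] (Fin 4 → K) where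
  toFun v := ![(υ ^ 2 + υ) * v 0 + (υ ^ 2 + υ + 1) * v 1, (υ ^ 2 + υ) * v 0, (υ ^ 2 + υ) * v 2,
    (υ ^ 2 + υ + 1) * v 3]
  map_add' u v := by ext i; fin_cases i <;> simp <;> ring
  map_smul' t v := by ext i; fin_cases i <;> simp <;> ring
  invFun v := ![(υ ^ 2 + υ + 1) * v 1, (υ ^ 2 + υ) * v 0 + (υ ^ 2 + υ) * v 1,
    (υ ^ 2 + υ + 1) * v 2, (υ ^ 2 + υ) * v 3]
  left_inv v := by
    have h2 : (2 : K) = 0 := CharP.cast_eq_zero K 2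
    have h := cubeRoot_mul hυ
    ext i; fin_cases i <;> simp
    · linear_combination v 0 * h
    · linear_combination v 1 * h + (υ ^ 2 + υ) ^ 2 * v 0 * h2
    · linear_combination v 2 * h
    · linear_combination v 3 * h
  right_inv v := by
    have h2 : (2 : K) = 0 := CharP.cast_eq_zero K 2
    have h := cubeRoot_mul hυ
    ext i; fin_cases i <;> simp
    · linear_combination v 0 * h + (υ ^ 2 + υ) * (υ ^ 2 + υ + 1) * v 1 * h2
    · linear_combination v 1 * h
    · linear_combination v 2 * h
    · linear_combination v 3 * h

theorem shear_apply (v : Fin 4 → K) : shear K v = ![v 0 + v 2, v 1, v 2, v 1 + v 2 + v 3] := rfl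

theorem flip_apply (v : Fin 4 → K) : flip K v = ![v 0 + v 1, v 1, v 3, v 2] := rfl

theorem diag_apply (hυ : υ ^ 4 = υ + 1) (v : Fin 4 → K) : diag hυ v =
    ![(υ ^ 2 + υ) * v 0 + (υ ^ 2 + υ + 1) * v 1, (υ ^ 2 + υ) * v 0, (υ ^ 2 + υ) * v 2,
      (υ ^ 2 + υ + 1) * v 3] := rfl

theorem isSimilarity_shear : IsSimilarity (shear K) := by
  have h2 : (2 : K) = 0 := CharP.cast_eq_zero K 2
  refine ⟨1, one_ne_zero, fun x y => ?_⟩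
  simp [shear_apply, hermForm, add_pow_four]
  linear_combination (x 2 * y 1 ^ 4 + x 1 * y 2 ^ 4 + x 2 * y 2 ^ 4) * h2

theorem isSimilarity_flip : IsSimilarity (flip K) := by
  have h2 : (2 : K) = 0 := CharP.cast_eq_zero K 2
  refine ⟨1, one_ne_zero, fun x y => ?_⟩
  simp [flip_apply, hermForm, add_pow_four]
  linear_combination (x 1 * y 1 ^ 4) * h2

theorem isSimilarity_diag (hυ : υ ^ 4 = υ + 1) : IsSimilarity (diag hυ) := by
  have h2 : (2 : K) = 0 := CharP.cast_eq_zero K 2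
  have h := cubeRoot_mul hυ
  have h4 := cubeRoot_pow_four hυ
  refine ⟨1, one_ne_zero, fun x y => ?_⟩
  simp only [diag_apply, hermForm]
  generalize υ ^ 2 + υ = w at h h4
  simp [add_pow_four, mul_pow, h4]
  linear_combination (x 0 * y 1 ^ 4 + x 1 * y 0 ^ 4 + x 2 * y 3 ^ 4 + x 3 * y 2 ^ 4) * h +
    w ^ 2 * x 0 * y 0 ^ 4 * h2

theorem shear_mem : shear K ∈ sympSimilarities K := by
  have h : ∀ v : Fin 4 → K, (∀ i, v i ^ 4 = v i) → ∀ i, shear K v i ^ 4 = shear K v i := by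
    intro v hv i
    fin_cases i <;> simp [shear_apply, add_pow_four, hv]
  exact mem_sympSimilarities isSimilarity_shear h h

theorem flip_mem : flip K ∈ sympSimilarities K := by
  have h : ∀ v : Fin 4 → K, (∀ i, v i ^ 4 = v i) → ∀ i, flip K v i ^ 4 = flip K v i := by
    intro v hv i
    fin_cases i <;> simp [flip_apply, add_pow_four, hv]
  exact mem_sympSimilarities isSimilarity_flip h h

theorem diag_mem (hυ : υ ^ 4 = υ + 1) : diag hυ ∈ sympSimilarities K := by
  have h4 := cubeRoot_pow_four hυ
  have h4' : (υ ^ 2 + υ + 1) ^ 4 = υ ^ 2 + υ + 1 := by rw [add_pow_four, h4, one_pow]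
  refine mem_sympSimilarities (isSimilarity_diag hυ) (fun v hv i => ?_) fun v hv i => ?_
  · rw [diag_apply]
    fin_cases i <;> simp only [Fin.zero_eta, Fin.mk_one, Fin.reduceFinMk, Matrix.cons_val] <;>
      simp only [add_pow_four (_ * _), mul_pow, h4, h4', hv]
  · change (![(υ ^ 2 + υ + 1) * v 1, (υ ^ 2 + υ) * v 0 + (υ ^ 2 + υ) * v 1,
      (υ ^ 2 + υ + 1) * v 2, (υ ^ 2 + υ) * v 3] i) ^ 4 = ![(υ ^ 2 + υ + 1) * v 1,
      (υ ^ 2 + υ) * v 0 + (υ ^ 2 + υ) * v 1, (υ ^ 2 + υ + 1) * v 2, (υ ^ 2 + υ) * v 3] i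
    fin_cases i <;> simp only [Fin.zero_eta, Fin.mk_one, Fin.reduceFinMk, Matrix.cons_val] <;>
      simp only [add_pow_four (_ * _), mul_pow, h4, h4', hv]

/-- The four generators, numbered as in `permTable`. -/
def gen (hυ : υ ^ 4 = υ + 1) : ℕ → (Fin 4 → K) ≃ₗ[K] (Fin 4 → K)
  | 0 => shear K
  | 1 => flip K
  | 2 => diag hυ
  | _ => halfSwap K

theorem gen_mem (hυ : υ ^ 4 = υ + 1) : ∀ g, gen hυ g ∈ sympSimilarities K
  | 0 => shear_mem
  | 1 => flip_mem
  | 2 => diag_mem hυ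
  | _ + 3 => halfSwap_mem

/-- The vector with given codes. -/
def decVec (υ : K) (v : ℕ × ℕ × ℕ × ℕ) : Fin 4 → K :=
  ![dec υ v.1, dec υ v.2.1, dec υ v.2.2.1, dec υ v.2.2.2]

theorem dec_seven : dec υ 7 = υ ^ 2 + υ + 1 := by
  rw [show (7 : ℕ) = 6 ^^^ 1 from rfl, dec_xor, dec_six, dec_one]

theorem gen_decVec (hυ : υ ^ 4 = υ + 1) (a b c d : ℕ) : ∀ g,
    gen hυ g (decVec υ (a, b, c, d)) = decVec υ (genCode g a b c d)
  | 0 => by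
    ext i
    fin_cases i <;> simp [gen, shear_apply, genCode, decVec, dec_xor]
  | 1 => by
    ext i
    fin_cases i <;> simp [gen, flip_apply, genCode, decVec, dec_xor]
  | 2 => by
    ext i
    fin_cases i <;>
      simp [gen, diag_apply, genCode, decVec, dec_xor, dec_mulCode hυ, dec_six, dec_seven]
  | _ + 3 => by
    ext i
    fin_cases i <;> simp [gen, halfSwap_apply, genCode, decVec]

theorem decVec_mem_line (hυ : υ ^ 4 = υ + 1) {n : ℕ} {v : ℕ × ℕ × ℕ × ℕ} (h : onLine n v = true) :
    decVec υ v ∈ line υ n := by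
  obtain ⟨a, b, c, d⟩ := v
  simp only [onLine, Bool.and_eq_true, Nat.beq_eq] at h
  rw [line, mem_graphLine]
  simp [decVec, h.1, h.2, dec_xor, dec_mulCode hυ]

theorem act_gen_line (hυ : υ ^ 4 = υ + 1) {g n : ℕ} (hg : g < 4) (hn : n < 240) :
    act (gen hυ g) (line υ n) = line υ (perm g n) := by
  obtain ⟨-, h1, h2⟩ := perm_valid g hg n hn
  refine Submodule.eq_of_le_of_finrank_eq ?_ ?_
  · rw [act, line, graphLine, Submodule.map_span, Submodule.span_le]
    rintro _ ⟨v, (rfl | rfl), rfl⟩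
    · have := decVec_mem_line (υ := υ) hυ h1
      rw [← gen_decVec hυ] at this
      simpa [decVec] using this
    · have := decVec_mem_line (υ := υ) hυ h2
      rw [← gen_decVec hυ] at this
      simpa [decVec] using this
  · rw [act, LinearEquiv.finrank_map_eq, line, line, finrank_graphLine, finrank_graphLine]

theorem perm_surjOn (hυ : υ ^ 4 = υ + 1) {g : ℕ} (hg : g < 4) {m : ℕ} (hm : m < 240) :
    ∃ n < 240, perm g n = m := by
  have hinj : Function.Injective fun n : Fin 240 =>
      (⟨perm g n, (perm_valid g hg n n.2).1⟩ : Fin 240) := by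
    intro i j hij
    have h : perm g i = perm g j := congrArg Fin.val hij
    apply Fin.ext
    refine line_injOn hυ i.2 j.2 (act_injective (gen hυ g) ?_)
    rw [act_gen_line hυ hg i.2, act_gen_line hυ hg j.2, h]
  obtain ⟨n, hn⟩ := Finite.injective_iff_surjective.1 hinj ⟨m, hm⟩
  exact ⟨n, n.2, congrArg Fin.val hn⟩

theorem act_gen_lineSet (hυ : υ ^ 4 = υ + 1) {g M N : ℕ} (hg : g < 4)
    (h : digitsOk M g N 240 = true) : act (gen hυ g) '' lineSet υ M = lineSet υ N := by
  rw [digitsOk_iff] at h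
  apply Set.Subset.antisymm
  · rintro _ ⟨_, ⟨n, hn, hM, rfl⟩, rfl⟩
    exact ⟨perm g n, (perm_valid g hg n hn).1, by rw [h n hn, hM], act_gen_line hυ hg hn⟩
  · rintro _ ⟨m, hm, hN, rfl⟩
    obtain ⟨n, hn, rfl⟩ := perm_surjOn hυ hg hm
    exact ⟨_, ⟨n, hn, by rw [← h n hn, hN], rfl⟩, act_gen_line hυ hg hn⟩

theorem exists_act_baseSolution (hυ : υ ^ 4 = υ + 1) {M : ℕ} (hM : M ∈ solutions) :
    ∃ g ∈ sympSimilarities K, act g '' lineSet υ baseSolution = lineSet υ M := by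
  obtain ⟨k, hk, rfl⟩ := List.getElem_of_mem hM
  have hk' : solutions[k] = solution k := (List.getD_eq_getElem _ _ hk).symm
  rw [hk']
  rw [length_solutions] at hk
  refine reach_induction (ok := solutionStepOk) (r := fun k => ∃ g ∈ sympSimilarities K,
    act g '' lineSet υ baseSolution = lineSet υ (solution k)) ?_ solutionSteps (2 ^ 52) ?_ k ?_
  · rintro p g k hok ⟨f, hf, hfe⟩
    simp only [solutionStepOk, Bool.and_eq_true, Nat.blt_eq] at hok
    exact ⟨gen hυ g * f, mul_mem (gen_mem hυ g) hf, by
      rw [act_image_mul, hfe, act_gen_lineSet hυ hok.1 hok.2]⟩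
  · intro i hi
    rw [digit_eq, Nat.testBit_two_pow] at hi
    obtain rfl : i = 52 := by by_contra h; simp [Ne.symm h] at hi
    exact ⟨1, one_mem _, act_image_one _⟩
  · rw [reach_solutionSteps, digit_eq, Nat.testBit_two_pow_sub_one]
    simp [hk]

theorem equivalent_of_mem_solutions (hυ : υ ^ 4 = υ + 1) {M N : ℕ} (hM : M ∈ solutions)
    (hN : N ∈ solutions) : Equivalent 4 (lineSet υ M) (lineSet υ N) := by
  obtain ⟨g, hg, hgM⟩ := exists_act_baseSolution hυ hM
  obtain ⟨h, hh, hhN⟩ := exists_act_baseSolution hυ hN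
  exact equivalent_of_act (mul_mem hh (inv_mem hg)) (by
    rw [act_image_mul, act_image_inv hgM, hhN])

end Generators

section Reguli

variable {K : Type*} [Field K]

theorem act_eq_of_forall_mem_iff {g : (Fin 4 → K) ≃ₗ[K] (Fin 4 → K)}
    {l l' : Submodule K (Fin 4 → K)} (h : ∀ v, g v ∈ l' ↔ v ∈ l) : act g l = l' := by
  ext v
  rw [act, Submodule.mem_map_equiv, ← h, LinearEquiv.apply_symm_apply]

theorem apply_mem_of_act_eq {g : (Fin 4 → K) ≃ₗ[K] (Fin 4 → K)}
    {l l' : Submodule K (Fin 4 → K)} (h : act g l = l') {v : Fin 4 → K} (hv : v ∈ l) :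
    g v ∈ l' :=
  h ▸ Submodule.mem_map_of_mem hv

/-- The lines of the first regulus except one. -/
def regLineOne (υ t : K) : Submodule K (Fin 4 → K) :=
  Submodule.span K {![υ ^ 4, 1, 0, t], ![t * υ, t, 1, 0]}

/-- The remaining line of the first regulus. -/
def regLineOneInf (υ : K) : Submodule K (Fin 4 → K) :=
  Submodule.span K {![0, 0, 0, 1], ![υ, 1, 0, 0]}

/-- The lines of the second regulus except one. -/
def regLineTwo (υ t : K) : Submodule K (Fin 4 → K) :=
  Submodule.span K {![υ ^ 4, 1, t, 0], ![t * υ, t, 0, 1]}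

/-- The remaining line of the second regulus. -/
def regLineTwoInf (υ : K) : Submodule K (Fin 4 → K) :=
  Submodule.span K {![0, 0, 1, 0], ![υ, 1, 0, 0]}

variable {υ : K}

theorem ne_zero_of_pow_four_eq (hυ : υ ^ 4 = υ + 1) : υ ≠ 0 := by
  rintro rfl
  simp at hυ

variable [CharP K 2]

theorem mem_regLineOne (hυ : υ ^ 4 = υ + 1) {t : K} {v : Fin 4 → K} : v ∈ regLineOne υ t ↔
    v 3 = t * (v 0 + υ * v 1) ∧ v 0 + (υ + 1) * v 1 = t * v 2 := by
  have h2 : (2 : K) = 0 := CharP.cast_eq_zero K 2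
  rw [regLineOne, Submodule.mem_span_pair, hυ]
  constructor
  · rintro ⟨r, s, rfl⟩
    simp
    constructor <;> grind
  · rintro ⟨h3, h4⟩
    refine ⟨v 0 + υ * v 1, v 2, ?_⟩
    ext i
    fin_cases i <;> simp <;> grind

theorem mem_regLineTwo (hυ : υ ^ 4 = υ + 1) {t : K} {v : Fin 4 → K} : v ∈ regLineTwo υ t ↔
    v 2 = t * (v 0 + υ * v 1) ∧ v 0 + (υ + 1) * v 1 = t * v 3 := by
  have h2 : (2 : K) = 0 := CharP.cast_eq_zero K 2
  rw [regLineTwo, Submodule.mem_span_pair, hυ]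
  constructor
  · rintro ⟨r, s, rfl⟩
    simp
    constructor <;> grind
  · rintro ⟨h3, h4⟩
    refine ⟨v 0 + υ * v 1, v 3, ?_⟩
    ext i
    fin_cases i <;> simp <;> grind

theorem mem_regLineOneInf {v : Fin 4 → K} :
    v ∈ regLineOneInf υ ↔ v 0 + υ * v 1 = 0 ∧ v 2 = 0 := by
  have h2 : (2 : K) = 0 := CharP.cast_eq_zero K 2
  rw [regLineOneInf, Submodule.mem_span_pair]
  constructor
  · rintro ⟨r, s, rfl⟩
    simp
    grind
  · rintro ⟨h3, h4⟩
    refine ⟨v 3, v 1, ?_⟩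
    ext i
    fin_cases i <;> simp <;> grind

theorem mem_regLineTwoInf {v : Fin 4 → K} :
    v ∈ regLineTwoInf υ ↔ v 0 + υ * v 1 = 0 ∧ v 3 = 0 := by
  have h2 : (2 : K) = 0 := CharP.cast_eq_zero K 2
  rw [regLineTwoInf, Submodule.mem_span_pair]
  constructor
  · rintro ⟨r, s, rfl⟩
    simp
    grind
  · rintro ⟨h3, h4⟩
    refine ⟨v 2, v 1, ?_⟩
    ext i
    fin_cases i <;> simp <;> grind

theorem shear_regLineOne (hυ : υ ^ 4 = υ + 1) (t : K) :
    act (shear K) (regLineOne υ t) = regLineOne υ (t + 1) := by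
  have h2 : (2 : K) = 0 := CharP.cast_eq_zero K 2
  refine act_eq_of_forall_mem_iff fun v => ?_
  rw [mem_regLineOne hυ, mem_regLineOne hυ, shear_apply]
  simp
  grind

theorem shear_regLineOneInf : act (shear K) (regLineOneInf υ) = regLineOneInf υ := by
  refine act_eq_of_forall_mem_iff fun v => ?_
  rw [mem_regLineOneInf, mem_regLineOneInf, shear_apply]
  simp
  grind

theorem flip_regLineOne_zero (hυ : υ ^ 4 = υ + 1) :
    act (flip K) (regLineOne υ 0) = regLineOneInf υ := by
  refine act_eq_of_forall_mem_iff fun v => ?_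
  rw [mem_regLineOne hυ, mem_regLineOneInf, flip_apply]
  simp
  grind

theorem flip_regLineOneInf (hυ : υ ^ 4 = υ + 1) :
    act (flip K) (regLineOneInf υ) = regLineOne υ 0 := by
  have h2 : (2 : K) = 0 := CharP.cast_eq_zero K 2
  refine act_eq_of_forall_mem_iff fun v => ?_
  rw [mem_regLineOne hυ, mem_regLineOneInf, flip_apply]
  simp
  grind

theorem flip_regLineOne (hυ : υ ^ 4 = υ + 1) {t : K} (ht : t ≠ 0) :
    act (flip K) (regLineOne υ t) = regLineOne υ t⁻¹ := by
  have h2 : (2 : K) = 0 := CharP.cast_eq_zero K 2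
  have hi := mul_inv_cancel₀ ht
  refine act_eq_of_forall_mem_iff fun v => ?_
  rw [mem_regLineOne hυ, mem_regLineOne hυ, flip_apply]
  simp
  grind

theorem diag_regLineOne (hυ : υ ^ 4 = υ + 1) (t : K) :
    act (diag hυ) (regLineOne υ t) = regLineOne υ (υ * t) := by
  have h2 : (2 : K) = 0 := CharP.cast_eq_zero K 2
  have h0 := ne_zero_of_pow_four_eq hυ
  have hw := cubeRoot_mul hυ
  have hp : υ * (υ ^ 2 + υ) ≠ 0 := mul_ne_zero h0 (left_ne_zero_of_mul_eq_one hw)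
  have hr : υ ^ 2 + υ + 1 ≠ 0 := right_ne_zero_of_mul_eq_one hw
  refine act_eq_of_forall_mem_iff fun v => ?_
  rw [mem_regLineOne hυ, mem_regLineOne hυ, diag_apply]
  simp only [Matrix.cons_val]
  have e1 : (υ ^ 2 + υ + 1) * v 3 - υ * t * ((υ ^ 2 + υ) * v 0 + (υ ^ 2 + υ + 1) * v 1 +
      υ * ((υ ^ 2 + υ) * v 0)) = (υ ^ 2 + υ + 1) * (v 3 - t * (v 0 + υ * v 1)) := by grind
  have e2 : (υ ^ 2 + υ) * v 0 + (υ ^ 2 + υ + 1) * v 1 + (υ + 1) * ((υ ^ 2 + υ) * v 0) -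
      υ * t * ((υ ^ 2 + υ) * v 2) =
      υ * (υ ^ 2 + υ) * (v 0 + (υ + 1) * v 1 - t * v 2) := by grind
  refine and_congr ?_ ?_
  · rw [← sub_eq_zero, e1, mul_eq_zero, or_iff_right hr, sub_eq_zero]
  · rw [← sub_eq_zero, e2, mul_eq_zero, or_iff_right hp, sub_eq_zero]

theorem diag_regLineOneInf (hυ : υ ^ 4 = υ + 1) :
    act (diag hυ) (regLineOneInf υ) = regLineOneInf υ := by
  have h2 : (2 : K) = 0 := CharP.cast_eq_zero K 2
  have h0 := ne_zero_of_pow_four_eq hυ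
  have hw := cubeRoot_mul hυ
  have hp : υ ^ 2 + υ ≠ 0 := left_ne_zero_of_mul_eq_one hw
  have hr : υ ^ 2 + υ + 1 ≠ 0 := right_ne_zero_of_mul_eq_one hw
  refine act_eq_of_forall_mem_iff fun v => ?_
  rw [mem_regLineOneInf, mem_regLineOneInf, diag_apply]
  simp only [Matrix.cons_val]
  have e1 : υ * ((υ ^ 2 + υ) * v 0 + (υ ^ 2 + υ + 1) * v 1 + υ * ((υ ^ 2 + υ) * v 0)) =
      (υ ^ 2 + υ + 1) * (v 0 + υ * v 1) := by grind
  rw [← mul_eq_zero_iff_left h0, e1, mul_eq_zero, or_iff_right hr, mul_eq_zero, or_iff_right hp]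

/-- The polar subspace of a subspace with respect to the Hermitian form. -/
def perp (l : Submodule K (Fin 4 → K)) : Submodule K (Fin 4 → K) where
  carrier := {y | ∀ x ∈ l, hermForm 4 x y = 0}
  zero_mem' := fun x _ => by simp [hermForm]
  add_mem' := fun hy hz x hx => by rw [hermForm_add_right, hy x hx, hz x hx, add_zero]
  smul_mem' := fun t y hy x hx => by rw [hermForm_smul_right, hy x hx, mul_zero]

theorem mem_perp_span_pair {r s y : Fin 4 → K} :
    y ∈ perp (Submodule.span K {r, s}) ↔ hermForm 4 r y = 0 ∧ hermForm 4 s y = 0 := by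
  constructor
  · exact fun h => ⟨h r (Submodule.mem_span_pair.2 ⟨1, 0, by simp⟩),
      h s (Submodule.mem_span_pair.2 ⟨0, 1, by simp⟩)⟩
  · rintro ⟨h1, h2⟩ x hx
    obtain ⟨a, b, rfl⟩ := Submodule.mem_span_pair.1 hx
    rw [hermForm_add_left, hermForm_smul_left, hermForm_smul_left, h1, h2]
    ring

theorem act_perp {g : (Fin 4 → K) ≃ₗ[K] (Fin 4 → K)} (hg : IsSimilarity g)
    (l : Submodule K (Fin 4 → K)) : act g (perp l) = perp (act g l) := by
  obtain ⟨c, hc, hh⟩ := hg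
  refine act_eq_of_forall_mem_iff fun v => ⟨fun h x hx => ?_, fun h => ?_⟩
  · have := h (g x) (Submodule.mem_map_of_mem hx)
    rw [hh] at this
    exact (mul_eq_zero.1 this).resolve_left hc
  · rintro _ ⟨x, hx, rfl⟩
    exact (hh x v).trans (by rw [h x hx, mul_zero])

theorem perp_regLineOne (hυ : υ ^ 4 = υ + 1) {s t : K} (h : t * s ^ 4 = 1) :
    perp (regLineOne υ t) = regLineTwo υ s := by
  have h2 : (2 : K) = 0 := CharP.cast_eq_zero K 2
  ext y
  rw [mem_regLineTwo hυ, regLineOne, mem_perp_span_pair]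
  have e1 : s ^ 4 * hermForm 4 ![υ ^ 4, 1, 0, t] y = (y 2 - s * (y 0 + υ * y 1)) ^ 4 := by
    simp [hermForm]
    grind
  have e2 : s ^ 4 * hermForm 4 ![t * υ, t, 1, 0] y =
      (y 0 + (υ + 1) * y 1 - s * y 3) ^ 4 := by
    simp [hermForm]
    grind
  have hs : s ^ 4 ≠ 0 := right_ne_zero_of_mul_eq_one h
  rw [← mul_eq_zero_iff_left hs, e1, pow_eq_zero_iff (by norm_num), sub_eq_zero,
    ← mul_eq_zero_iff_left hs, e2, pow_eq_zero_iff (by norm_num), sub_eq_zero]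

theorem perp_regLineOne_zero (hυ : υ ^ 4 = υ + 1) :
    perp (regLineOne υ 0) = regLineTwoInf υ := by
  have h2 : (2 : K) = 0 := CharP.cast_eq_zero K 2
  ext y
  rw [mem_regLineTwoInf, regLineOne, mem_perp_span_pair]
  have e1 : hermForm 4 ![υ ^ 4, 1, 0, 0] y = (y 0 + υ * y 1) ^ 4 := by
    simp [hermForm]
    grind
  have e2 : hermForm 4 ![0 * υ, 0, 1, 0] y = y 3 ^ 4 := by simp [hermForm]
  rw [e1, e2, pow_eq_zero_iff (by norm_num), pow_eq_zero_iff (by norm_num)]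

theorem perp_regLineOneInf (hυ : υ ^ 4 = υ + 1) :
    perp (regLineOneInf υ) = regLineTwo υ 0 := by
  have h2 : (2 : K) = 0 := CharP.cast_eq_zero K 2
  ext y
  rw [mem_regLineTwo hυ, regLineOneInf, mem_perp_span_pair]
  have e1 : hermForm 4 ![0, 0, 0, 1] y = y 2 ^ 4 := by simp [hermForm]
  have e2 : hermForm 4 ![υ, 1, 0, 0] y = (y 0 + (υ + 1) * y 1) ^ 4 := by
    simp [hermForm]
    grind
  rw [e1, e2, pow_eq_zero_iff (by norm_num), pow_eq_zero_iff (by norm_num), zero_mul, zero_mul]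

theorem perp_image_regulusOne (h16 : ∀ x : K, x ^ 16 = x) (hυ : υ ^ 4 = υ + 1) :
    perp '' regulusOne 4 υ = regulusTwo 4 υ := by
  apply Set.Subset.antisymm
  · rintro _ ⟨l, (⟨t, rfl⟩ | rfl), rfl⟩
    · by_cases ht : t = 0
      · subst ht
        exact Or.inr (perp_regLineOne_zero hυ)
      · refine Or.inl ⟨t⁻¹ ^ 4, perp_regLineOne hυ ?_⟩
        rw [← pow_mul, h16, mul_inv_cancel₀ ht]
    · exact Or.inl ⟨0, perp_regLineOneInf hυ⟩
  · rintro _ (⟨s, rfl⟩ | rfl)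
    · by_cases hs : s = 0
      · subst hs
        exact ⟨_, Or.inr rfl, perp_regLineOneInf hυ⟩
      · exact ⟨_, Or.inl ⟨(s ^ 4)⁻¹, rfl⟩,
          perp_regLineOne hυ (inv_mul_cancel₀ (pow_ne_zero 4 hs))⟩
    · exact ⟨_, Or.inl ⟨0, rfl⟩, perp_regLineOne_zero hυ⟩

theorem act_image_regulusTwo (h16 : ∀ x : K, x ^ 16 = x) (hυ : υ ^ 4 = υ + 1)
    {g : (Fin 4 → K) ≃ₗ[K] (Fin 4 → K)} (hg : IsSimilarity g)
    (h : act g '' regulusOne 4 υ = regulusOne 4 υ) :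
    act g '' regulusTwo 4 υ = regulusTwo 4 υ := by
  rw [← perp_image_regulusOne h16 hυ]
  conv_rhs => rw [← h]
  rw [Set.image_image, Set.image_image]
  exact Set.image_congr fun l _ => act_perp hg l

theorem shear_image_regulusOne (hυ : υ ^ 4 = υ + 1) :
    act (shear K) '' regulusOne 4 υ = regulusOne 4 υ := by
  apply Set.Subset.antisymm
  · rintro _ ⟨l, (⟨t, rfl⟩ | rfl), rfl⟩
    · exact Or.inl ⟨_, shear_regLineOne hυ t⟩
    · exact Or.inr shear_regLineOneInf
  · rintro _ (⟨t, rfl⟩ | rfl)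
    · refine ⟨_, Or.inl ⟨t - 1, rfl⟩, ?_⟩
      exact (shear_regLineOne hυ _).trans (by rw [sub_add_cancel]; rfl)
    · exact ⟨_, Or.inr rfl, shear_regLineOneInf⟩

theorem flip_image_regulusOne (hυ : υ ^ 4 = υ + 1) :
    act (flip K) '' regulusOne 4 υ = regulusOne 4 υ := by
  apply Set.Subset.antisymm
  · rintro _ ⟨l, (⟨t, rfl⟩ | rfl), rfl⟩
    · by_cases ht : t = 0
      · subst ht
        exact Or.inr (flip_regLineOne_zero hυ)
      · exact Or.inl ⟨_, flip_regLineOne hυ ht⟩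
    · exact Or.inl ⟨0, flip_regLineOneInf hυ⟩
  · rintro _ (⟨t, rfl⟩ | rfl)
    · by_cases ht : t = 0
      · subst ht
        exact ⟨_, Or.inr rfl, flip_regLineOneInf hυ⟩
      · refine ⟨_, Or.inl ⟨t⁻¹, rfl⟩, ?_⟩
        exact (flip_regLineOne hυ (inv_ne_zero ht)).trans (by rw [inv_inv]; rfl)
    · exact ⟨_, Or.inl ⟨0, rfl⟩, flip_regLineOne_zero hυ⟩

theorem diag_image_regulusOne (hυ : υ ^ 4 = υ + 1) :
    act (diag hυ) '' regulusOne 4 υ = regulusOne 4 υ := by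
  apply Set.Subset.antisymm
  · rintro _ ⟨l, (⟨t, rfl⟩ | rfl), rfl⟩
    · exact Or.inl ⟨_, diag_regLineOne hυ t⟩
    · exact Or.inr (diag_regLineOneInf hυ)
  · rintro _ (⟨t, rfl⟩ | rfl)
    · refine ⟨_, Or.inl ⟨υ⁻¹ * t, rfl⟩, ?_⟩
      exact (diag_regLineOne hυ _).trans
        (by rw [mul_inv_cancel_left₀ (ne_zero_of_pow_four_eq hυ)]; rfl)
    · exact ⟨_, Or.inr rfl, diag_regLineOneInf hυ⟩

/-- A similarity that fixes three lines of the first regulus is a scalar. -/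
theorem exists_eq_smul (hυ : υ ^ 4 = υ + 1) {g : (Fin 4 → K) ≃ₗ[K] (Fin 4 → K)}
    (hg : IsSimilarity g) (h0 : act g (regLineOne υ 0) = regLineOne υ 0)
    (h1 : act g (regLineOne υ 1) = regLineOne υ 1)
    (hi : act g (regLineOneInf υ) = regLineOneInf υ) : ∃ c : K, ∀ v, g v = c • v := by
  have h2 : (2 : K) = 0 := CharP.cast_eq_zero K 2
  have k0 : act g (regLineTwoInf υ) = regLineTwoInf υ := by
    rw [← perp_regLineOne_zero hυ, act_perp hg, h0]
  have k1 : act g (regLineTwo υ 1) = regLineTwo υ 1 := by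
    rw [← perp_regLineOne hυ (t := 1) (s := 1) (by norm_num), act_perp hg, h1]
  have ki : act g (regLineTwo υ 0) = regLineTwo υ 0 := by
    rw [← perp_regLineOneInf hυ, act_perp hg, hi]
  have fix : ∀ (l l' : Submodule K (Fin 4 → K)) (e : Fin 4 → K), act g l = l → act g l' = l' →
      (∀ v, v ∈ l → v ∈ l' → ∃ c : K, v = c • e) → e ∈ l → e ∈ l' → ∃ c : K, g e = c • e :=
    fun l l' e hl hl' h he he' => h _ (apply_mem_of_act_eq hl he) (apply_mem_of_act_eq hl' he')
  obtain ⟨a, ha⟩ := fix _ _ ![υ + 1, 1, 0, 0] h0 ki (by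
    intro v hv hv'
    rw [mem_regLineOne hυ] at hv
    rw [mem_regLineTwo hυ] at hv'
    refine ⟨v 1, ?_⟩
    ext i; fin_cases i <;> simp <;> grind)
    ((mem_regLineOne hυ).2 (by simp; grind)) ((mem_regLineTwo hυ).2 (by simp; grind))
  obtain ⟨b, hb⟩ := fix _ _ ![0, 0, 1, 0] h0 k0 (by
    intro v hv hv'
    rw [mem_regLineOne hυ] at hv
    rw [mem_regLineTwoInf] at hv'
    refine ⟨v 2, ?_⟩
    ext i; fin_cases i <;> simp <;> grind)
    ((mem_regLineOne hυ).2 (by simp)) (mem_regLineTwoInf.2 (by simp))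
  obtain ⟨c, hc⟩ := fix _ _ ![0, 0, 0, 1] hi ki (by
    intro v hv hv'
    rw [mem_regLineOneInf] at hv
    rw [mem_regLineTwo hυ] at hv'
    refine ⟨v 3, ?_⟩
    ext i; fin_cases i <;> simp <;> grind)
    (mem_regLineOneInf.2 (by simp)) ((mem_regLineTwo hυ).2 (by simp))
  obtain ⟨d, hd⟩ := fix _ _ ![υ, 1, 0, 0] hi k0 (by
    intro v hv hv'
    rw [mem_regLineOneInf] at hv
    rw [mem_regLineTwoInf] at hv'
    refine ⟨v 1, ?_⟩
    ext i; fin_cases i <;> simp <;> grind)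
    (mem_regLineOneInf.2 (by simp; grind)) (mem_regLineTwoInf.2 (by simp; grind))
  have hca : c = a := by
    have := apply_mem_of_act_eq h1 (v := ![υ + 1, 1, 0, 0] + ![0, 0, 0, 1])
      ((mem_regLineOne hυ).2 (by simp; grind))
    rw [map_add, ha, hc, mem_regLineOne hυ] at this
    simp at this
    grind
  have hdb : d = b := by
    have := apply_mem_of_act_eq h1 (v := ![υ, 1, 0, 0] + ![0, 0, 1, 0])
      ((mem_regLineOne hυ).2 (by simp; grind))
    rw [map_add, hd, hb, mem_regLineOne hυ] at this
    simp at this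
    grind
  have hba : b = a := by
    have := apply_mem_of_act_eq k1 (v := ![υ + 1, 1, 0, 0] + ![0, 0, 1, 0])
      ((mem_regLineTwo hυ).2 (by simp; grind))
    rw [map_add, ha, hb, mem_regLineTwo hυ] at this
    simp at this
    grind
  refine ⟨a, fun v => ?_⟩
  have hv : v = (v 0 + υ * v 1) • ![υ + 1, 1, 0, 0] + (v 0 + (υ + 1) * v 1) • ![υ, 1, 0, 0] +
      v 2 • ![0, 0, 1, 0] + v 3 • ![0, 0, 0, 1] := by
    ext i; fin_cases i <;> simp <;> grind
  conv_lhs => rw [hv]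
  conv_rhs => rw [hv]
  rw [map_add, map_add, map_add, map_smul, map_smul, map_smul, map_smul, ha, hb, hc, hd, hca, hdb,
    hba, smul_add, smul_add, smul_add, smul_comm a, smul_comm a, smul_comm a, smul_comm a]

end Reguli

/-- The code of a power of `υ`. -/
def powCode : ℕ → ℕ
  | 0 => 1
  | n + 1 => mulCode 2 (powCode n)

theorem exists_powCode_mul_eq_one :
    ∀ a < 16, a ≠ 0 → ∃ j < 15, mulCode (powCode j) a = 1 := by
  decide +kernel

section Orbits

theorem act_eq_self_of_smul {K : Type*} [Field K] {g : (Fin 4 → K) ≃ₗ[K] (Fin 4 → K)}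
    {c : K} (h : ∀ v, g v = c • v) (l : Submodule K (Fin 4 → K)) : act g l = l := by
  refine Submodule.eq_of_le_of_finrank_eq ?_ (LinearEquiv.finrank_map_eq g l)
  rintro _ ⟨v, hv, rfl⟩
  exact (h v).symm ▸ l.smul_mem c hv

variable {K : Type*} [Field K] [CharP K 2] {υ : K}

theorem dec_powCode (hυ : υ ^ 4 = υ + 1) (n : ℕ) : dec υ (powCode n) = υ ^ n := by
  induction n with
  | zero => simp [powCode]
  | succ n ih => rw [powCode, dec_mulCode hυ, ih, dec_two, pow_succ']

theorem exists_pow_mul_eq_one (hK : Nat.card K = 4 ^ 2) (hυ : υ ^ 4 = υ + 1) {t : K}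
    (ht : t ≠ 0) : ∃ j, υ ^ j * t = 1 := by
  obtain ⟨a, ha, rfl⟩ := exists_dec_eq hυ hK t
  obtain ⟨j, -, hj⟩ := exists_powCode_mul_eq_one a ha (by rintro rfl; simp at ht)
  exact ⟨j, by rw [← dec_powCode hυ, ← dec_mulCode hυ, hj, dec_one]⟩

/-- The group generated by the first three generators. -/
def orbitGroup (hυ : υ ^ 4 = υ + 1) : Subgroup ((Fin 4 → K) ≃ₗ[K] (Fin 4 → K)) :=
  Subgroup.closure {shear K, flip K, diag hυ}

theorem shear_mem_orbitGroup (hυ : υ ^ 4 = υ + 1) : shear K ∈ orbitGroup hυ :=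
  Subgroup.subset_closure (by simp)

theorem flip_mem_orbitGroup (hυ : υ ^ 4 = υ + 1) : flip K ∈ orbitGroup hυ :=
  Subgroup.subset_closure (by simp)

theorem diag_mem_orbitGroup (hυ : υ ^ 4 = υ + 1) : diag hυ ∈ orbitGroup hυ :=
  Subgroup.subset_closure (by simp)

theorem gen_mem_orbitGroup (hυ : υ ^ 4 = υ + 1) : ∀ g < 3, gen hυ g ∈ orbitGroup hυ
  | 0, _ => shear_mem_orbitGroup hυ
  | 1, _ => flip_mem_orbitGroup hυ
  | 2, _ => diag_mem_orbitGroup hυ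

theorem orbitGroup_induction (hυ : υ ^ 4 = υ + 1)
    {S : Set (Submodule K (Fin 4 → K))} (h : ∀ g < 3, act (gen hυ g) '' S = S)
    {g : (Fin 4 → K) ≃ₗ[K] (Fin 4 → K)} (hg : g ∈ orbitGroup hυ) : act g '' S = S := by
  refine Subgroup.closure_induction (p := fun g _ => act g '' S = S) ?_ (act_image_one S) ?_ ?_ hg
  · rintro _ (rfl | rfl | rfl)
    exacts [h 0 (by norm_num), h 1 (by norm_num), h 2 (by norm_num)]
  · intro g h _ _ hg hh
    rw [act_image_mul, hh, hg]
  · intro g _ hg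
    exact act_image_inv hg

theorem isSimilarity_of_mem_orbitGroup (hυ : υ ^ 4 = υ + 1)
    {g : (Fin 4 → K) ≃ₗ[K] (Fin 4 → K)} (hg : g ∈ orbitGroup hυ) : IsSimilarity g := by
  refine Subgroup.closure_induction (p := fun g _ => IsSimilarity g) ?_ IsSimilarity.one
    (fun _ _ _ _ => IsSimilarity.mul) (fun _ _ => IsSimilarity.inv) hg
  rintro _ (rfl | rfl | rfl)
  exacts [isSimilarity_shear, isSimilarity_flip, isSimilarity_diag hυ]

theorem orbitGroup_image_regulusOne (hυ : υ ^ 4 = υ + 1)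
    {g : (Fin 4 → K) ≃ₗ[K] (Fin 4 → K)} (hg : g ∈ orbitGroup hυ) :
    act g '' regulusOne 4 υ = regulusOne 4 υ :=
  orbitGroup_induction hυ (fun
    | 0, _ => shear_image_regulusOne hυ
    | 1, _ => flip_image_regulusOne hυ
    | 2, _ => diag_image_regulusOne hυ) hg

theorem mem_omegaMinus_of_mem_orbitGroup (h16 : ∀ x : K, x ^ 16 = x) (hυ : υ ^ 4 = υ + 1)
    {g : (Fin 4 → K) ≃ₗ[K] (Fin 4 → K)} (hg : g ∈ orbitGroup hυ) : g ∈ omegaMinus 4 υ :=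
  have h := orbitGroup_image_regulusOne hυ hg
  have hs := isSimilarity_of_mem_orbitGroup hυ hg
  ⟨hs, h, act_image_regulusTwo h16 hυ hs h⟩

theorem exists_scale (hK : Nat.card K = 4 ^ 2) (hυ : υ ^ 4 = υ + 1) {t : K} (ht : t ≠ 0) :
    ∃ h ∈ orbitGroup hυ, act h (regLineOneInf υ) = regLineOneInf υ ∧
      act h (regLineOne υ 0) = regLineOne υ 0 ∧ act h (regLineOne υ t) = regLineOne υ 1 := by
  obtain ⟨j, hj⟩ := exists_pow_mul_eq_one hK hυ ht
  have key : ∀ (i : ℕ) (s : K), act (diag hυ ^ i) (regLineOne υ s) = regLineOne υ (υ ^ i * s) := by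
    intro i s
    induction i with
    | zero => rw [pow_zero, act_one, pow_zero, one_mul]
    | succ i ih => rw [pow_succ', act_mul, ih, diag_regLineOne, pow_succ', mul_assoc]
  refine ⟨diag hυ ^ j, pow_mem (diag_mem_orbitGroup hυ) j, ?_, by rw [key, mul_zero],
    by rw [key, hj]⟩
  clear hj
  induction j with
  | zero => rw [pow_zero, act_one]
  | succ i ih => rw [pow_succ', act_mul, ih, diag_regLineOneInf]

theorem exists_translate (hK : Nat.card K = 4 ^ 2) (hυ : υ ^ 4 = υ + 1) (t : K) :
    ∃ h ∈ orbitGroup hυ, act h (regLineOneInf υ) = regLineOneInf υ ∧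
      act h (regLineOne υ t) = regLineOne υ 0 := by
  have h2 : (2 : K) = 0 := CharP.cast_eq_zero K 2
  by_cases ht : t = 0
  · exact ⟨1, one_mem _, act_one _, by rw [ht, act_one]⟩
  · obtain ⟨h, hh, hi, -, h1⟩ := exists_scale hK hυ ht
    refine ⟨shear K * h, mul_mem (shear_mem_orbitGroup hυ) hh, ?_, ?_⟩
    · rw [act_mul, hi, shear_regLineOneInf]
    · rw [act_mul, h1, shear_regLineOne hυ, one_add_one_eq_two, h2]

theorem regLineOne_ne_inf (hυ : υ ^ 4 = υ + 1) (t : K) : regLineOne υ t ≠ regLineOneInf υ := by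
  have h2 : (2 : K) = 0 := CharP.cast_eq_zero K 2
  intro h
  have : ![t * υ, t, 1, 0] ∈ regLineOne υ t := (mem_regLineOne hυ).2 (by simp; grind)
  rw [h, mem_regLineOneInf] at this
  simp at this

theorem regLineOne_one_ne_zero (hυ : υ ^ 4 = υ + 1) : regLineOne υ 1 ≠ regLineOne υ 0 := by
  have h2 : (2 : K) = 0 := CharP.cast_eq_zero K 2
  intro h
  have : ![υ, 1, 1, 0] ∈ regLineOne υ 1 := (mem_regLineOne hυ).2 (by simp; grind)
  rw [h, mem_regLineOne hυ] at this
  simp at this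
  grind

/-- The group of the two reguli is generated by the first three generators, up to scalars. -/
theorem exists_mul_eq_smul (hK : Nat.card K = 4 ^ 2) (hυ : υ ^ 4 = υ + 1)
    {g : (Fin 4 → K) ≃ₗ[K] (Fin 4 → K)} (hg : g ∈ omegaMinus 4 υ) :
    ∃ h ∈ orbitGroup hυ, ∃ c : K, ∀ v, (h * g) v = c • v := by
  obtain ⟨hs, hreg, -⟩ := hg
  have image : ∀ h ∈ orbitGroup hυ, ∀ l ∈ regulusOne 4 υ, act (h * g) l ∈ regulusOne 4 υ := by
    intro h hh l hl
    have h1 : act g l ∈ regulusOne 4 υ := hreg ▸ Set.mem_image_of_mem (act g) hl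
    have h2 := Set.mem_image_of_mem (act h) h1
    rwa [orbitGroup_image_regulusOne hυ hh, ← act_mul] at h2
  have exists_fix_inf : ∃ h ∈ orbitGroup hυ, act (h * g) (regLineOneInf υ) = regLineOneInf υ := by
    rcases image 1 (one_mem _) (regLineOneInf υ) (Or.inr rfl) with ⟨t, ht⟩ | hi
    · obtain ⟨h, hh, -, h0⟩ := exists_translate hK hυ t
      refine ⟨flip K * h, mul_mem (flip_mem_orbitGroup hυ) hh, ?_⟩
      rw [one_mul] at ht
      rw [act_mul, act_mul, ht]
      exact (congrArg _ h0).trans (flip_regLineOne_zero hυ)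
    · exact ⟨1, one_mem _, hi⟩
  obtain ⟨a, ha, hai⟩ := exists_fix_inf
  have exists_fix_zero : ∃ h ∈ orbitGroup hυ, act (h * g) (regLineOneInf υ) = regLineOneInf υ ∧
      act (h * g) (regLineOne υ 0) = regLineOne υ 0 := by
    rcases image a ha (regLineOne υ 0) (Or.inl ⟨0, rfl⟩) with ⟨t, ht⟩ | hi
    · obtain ⟨h, hh, h1, h0⟩ := exists_translate hK hυ t
      refine ⟨h * a, mul_mem hh ha, ?_, ?_⟩
      · rw [mul_assoc, act_mul, hai, h1]
      · rw [mul_assoc, act_mul, ht]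
        exact h0
    · exact absurd (act_injective _ (hi.trans hai.symm)) (regLineOne_ne_inf hυ 0)
  obtain ⟨b, hb, hbi, hb0⟩ := exists_fix_zero
  have exists_fix_one : ∃ h ∈ orbitGroup hυ, act (h * g) (regLineOneInf υ) = regLineOneInf υ ∧
      act (h * g) (regLineOne υ 0) = regLineOne υ 0 ∧
      act (h * g) (regLineOne υ 1) = regLineOne υ 1 := by
    rcases image b hb (regLineOne υ 1) (Or.inl ⟨1, rfl⟩) with ⟨t, ht⟩ | hi
    · have ht0 : t ≠ 0 := by
        rintro rfl
        exact regLineOne_one_ne_zero hυ (act_injective _ (ht.trans hb0.symm))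
      obtain ⟨h, hh, h1, h0, ht1⟩ := exists_scale hK hυ ht0
      refine ⟨h * b, mul_mem hh hb, ?_, ?_, ?_⟩
      · rw [mul_assoc, act_mul, hbi, h1]
      · rw [mul_assoc, act_mul, hb0, h0]
      · rw [mul_assoc, act_mul, ht]
        exact ht1
    · exact absurd (act_injective _ (hi.trans hbi.symm)) (regLineOne_ne_inf hυ 1)
  obtain ⟨h, hh, h1, h2, h3⟩ := exists_fix_one
  exact ⟨h, hh, exists_eq_smul hυ ((isSimilarity_of_mem_orbitGroup hυ hh).mul hs) h2 h3 h1⟩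

/-- The orbits on a set of lines that is an orbit of the group of the first three generators. -/
theorem omegaMinus_orbit_eq (hK : Nat.card K = 4 ^ 2) (hυ : υ ^ 4 = υ + 1)
    {S : Set (Submodule K (Fin 4 → K))} {r : Submodule K (Fin 4 → K)}
    (hS : ∀ g < 3, act (gen hυ g) '' S = S)
    (hr : ∀ l ∈ S, ∃ g ∈ orbitGroup hυ, act g r = l) {l : Submodule K (Fin 4 → K)} (hl : l ∈ S) :
    {m | ∃ g ∈ omegaMinus 4 υ, m = act g l} = S := by
  have h16 := pow_sixteen_of_card hK
  apply Set.Subset.antisymm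
  · rintro _ ⟨g, hg, rfl⟩
    obtain ⟨h, hh, c, hc⟩ := exists_mul_eq_smul hK hυ hg
    have h1 : act g l = act h⁻¹ l := by
      rw [← act_inv_act h (act g l), ← act_mul h g, act_eq_self_of_smul hc]
    rw [h1, ← orbitGroup_induction hυ hS (inv_mem hh)]
    exact Set.mem_image_of_mem _ hl
  · intro m hm
    obtain ⟨a, ha, ham⟩ := hr m hm
    obtain ⟨b, hb, hbl⟩ := hr l hl
    refine ⟨a * b⁻¹, mem_omegaMinus_of_mem_orbitGroup h16 hυ (mul_mem ha (inv_mem hb)), ?_⟩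
    rw [← hbl, act_mul, act_inv_act, ham]

theorem exists_act_of_reach (hυ : υ ^ 4 = υ + 1) {steps : List (ℕ × ℕ × ℕ)} {r s : ℕ}
    (hr : r < 240) (hs : ∀ i, digit s i = 1 → i = r) :
    ∀ l ∈ lineSet υ (reach lineStepOk steps s), ∃ g ∈ orbitGroup hυ, act g (line υ r) = l := by
  rintro _ ⟨n, hn, hd, rfl⟩
  have := reach_induction (ok := lineStepOk) (r := fun n => n < 240 ∧ ∃ g ∈ orbitGroup hυ,
    act g (line υ r) = line υ n) ?_ steps s ?_ n hd
  · exact this.2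
  · rintro p g k hok ⟨hp, f, hf, hfe⟩
    simp only [lineStepOk, Bool.and_eq_true, Nat.beq_eq, Nat.blt_eq] at hok
    obtain ⟨rfl, hg⟩ := hok
    refine ⟨(perm_valid g (by omega) p hp).1, gen hυ g * f,
      mul_mem (gen_mem_orbitGroup hυ g hg) hf, ?_⟩
    rw [act_mul, hfe, act_gen_line hυ (by omega) hp]
  · intro i hi
    rw [hs i hi]
    exact ⟨hr, 1, one_mem _, act_one _⟩

theorem omegaMinus_orbit_mem_solutions (hK : Nat.card K = 4 ^ 2) (hυ : υ ^ 4 = υ + 1)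
    {l : Submodule K (Fin 4 → K)} (hl : l ∈ externalLines 4) :
    ∃ M ∈ solutions, {m | ∃ g ∈ omegaMinus 4 υ, m = act g l} = lineSet υ M := by
  have hsol : baseSolution ∈ halfSolutions := by decide +kernel
  have hlt := ((mem_halfSolutions _).1 hsol).1
  obtain ⟨n, hn, rfl⟩ := exists_line_eq hK hυ hl
  have hc := digit_compl hlt hn
  rcases digit_le_one baseSolution n with h | h
  · refine ⟨_, List.mem_append_right _ (List.mem_map_of_mem hsol), omegaMinus_orbit_eq hK hυ
      (r := line υ 1) (fun g hg => act_gen_lineSet hυ (by omega) (baseSolution_compl_stable g hg)) ?_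
      ⟨n, hn, by omega, rfl⟩⟩
    rw [← reach_orbitStepsOne]
    refine exists_act_of_reach hυ (by norm_num) fun i hi => ?_
    rw [digit_eq, show (2 : ℕ) = 2 ^ 1 from rfl, Nat.testBit_two_pow] at hi
    by_contra hne
    simp [Ne.symm hne] at hi
  · refine ⟨_, List.mem_append_left _ hsol, omegaMinus_orbit_eq hK hυ
      (r := line υ 0) (fun g hg => act_gen_lineSet hυ (by omega) (baseSolution_stable g hg)) ?_
      ⟨n, hn, h, rfl⟩⟩
    rw [← reach_orbitStepsZero]
    refine exists_act_of_reach hυ (by norm_num) fun i hi => ?_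
    rw [digit_eq, show (1 : ℕ) = 2 ^ 0 from rfl, Nat.testBit_two_pow] at hi
    by_contra hne
    simp [Ne.symm hne] at hi

end Orbits

end RelHemi

theorem mainTheorem7 {K : Type*} [Field K] (hK : Nat.card K = 4 ^ 2) :
    {R : Set (Submodule K (Fin 4 → K)) | RelHemi.IsRelativeHemisystem 4 R}.ncard = 240 ∧
    (∃ R₀ : Set (Submodule K (Fin 4 → K)), RelHemi.IsPenttilaWilliford 4 R₀) ∧
    (∀ R₀ : Set (Submodule K (Fin 4 → K)), RelHemi.IsPenttilaWilliford 4 R₀ →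
      RelHemi.IsRelativeHemisystem 4 R₀ ∧
      ∀ R : Set (Submodule K (Fin 4 → K)), RelHemi.IsRelativeHemisystem 4 R →
        RelHemi.Equivalent 4 R R₀) := by
  have hc := RelHemi.charP_two_of_card hK
  have h2 : (2 : K) = 0 := CharP.cast_eq_zero K 2
  have h16 := RelHemi.pow_sixteen_of_card hK
  have heq : ∀ υ : K, υ ^ 4 + υ = 1 → υ ^ 4 = υ + 1 := fun υ h => by
    linear_combination h - υ * h2
  obtain ⟨υ, hυ'⟩ := RelHemi.exists_pow_four_add_eq_one hK
  have hυ := heq υ hυ'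
  refine ⟨RelHemi.ncard_isRelativeHemisystem hK hυ, ⟨_, υ, hυ', RelHemi.line υ 0,
    RelHemi.line_mem_externalLines h16 hυ (by norm_num), rfl⟩, ?_⟩
  clear! υ
  rintro _ ⟨υ, hυ', l, hl, rfl⟩
  have hυ := heq υ hυ'
  obtain ⟨M, hM, horb⟩ := RelHemi.omegaMinus_orbit_mem_solutions hK hυ hl
  have hR₀ : {m | ∃ g ∈ RelHemi.omegaMinus 4 υ,
      m = Submodule.map (g : (Fin 4 → K) →ₗ[K] (Fin 4 → K)) l} = RelHemi.lineSet υ M := horb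
  rw [hR₀]
  refine ⟨(RelHemi.isRelativeHemisystem_iff_exists hK hυ _).2 ⟨M, hM, rfl⟩, fun R hR => ?_⟩
  obtain ⟨N, hN, rfl⟩ := (RelHemi.isRelativeHemisystem_iff_exists hK hυ R).1 hR
  exact RelHemi.equivalent_of_mem_solutions hυ hN hM
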